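/- **Model.** An alternating Turing machine has a two-way read-only input tape with end markers and finitely many two-way infinite work tapes; its states are existential, universal, accepting or rejecting, and the last two kinds are halting. An alternation is a step between an existential and a universal state. Languages are sets of words over a finite alphabet. For a set $F$ of functions $\mathbb N\to\mathbb N$: * for $j\ge 1$, $\mathrm{ATIME}(F,j)$ is the class of languages decided, for some $f\in F$, by an alternating Turing machine whose computation paths on every input of length $n$ all halt within $O(f(n))$ steps, begin in an existential state (or in a halting state) and make at most $j-1$ alternations; $\mathrm{ATIME}(F,0)$ is the class of languages decided in $O(f(n))$ steps, $f\in F$, by deterministic machines; * $\mathrm{coATIME}(F,j)$ is the class of complements of the languages in $\mathrm{ATIME}(F,j)$; * $\mathrm{SPACE}(F)$ is the class of languages decided, for some $f\in F$, by an always halting deterministic machine that visits $O(f(n))$ work-tape cells on inputs of length $n$. (Here $O(f(n))$ means at most $b\,f(n)+b$ for a constant $b$.) A function $f$ is time-constructible if $f(n)\ge n$ for all $n$ and a deterministic machine, on input $1^n$, halts within $O(f(n))$ steps with $f(n)$ written in unary on a work tape. $F$ collapses to level $j$ if $\mathrm{ATIME}(F,j)=\mathrm{ATIME}(F,k)$ for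 all $k\ge j$. Let $\exp_2^0(x)=x$, $\exp_2^{r+1}(x)=2^{\exp_2^{r}(x)}$ and $E_r=\exp_2^r(n^{O(1)})=\{n\mapsto\exp_2^r(n^c) : c\in\mathbb N\}$. **Theorem.** Let $D$ be a set of functions $\mathbb N\to\mathbb N$ containing all the linear functions $n\mapsto an$, $a\ge 1$. Let $C$ be a set of time-constructible functions closed under addition and such that $g\circ f\in C$ for all $g\in D$, $f\in C$. Let $j\ge 0$. 1. If $\mathrm{ATIME}(D,j)=\mathrm{ATIME}(D,j+1)$, or if $j\ge 1$ and $\mathrm{ATIME}(D,j)=\mathrm{coATIME}(D,j)$, then $\mathrm{ATIME}(C,k)=\mathrm{coATIME}(C,k)=\mathrm{ATIME}(C,j)$ for all $k\ge j$. 2. If $\mathrm{ATIME}(D,j)=\mathrm{SPACE}(D)$, then $\mathrm{ATIME}(C,j)=\mathrm{SPACE}(C)$. **Corollary.** Let $j,r\ge 0$. If the polynomial hierarchy $\mathrm{ATIME}(E_0,\cdot)$ collapses to level $j$, then so does the $r$-th exponential hierarchy $\mathrm{ATIME}(E_r,\cdot)$. If the linear hierarchy $\mathrm{ATIME}(O(n),\cdot)$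 collapses to level $j$, then so does the $r$-th exponential hierarchy. If $\mathrm{SPACE}(E_0)\subseteq\mathrm{ATIME}(E_0,j)$ (that is, $\mathrm{PSPACE}\subseteq\Sigma^p_j$), then $\mathrm{SPACE}(E_r)\subseteq\mathrm{ATIME}(E_r,j)$. -/

import Mathlib

namespace AltTM

/-- Label of a state of an alternating Turing machine. States labelled `accept` or `reject`
are halting. -/
inductive Label where
  | ex | all | accept | reject

/-- Head movements. -/
inductive Dir where
  | left | stay | right

/-- Content of a cell of the input tape: a letter, or one of the two end markers. -/
inductive InSym (α : Type) where
  | leftEnd | letter (a : α) | rightEnd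

/-- What a machine does in one step: new state, move of the input head, symbols written
on the work tapes, moves of the work heads. -/
structure Action (State Sym Tape : Type) where
  state : State
  inMove : Dir
  write : Tape → Sym
  move : Tape → Dir

/-- An alternating Turing machine with a two-way read-only input tape over the alphabet `α`
and finitely many two-way infinite work tapes. -/
structure ATM (α : Type) where
  State : Type
  Sym : Type
  Tape : Type
  finState : Finite State
  finSym : Finite Sym
  finTape : Finite Tape
  blank : Sym
  start : State
  label : State → Label
  /-- The possible actions, given the state, the scanned input cell and the scanned work
  cells. -/
  trans : State → InSym α → (Tape → Sym) → Set (Action State Sym Tape)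

/-- Cell `p` of the input tape carrying the word `x`: the left end marker is in cell `0`, the
letters are in the cells `1, …, |x|`, the right end marker is in cell `|x| + 1`. -/
def readInput {α : Type} (x : List α) (p : ℕ) : InSym α :=
  if p = 0 then .leftEnd
  else match x[p - 1]? with
    | some a => .letter a
    | none => .rightEnd

/-- Movement of the input head, which never leaves the cells `0, …, n + 1`. -/
def moveInput (n p : ℕ) : Dir → ℕ
  | .left => p - 1
  | .stay => p
  | .right => min (p + 1) (n + 1)

/-- Movement of a work head. -/
def moveWork (p : ℤ) : Dir → ℤ
  | .left => p - 1
  | .stay => p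
  | .right => p + 1

namespace ATM

variable {α : Type} (M : ATM α)

/-- Configurations. -/
structure Cfg where
  state : M.State
  inPos : ℕ
  head : M.Tape → ℤ
  tape : M.Tape → ℤ → M.Sym

/-- The initial configuration: all work tapes are blank, the input head is on the first
letter (on the right end marker if the input is empty). -/
def init : M.Cfg where
  state := M.start
  inPos := 1
  head := fun _ => 0
  tape := fun _ _ => M.blank

/-- The configuration obtained from `c` by the action `a`, on an input of length `n`. -/
def apply (n : ℕ) (c : M.Cfg) (a : Action M.State M.Sym M.Tape) : M.Cfg where
  state := a.state
  inPos := moveInput n c.inPos a.inMove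
  head := fun i => moveWork (c.head i) (a.move i)
  tape := fun i => Function.update (c.tape i) (c.head i) (a.write i)

/-- One step of computation on the input `x`; there is none from a halting state. -/
def Step (x : List α) (c c' : M.Cfg) : Prop :=
  (M.label c.state = .ex ∨ M.label c.state = .all) ∧
  ∃ a ∈ M.trans c.state (readInput x c.inPos) (fun i => c.tape i (c.head i)),
    c' = M.apply x.length c a

/-- Going from `l` to `l'` is an alternation. -/
def Alternates (l l' : Label) : Prop :=
  (l = .ex ∧ l' = .all) ∨ (l = .all ∧ l' = .ex)

/-- `M.Reaches x t a c`: some computation path on input `x` leads from the initial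
configuration to `c` in exactly `t` steps with exactly `a` alternations. -/
inductive Reaches (x : List α) : ℕ → ℕ → M.Cfg → Prop where
  | init : Reaches x 0 0 M.init
  | same {t a : ℕ} {c c' : M.Cfg} : Reaches x t a c → M.Step x c c' →
      ¬ Alternates (M.label c.state) (M.label c'.state) → Reaches x (t + 1) a c'
  | alt {t a : ℕ} {c c' : M.Cfg} : Reaches x t a c → M.Step x c c' →
      Alternates (M.label c.state) (M.label c'.state) → Reaches x (t + 1) (a + 1) c'

/-- Alternating acceptance from a configuration. -/
inductive AcceptsFrom (x : List α) : M.Cfg → Prop where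
  | accept {c : M.Cfg} : M.label c.state = .accept → AcceptsFrom x c
  | ex {c c' : M.Cfg} : M.label c.state = .ex → M.Step x c c' → AcceptsFrom x c' →
      AcceptsFrom x c
  | all {c : M.Cfg} : M.label c.state = .all → (∀ c', M.Step x c c' → AcceptsFrom x c') →
      AcceptsFrom x c

/-- The language of `M`. -/
def language : Set (List α) := {x | M.AcceptsFrom x M.init}

/-- On every input, every computation path has at most `T n` steps, `n` being the length of
the input; in particular `M` always halts. -/
def TimeBounded (T : ℕ → ℕ) : Prop :=
  ∀ x t a c, M.Reaches x t a c → t ≤ T x.length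

/-- `M` always halts. -/
def Halts : Prop :=
  ∀ x, ∃ B : ℕ, ∀ t a c, M.Reaches x t a c → t ≤ B

/-- On every input of length `n`, at most `S n` cells of the work tapes are visited. -/
def SpaceBounded (S : ℕ → ℕ) : Prop :=
  ∀ x : List α, Set.encard {ip : M.Tape × ℤ | ∃ t a c, M.Reaches x t a c ∧ c.head ip.1 = ip.2}
    ≤ (S x.length : ℕ∞)

/-- Deterministic machines: at most one possible action in every situation. -/
def Deterministic : Prop :=
  ∀ q s w, (M.trans q s w).Subsingleton

/-- Machines of level `j`: deterministic ones for `j = 0`; for `j ≥ 1` those that begin by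
existential states and make at most `j - 1` alternations on every path. -/
def HasLevel : ℕ → Prop
  | 0 => M.Deterministic
  | j + 1 => M.label M.start ≠ .all ∧ ∀ x t a c, M.Reaches x t a c → a ≤ j

end ATM

/-- A language over some finite alphabet `Fin m`. -/
abbrev Lang : Type := Σ m : ℕ, Set (List (Fin m))

/-- The complement of a language, over the same alphabet. -/
def Lang.compl (L : Lang) : Lang := ⟨L.1, L.2ᶜ⟩

/-- `Σ_j TIME(F)`: the languages decided, for some `f ∈ F`, by an alternating Turing machine of
level `j` in time `O(f(n))`. The additive constant only matters where `f` vanishes. -/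
def ATIME (F : Set (ℕ → ℕ)) (j : ℕ) : Set Lang :=
  {L | ∃ f ∈ F, ∃ (b : ℕ) (M : ATM (Fin L.1)),
    M.HasLevel j ∧ M.TimeBounded (fun n => b * f n + b) ∧ M.language = L.2}

/-- The languages whose complement is in `ATIME F j`. -/
def coATIME (F : Set (ℕ → ℕ)) (j : ℕ) : Set Lang :=
  {L | L.compl ∈ ATIME F j}

/-- `SPACE(F)`: the languages decided, for some `f ∈ F`, by a deterministic Turing machine
using `O(f(n))` cells of its work tapes. -/
def SPACE (F : Set (ℕ → ℕ)) : Set Lang :=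
  {L | ∃ f ∈ F, ∃ (b : ℕ) (M : ATM (Fin L.1)),
    M.Deterministic ∧ M.Halts ∧ M.SpaceBounded (fun n => b * f n + b) ∧ M.language = L.2}

/-- `f` is time-constructible: `n ≤ f n`, and some deterministic Turing machine on the input
`1ⁿ` halts after `O(f(n))` steps with `f(n)` written in unary on one of its work tapes. -/
def TimeConstructible (f : ℕ → ℕ) : Prop :=
  (∀ n, n ≤ f n) ∧
  ∃ (M : ATM Unit) (out : M.Tape) (one : M.Sym) (b : ℕ),
    M.Deterministic ∧ one ≠ M.blank ∧
    ∀ n, ∃ t a c, M.Reaches (List.replicate n ()) t a c ∧ t ≤ b * f n + b ∧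
      M.label c.state = .accept ∧
      (∀ p : ℤ, 0 ≤ p → p < (f n : ℤ) → c.tape out p = one) ∧
      (∀ p : ℤ, (p < 0 ∨ (f n : ℤ) ≤ p) → c.tape out p = M.blank)

/-- `F` collapses to level `j`. -/
def CollapsesTo (F : Set (ℕ → ℕ)) (j : ℕ) : Prop :=
  ∀ k, j ≤ k → ATIME F j = ATIME F k

/-- The linear bounds `O(n)`. -/
def linearBounds : Set (ℕ → ℕ) :=
  {f | ∃ a : ℕ, f = fun n => a * n}

/-- The bounds `exp₂^r (n^{O(1)})`, with `r` exponentiations of `2`; for `r = 0` these are the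
polynomial bounds. -/
def expBounds (r : ℕ) : Set (ℕ → ℕ) :=
  {f | ∃ c : ℕ, f = fun n => (fun m => 2 ^ m)^[r] (n ^ c)}

end AltTM

open AltTM

/-!
The proof is by padding. For a machine `M` with bounds in `C`, take a function `h ∈ C` above its
running time. Append to the input `x` blanks up to the length `h |x|`; on the padded word, `M` runs
in linear time. More generally, let a second track of the padded word hold the actions of `M` on a
path up to its `m`-th alternation. The replaying machine (`ATM.replay`) simulates `M` on such a
word, following the recorded actions as long as there are any. In doing so it can stay in states of
the kind that `M` has after the `m`-th alternation, so that the first `m` alternations of `M` are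
saved. Words that do not arise in this way do no harm, because a clock, which is the second track
itself, stops the machine after linearly many steps. If only the space of `M` is bounded, the clock
advances whenever a new cell is visited; hence it bounds the space, and the simulation halts
because `M` does.

So questions about `M` become members of a class with bounds in `D`, to which the hypothesis
applies and gives a machine `M'` with the same language and other properties. The asking machine
(`ATM.ask`) computes `h |x|` in unary, by time-constructibility, simulates `M` on its input up to
the `m`-th alternation while writing the padded word with the actions taken, and then runs `M'` on
this word. Its bounds are again in `C`, since `C` is closed under addition and under composition
with `D`.

With `m = 0` this transfers inclusions between the classes (`TransferPair.atime_subset_atime`,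
`TransferPair.atime_subset_space`, `TransferPair.space_subset_atime`). For the collapse, let level
`j ≥ 1` of `D` be closed under complement and let `M` be of level `k + 1` with `k ≥ j`. With
`m = k + 1 - j`, the replaying machine or its dual is of level `j`. By hypothesis its language is
decided by a machine of level `j` and also by the dual of such a machine. One of these begins in states of
the kind that `M` has before the `m`-th alternation, and so the asking machine makes one
alternation less than `M` (`TransferPair.atime_succ_subset`).

The corollaries follow by taking for `D` the monomials or the linear functions and for `C` all
time-constructible functions below a bound of the exponential hierarchy. This set contains enough
functions because sums, products and powers of two of time-constructible functions are
time-constructible.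
-/

open Relation

namespace AltTM

/-! ### Configurations, acceptance, and bounds on computation paths -/

/-- A configuration without its state: head positions and tape contents. -/
@[ext]
structure Store (Sym Tape : Type) where
  inPos : ℕ
  head : Tape → ℤ
  tape : Tape → ℤ → Sym

namespace Store

variable {Sym Tape σ : Type}

/-- The effect of an action, on an input of length `n`. -/
def act (n : ℕ) (d : Store Sym Tape) (a : Action σ Sym Tape) : Store Sym Tape where
  inPos := moveInput n d.inPos a.inMove
  head := fun i => moveWork (d.head i) (a.move i)
  tape := fun i => Function.update (d.tape i) (d.head i) (a.write i)

/-- The scanned work symbols. -/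
def scan (d : Store Sym Tape) : Tape → Sym := fun i => d.tape i (d.head i)

/-- Blank tapes, heads at the start. -/
def initial (s : Sym) : Store Sym Tape := ⟨1, fun _ => 0, fun _ _ => s⟩

end Store

/-- Exchange of existential with universal and of accepting with rejecting labels. -/
def Label.swap : Label → Label
  | .ex => .all
  | .all => .ex
  | .accept => .reject
  | .reject => .accept

/-- The number of alternations, `0` or `1`, in going from `l` to `l'`. -/
noncomputable def altCount (l l' : Label) : ℕ := by
  classical exact if ATM.Alternates l l' then 1 else 0

theorem altCount_of (l l' : Label) (h : ATM.Alternates l l') : altCount l l' = 1 := by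
  simp [altCount, h]

theorem altCount_of_not (l l' : Label) (h : ¬ ATM.Alternates l l') : altCount l l' = 0 := by
  simp [altCount, h]

theorem altCount_self (l : Label) : altCount l l = 0 := by
  cases l <;> simp [altCount, ATM.Alternates]

theorem altCount_le (l l' : Label) : altCount l l' ≤ 1 := by
  unfold altCount; split <;> simp

theorem altCount_swap (l l' : Label) : altCount l.swap l'.swap = altCount l l' := by
  cases l <;> cases l' <;> simp [altCount, ATM.Alternates, Label.swap]

namespace ATM

variable {α β : Type}

/-- The configuration with a given state and a given store. -/
def cfg (M : ATM α) (q : M.State) (d : Store M.Sym M.Tape) : M.Cfg :=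
  ⟨q, d.inPos, d.head, d.tape⟩

/-- The store of a configuration. -/
def Cfg.store {M : ATM α} (c : M.Cfg) : Store M.Sym M.Tape := ⟨c.inPos, c.head, c.tape⟩

theorem acceptsFrom_iff_of_ex {M : ATM α} {x : List α} {c : M.Cfg} (h : M.label c.state = .ex) :
    M.AcceptsFrom x c ↔ ∃ c', M.Step x c c' ∧ M.AcceptsFrom x c' := by
  constructor
  · intro h'
    cases h' with
    | accept h2 => simp [h] at h2
    | ex _ h2 h3 => exact ⟨_, h2, h3⟩
    | all h2 _ => simp [h] at h2
  · rintro ⟨c', h1, h2⟩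
    exact .ex h h1 h2

theorem acceptsFrom_iff_of_all {M : ATM α} {x : List α} {c : M.Cfg}
    (h : M.label c.state = .all) :
    M.AcceptsFrom x c ↔ ∀ c', M.Step x c c' → M.AcceptsFrom x c' := by
  constructor
  · intro h'
    cases h' with
    | accept h2 => simp [h] at h2
    | ex h2 _ _ => simp [h] at h2
    | all _ h3 => exact h3
  · exact .all h

theorem not_acceptsFrom_of_reject {M : ATM α} {x : List α} {c : M.Cfg}
    (h : M.label c.state = .reject) : ¬ M.AcceptsFrom x c := by
  intro h'
  cases h' with
  | accept h2 => simp [h] at h2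
  | ex h2 _ _ => simp [h] at h2
  | all h2 _ => simp [h] at h2

theorem not_step_of_halting {M : ATM α} {x : List α} {c c' : M.Cfg}
    (h : M.label c.state = .accept ∨ M.label c.state = .reject) : ¬ M.Step x c c' := by
  rintro ⟨h1, _⟩
  rcases h with h | h <;> simp [h] at h1

/-- Acceptance is preserved by a correspondence between the next configurations. -/
theorem acceptsFrom_congr {M : ATM α} {N : ATM β} {x : List α} {y : List β} {c : M.Cfg}
    {e : N.Cfg} (hl : N.label e.state = M.label c.state)
    (fwd : ∀ c', M.Step x c c' → ∃ e', N.Step y e e' ∧ (M.AcceptsFrom x c' ↔ N.AcceptsFrom y e'))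
    (bwd : ∀ e', N.Step y e e' → ∃ c', M.Step x c c' ∧ (M.AcceptsFrom x c' ↔ N.AcceptsFrom y e')) :
    M.AcceptsFrom x c ↔ N.AcceptsFrom y e := by
  cases h : M.label c.state with
  | ex =>
    rw [acceptsFrom_iff_of_ex h, acceptsFrom_iff_of_ex (hl.trans h)]
    constructor
    · rintro ⟨c', h1, h2⟩
      obtain ⟨e', h3, h4⟩ := fwd c' h1
      exact ⟨e', h3, h4.1 h2⟩
    · rintro ⟨c', h1, h2⟩
      obtain ⟨e', h3, h4⟩ := bwd c' h1
      exact ⟨e', h3, h4.2 h2⟩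
  | all =>
    rw [acceptsFrom_iff_of_all h, acceptsFrom_iff_of_all (hl.trans h)]
    constructor
    · intro h1 e' h2
      obtain ⟨c', h3, h4⟩ := bwd e' h2
      exact h4.1 (h1 c' h3)
    · intro h1 e' h2
      obtain ⟨c', h3, h4⟩ := fwd e' h2
      exact h4.2 (h1 c' h3)
  | accept => exact iff_of_true (.accept h) (.accept (hl.trans h))
  | reject =>
    exact iff_of_false (not_acceptsFrom_of_reject h) (not_acceptsFrom_of_reject (hl.trans h))

theorem acceptsFrom_iff_of_unique {M : ATM α} {x : List α} {c c₁ : M.Cfg} (h : M.Step x c c₁)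
    (hu : ∀ c', M.Step x c c' → c' = c₁) : M.AcceptsFrom x c ↔ M.AcceptsFrom x c₁ := by
  rcases h.1 with hl | hl
  · rw [acceptsFrom_iff_of_ex hl]
    exact ⟨fun ⟨c', h1, h2⟩ => hu c' h1 ▸ h2, fun h2 => ⟨c₁, h, h2⟩⟩
  · rw [acceptsFrom_iff_of_all hl]
    exact ⟨fun h2 => h2 _ h, fun h2 c' h1 => hu c' h1 ▸ h2⟩

/-- Every computation path from `c` has at most `T` steps and at most `A` alternations. -/
inductive Bdd {M : ATM α} (x : List α) : M.Cfg → ℕ → ℕ → Prop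
  | intro {c : M.Cfg} {T A : ℕ} (T' A' : M.Cfg → ℕ) (hT : ∀ c', M.Step x c c' → T' c' + 1 ≤ T)
      (hA : ∀ c', M.Step x c c' → A' c' + altCount (M.label c.state) (M.label c'.state) ≤ A)
      (h : ∀ c', M.Step x c c' → Bdd x c' (T' c') (A' c')) : Bdd x c T A

theorem Bdd.mk {M : ATM α} {x : List α} {c : M.Cfg} {T A : ℕ}
    (h : ∀ c', M.Step x c c' → ∃ T' A', T' + 1 ≤ T ∧
      A' + altCount (M.label c.state) (M.label c'.state) ≤ A ∧ Bdd x c' T' A') : Bdd x c T A := by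
  classical
  choose! T' A' h1 h2 h3 using h
  exact .intro T' A' h1 h2 h3

theorem Bdd.next {M : ATM α} {x : List α} {c : M.Cfg} {T A : ℕ} (h : Bdd x c T A) {c' : M.Cfg}
    (h' : M.Step x c c') : ∃ T' A', T' + 1 ≤ T ∧
      A' + altCount (M.label c.state) (M.label c'.state) ≤ A ∧ Bdd x c' T' A' := by
  cases h with
  | intro T' A' h1 h2 h3 => exact ⟨T' c', A' c', h1 c' h', h2 c' h', h3 c' h'⟩

@[elab_as_elim]
theorem Bdd.induct {M : ATM α} {x : List α}
    {motive : (c : M.Cfg) → (T A : ℕ) → Bdd x c T A → Prop}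
    (mk : ∀ c T A (h : Bdd x c T A), (∀ c', M.Step x c c' → ∃ T' A', T' + 1 ≤ T ∧
      A' + altCount (M.label c.state) (M.label c'.state) ≤ A ∧ ∃ h' : Bdd x c' T' A',
      motive c' T' A' h') → motive c T A h) {c : M.Cfg} {T A : ℕ} (h : Bdd x c T A) :
    motive c T A h := by
  induction h with
  | intro T' A' h1 h2 h3 ih =>
    exact mk _ _ _ _ fun c' h' => ⟨T' c', A' c', h1 c' h', h2 c' h', h3 c' h', ih c' h'⟩

theorem Bdd.mono {M : ATM α} {x : List α} {c : M.Cfg} {T A T₁ A₁ : ℕ} (h : Bdd x c T A)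
    (hT : T ≤ T₁) (hA : A ≤ A₁) : Bdd x c T₁ A₁ := by
  refine .mk fun c' h' => ?_
  obtain ⟨T', A', h1, h2, h3⟩ := h.next h'
  exact ⟨T', A', h1.trans hT, h2.trans hA, h3⟩

theorem Bdd.of_halting {M : ATM α} {x : List α} {c : M.Cfg}
    (h : M.label c.state = .accept ∨ M.label c.state = .reject) (T A : ℕ) : Bdd x c T A :=
  .mk fun _ h' => (not_step_of_halting h h').elim

theorem Bdd.alt_le_time {M : ATM α} {x : List α} {c : M.Cfg} {T A : ℕ} (h : Bdd x c T A) :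
    Bdd x c T T := by
  induction h using Bdd.induct with
  | mk c T A h ih =>
    refine .mk fun c' h' => ?_
    obtain ⟨T', A', h1, h2, h3, h4⟩ := ih c' h'
    have := altCount_le (M.label c.state) (M.label c'.state)
    exact ⟨T', T', h1, by omega, h4⟩

theorem Bdd.of_unique {M : ATM α} {x : List α} {c c₁ : M.Cfg} {T A : ℕ}
    (hu : ∀ c', M.Step x c c' → c' = c₁) (h : Bdd x c₁ T A) :
    Bdd x c (T + 1) (A + altCount (M.label c.state) (M.label c₁.state)) :=
  .mk fun c' h' => by
    obtain rfl := hu c' h'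
    exact ⟨T, A, le_rfl, le_rfl, h⟩

/-- What is left of the bounds after `t` steps and `a` alternations. -/
theorem reaches_bounded_of_bdd {M : ATM α} {x : List α} {T A : ℕ} (h : Bdd x M.init T A) {t a : ℕ}
    {c : M.Cfg} (hr : M.Reaches x t a c) : ∃ T' A', t + T' ≤ T ∧ a + A' ≤ A ∧ Bdd x c T' A' := by
  induction hr with
  | init => exact ⟨T, A, by simp, by simp, h⟩
  | same h1 h2 h3 ih =>
    obtain ⟨T', A', h4, h5, h6⟩ := ih
    obtain ⟨T₁, A₁, h7, h8, h9⟩ := h6.next h2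
    rw [altCount_of_not _ _ h3] at h8
    exact ⟨T₁, A₁, by omega, by omega, h9⟩
  | alt h1 h2 h3 ih =>
    obtain ⟨T', A', h4, h5, h6⟩ := ih
    obtain ⟨T₁, A₁, h7, h8, h9⟩ := h6.next h2
    rw [altCount_of _ _ h3] at h8
    exact ⟨T₁, A₁, by omega, by omega, h9⟩

theorem Reaches.step {M : ATM α} {x : List α} {t a : ℕ} {c c' : M.Cfg} (h : M.Reaches x t a c)
    (h' : M.Step x c c') :
    M.Reaches x (t + 1) (a + altCount (M.label c.state) (M.label c'.state)) c' := by
  by_cases h1 : Alternates (M.label c.state) (M.label c'.state)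
  · rw [altCount_of _ _ h1]; exact h.alt h' h1
  · rw [altCount_of_not _ _ h1]; exact h.same h' h1

/-- For the initial configuration, the inductive bound is the one in terms of paths. -/
theorem bdd_init_iff {M : ATM α} {x : List α} {T A : ℕ} :
    Bdd x M.init T A ↔ ∀ t a c, M.Reaches x t a c → t ≤ T ∧ a ≤ A := by
  constructor
  · intro h t a c hr
    obtain ⟨T', A', h1, h2, -⟩ := reaches_bounded_of_bdd h hr
    omega
  · intro h
    suffices H : ∀ k t a c, M.Reaches x t a c → t + k = T → Bdd x c k (A - a) from
      H T 0 0 _ .init (by simp)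
    intro k
    induction k with
    | zero =>
      intro t a c hr ht
      refine .mk fun c' h' => ?_
      have := (h _ _ _ (hr.step h')).1
      omega
    | succ k ih =>
      intro t a c hr ht
      refine .mk fun c' h' => ?_
      have h1 := hr.step h'
      have h2 := (h _ _ _ h1).2
      exact ⟨k, _, le_rfl, by omega, ih _ _ _ h1 (by omega)⟩

/-- `c'` can be reached from `c`. -/
def From (M : ATM α) (x : List α) : M.Cfg → M.Cfg → Prop := ReflTransGen (M.Step x)

theorem Reaches.from {M : ATM α} {x : List α} {t a : ℕ} {c : M.Cfg} (h : M.Reaches x t a c) :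
    M.From x M.init c := by
  induction h with
  | init => exact .refl
  | same _ h2 _ ih => exact ih.tail h2
  | alt _ h2 _ ih => exact ih.tail h2

theorem From.reaches {M : ATM α} {x : List α} {c : M.Cfg} (h : M.From x M.init c) :
    ∃ t a, M.Reaches x t a c := by
  unfold From at h
  induction h with
  | refl => exact ⟨_, _, .init⟩
  | tail _ h2 ih =>
    obtain ⟨t, a, h3⟩ := ih
    exact ⟨_, _, h3.step h2⟩

/-- At most `S` cells of the work tapes are visited on the paths from `c`. -/
def VisitsAtMost (M : ATM α) (x : List α) (c : M.Cfg) (S : ℕ) : Prop :=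
  Set.encard {ip : M.Tape × ℤ | ∃ c', M.From x c c' ∧ c'.head ip.1 = ip.2} ≤ (S : ℕ∞)

theorem visitsAtMost_init_iff {M : ATM α} {x : List α} {S : ℕ} : M.VisitsAtMost x M.init S ↔
    Set.encard {ip : M.Tape × ℤ | ∃ t a c, M.Reaches x t a c ∧ c.head ip.1 = ip.2} ≤ (S : ℕ∞) := by
  unfold VisitsAtMost
  have : {ip : M.Tape × ℤ | ∃ c', M.From x M.init c' ∧ c'.head ip.1 = ip.2} =
      {ip : M.Tape × ℤ | ∃ t a c, M.Reaches x t a c ∧ c.head ip.1 = ip.2} := by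
    ext ip
    constructor
    · rintro ⟨c, h1, h2⟩
      obtain ⟨t, a, h3⟩ := h1.reaches
      exact ⟨t, a, c, h3, h2⟩
    · rintro ⟨t, a, c, h1, h2⟩
      exact ⟨c, h1.from, h2⟩
  rw [this]

/-- `R` is a bisimulation between `M` on `x` and `N` on `y` respecting the labels. -/
structure Bisim (M : ATM α) (N : ATM β) (x : List α) (y : List β) (R : M.Cfg → N.Cfg → Prop) :
    Prop where
  label : ∀ c e, R c e → N.label e.state = M.label c.state
  fwd : ∀ c e c', R c e → M.Step x c c' → ∃ e', N.Step y e e' ∧ R c' e'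
  bwd : ∀ c e e', R c e → N.Step y e e' → ∃ c', M.Step x c c' ∧ R c' e'

namespace Bisim

variable {M : ATM α} {N : ATM β} {x : List α} {y : List β} {R : M.Cfg → N.Cfg → Prop}

theorem acceptsFrom_iff (h : Bisim M N x y R) {c : M.Cfg} {e : N.Cfg} (hR : R c e) :
    M.AcceptsFrom x c ↔ N.AcceptsFrom y e := by
  constructor
  · intro ha
    induction ha generalizing e with
    | accept h1 => exact .accept ((h.label _ _ hR).trans h1)
    | ex h1 h2 _ ih =>
      obtain ⟨e', h4, h5⟩ := h.fwd _ _ _ hR h2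
      exact .ex ((h.label _ _ hR).trans h1) h4 (ih h5)
    | all h1 h2 ih =>
      refine .all ((h.label _ _ hR).trans h1) fun e' h3 => ?_
      obtain ⟨c', h4, h5⟩ := h.bwd _ _ _ hR h3
      exact ih c' h4 h5
  · intro ha
    induction ha generalizing c with
    | accept h1 => exact .accept ((h.label _ _ hR).symm.trans h1)
    | ex h1 h2 _ ih =>
      obtain ⟨e', h4, h5⟩ := h.bwd _ _ _ hR h2
      exact .ex ((h.label _ _ hR).symm.trans h1) h4 (ih h5)
    | all h1 h2 ih =>
      refine .all ((h.label _ _ hR).symm.trans h1) fun e' h3 => ?_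
      obtain ⟨c', h4, h5⟩ := h.fwd _ _ _ hR h3
      exact ih c' h4 h5

theorem bdd (h : Bisim M N x y R) {c : M.Cfg} {e : N.Cfg} (hR : R c e) {T A : ℕ}
    (hb : Bdd x c T A) : Bdd y e T A := by
  induction hb using Bdd.induct generalizing e with
  | mk c T A _ ih =>
    refine .mk fun e' h1 => ?_
    obtain ⟨c', h2, h3⟩ := h.bwd _ _ _ hR h1
    obtain ⟨T', A', h4, h5, -, h6⟩ := ih c' h2
    exact ⟨T', A', h4, by rw [h.label _ _ hR, h.label _ _ h3]; exact h5, h6 h3⟩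

theorem from_bwd (h : Bisim M N x y R) {c : M.Cfg} {e e' : N.Cfg} (hR : R c e)
    (hf : N.From y e e') : ∃ c', M.From x c c' ∧ R c' e' := by
  unfold From at hf
  induction hf with
  | refl => exact ⟨c, .refl, hR⟩
  | tail _ h2 ih =>
    obtain ⟨c', h3, h4⟩ := ih
    obtain ⟨c'', h5, h6⟩ := h.bwd _ _ _ h4 h2
    exact ⟨c'', h3.tail h5, h6⟩

end Bisim

/-! ### The dual machine -/

/-- The dual machine: all labels are exchanged. It decides the complement. -/
def dual (M : ATM α) : ATM α := { M with label := fun q => (M.label q).swap }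

theorem dual_step_iff (M : ATM α) (x : List α) (q : M.State) (d : Store M.Sym M.Tape)
    (q' : M.State) (d' : Store M.Sym M.Tape) :
    M.dual.Step x (M.dual.cfg q d) (M.dual.cfg q' d') ↔ M.Step x (M.cfg q d) (M.cfg q' d') := by
  refine and_congr ?_ (exists_congr fun a => and_congr Iff.rfl ?_)
  · change (M.label q).swap = .ex ∨ (M.label q).swap = .all ↔ M.label q = .ex ∨ M.label q = .all
    cases M.label q <;> simp [Label.swap]
  · have h₁ := Cfg.mk.injEq (M := M.dual) q' d'.inPos d'.head d'.tape a.state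
      (d.act x.length a).inPos (d.act x.length a).head (d.act x.length a).tape
    have h₂ := Cfg.mk.injEq (M := M) q' d'.inPos d'.head d'.tape a.state
      (d.act x.length a).inPos (d.act x.length a).head (d.act x.length a).tape
    exact (Iff.of_eq h₁).trans (Iff.of_eq h₂).symm

theorem Bdd.dual {M : ATM α} {x : List α} {c : M.Cfg} {T A : ℕ} (h : Bdd x c T A) :
    Bdd x (M.dual.cfg c.state c.store) T A := by
  induction h using Bdd.induct with
  | mk c T A h ih =>
    refine .mk fun c' h' => ?_
    obtain ⟨T', A', h1, h2, -, h4⟩ :=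
      ih (M.cfg c'.state c'.store) 
      ((dual_step_iff M x c.state c.store c'.state c'.store).1 h')
    refine ⟨T', A', h1, ?_, h4⟩
    change A' + altCount (M.label _).swap (M.label _).swap ≤ A
    rw [altCount_swap]
    exact h2

theorem dual_acceptsFrom_iff {M : ATM α} {x : List α} {c : M.Cfg} {T A : ℕ} (h : Bdd x c T A) :
    M.dual.AcceptsFrom x (M.dual.cfg c.state c.store) ↔ ¬ M.AcceptsFrom x c := by
  induction h using Bdd.induct with
  | mk c T A h ih =>
    have hd : M.dual.label (M.dual.cfg c.state c.store).state = (M.label c.state).swap := rfl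
    have ih' : ∀ c', M.Step x c c' →
        (M.dual.AcceptsFrom x (M.dual.cfg c'.state c'.store) ↔ ¬ M.AcceptsFrom x c') := by
      intro c' h'
      obtain ⟨_, _, _, _, _, h2⟩ := ih c' h'
      exact h2
    cases hl : M.label c.state with
    | ex =>
      rw [acceptsFrom_iff_of_ex hl, acceptsFrom_iff_of_all (hd.trans (by rw [hl]; rfl))]
      push Not
      constructor
      · intro h1 c' h2
        exact (ih' c' h2).1 (h1 _ ((dual_step_iff M x c.state c.store c'.state c'.store).2 h2))
      · intro h1 c' h2
        have h3 := (dual_step_iff M x c.state c.store c'.state c'.store).1 h2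
        exact (ih' _ h3).2 (h1 _ h3)
    | all =>
      rw [acceptsFrom_iff_of_all hl, acceptsFrom_iff_of_ex (hd.trans (by rw [hl]; rfl))]
      push Not
      constructor
      · rintro ⟨c', h2, h4⟩
        have h3 := (dual_step_iff M x c.state c.store c'.state c'.store).1 h2
        exact ⟨_, h3, (ih' _ h3).1 h4⟩
      · rintro ⟨c', h2, h4⟩
        exact ⟨_, (dual_step_iff M x c.state c.store c'.state c'.store).2 h2, (ih' _ h2).2 h4⟩
    | accept =>
      exact iff_of_false (not_acceptsFrom_of_reject (hd.trans (by rw [hl]; rfl)))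
        (not_not.2 (.accept hl))
    | reject =>
      exact iff_of_true (.accept (hd.trans (by rw [hl]; rfl))) (not_acceptsFrom_of_reject hl)

/-- Complementation by the dual machine needs halting: a configuration with an infinite path may be
accepted by neither machine. -/
theorem dual_language {M : ATM α} (h : ∀ x, ∃ T A, Bdd x M.init T A) :
    M.dual.language = M.languageᶜ := by
  ext x
  obtain ⟨T, A, h⟩ := h x
  exact dual_acceptsFrom_iff h

end ATM

end AltTM

namespace AltTM

/-! ### Deterministic program fragments -/

/-- The action with the new state replaced by its image. -/
def Action.mapState {σ τ Sym Tape : Type} (f : σ → τ) (a : Action σ Sym Tape) :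
    Action τ Sym Tape := ⟨f a.state, a.inMove, a.write, a.move⟩

/-- The action that changes nothing but the state. -/
def Action.idle {σ Sym Tape : Type} (q : σ) (w : Tape → Sym) : Action σ Sym Tape :=
  ⟨q, .stay, w, fun _ => .stay⟩

@[simp] theorem Store.act_idle {σ Sym Tape : Type} (q : σ) (n : ℕ) (d : Store Sym Tape) :
    d.act n (Action.idle q d.scan) = d := by
  ext <;> simp [Store.act, Action.idle, moveInput, moveWork, Store.scan]

/-- A deterministic program fragment: a finite control that is left by an action whose new state
is `none`. -/
structure Frag (α Sym Tape : Type) where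
  S : Type
  fin : Finite S
  start : S
  next : S → InSym α → (Tape → Sym) → Action (Option S) Sym Tape

namespace Frag

variable {α Sym Tape : Type}

/-- The action of a fragment in a given state and store, on the input `x`. -/
def actionAt (P : Frag α Sym Tape) (x : List α) (s : P.S) (d : Store Sym Tape) :
    Action (Option P.S) Sym Tape := P.next s (readInput x d.inPos) d.scan

/-- Started in state `s` with the store `d`, the fragment is left within `t` steps, with the
store `d'`. -/
inductive RunsFrom (P : Frag α Sym Tape) (x : List α) :
    P.S → Store Sym Tape → ℕ → Store Sym Tape → Prop
  | exit {s : P.S} {d : Store Sym Tape} {t : ℕ} (h : (P.actionAt x s d).state = none) :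
      RunsFrom P x s d (t + 1) (d.act x.length (P.actionAt x s d))
  | step {s s' : P.S} {d d' : Store Sym Tape} {t : ℕ} (h : (P.actionAt x s d).state = some s')
      (h' : RunsFrom P x s' (d.act x.length (P.actionAt x s d)) t d') :
      RunsFrom P x s d (t + 1) d'

/-- Started with the store `d`, the fragment is left within `t` steps, with the store `d'`. -/
def Runs (P : Frag α Sym Tape) (x : List α) (d : Store Sym Tape) (t : ℕ) (d' : Store Sym Tape) :
    Prop := P.RunsFrom x P.start d t d'

theorem RunsFrom.mono {P : Frag α Sym Tape} {x : List α} {s : P.S} {d d' : Store Sym Tape}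
    {t t' : ℕ} (h : P.RunsFrom x s d t d') (ht : t ≤ t') : P.RunsFrom x s d t' d' := by
  induction h generalizing t' with
  | exit h =>
    obtain ⟨u, rfl⟩ := Nat.exists_eq_add_of_le' ht
    exact .exit (t := u + _) h
  | step h h' ih =>
    obtain ⟨u, rfl⟩ : ∃ u, t' = u + 1 := ⟨t' - 1, by omega⟩
    exact .step h (ih (by omega))

theorem Runs.mono {P : Frag α Sym Tape} {x : List α} {d d' : Store Sym Tape}
    {t t' : ℕ} (h : P.Runs x d t d') (ht : t ≤ t') : P.Runs x d t' d' := RunsFrom.mono h ht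

/-- First `P`, then `Q`. -/
def seq (P Q : Frag α Sym Tape) : Frag α Sym Tape where
  S := P.S ⊕ Q.S
  fin := by have := P.fin; have := Q.fin; infer_instance
  start := .inl P.start
  next
    | .inl s, i, w => (P.next s i w).mapState fun o => some (o.elim (.inr Q.start) .inl)
    | .inr s, i, w => (Q.next s i w).mapState (Option.map .inr)

theorem Runs.seq {P Q : Frag α Sym Tape} {x : List α} {d d₁ d₂ : Store Sym Tape} {t t' : ℕ}
    (h : P.Runs x d t d₁) (h' : Q.Runs x d₁ t' d₂) : (P.seq Q).Runs x d (t + t') d₂ := by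
  have hQ : ∀ s d t d₂, Q.RunsFrom x s d t d₂ → (P.seq Q).RunsFrom x (.inr s) d t d₂ := by
    intro s d t d₂ h
    induction h with
    | @exit s d t h =>
      refine .exit (P := P.seq Q) (s := .inr s) (d := d) (t := t) ?_
      change Option.map _ (Q.actionAt x s d).state = none
      rw [h]; rfl
    | @step s s' d d' t h h' ih =>
      refine .step (P := P.seq Q) (s := .inr s) (s' := .inr s') (d := d) (t := t) ?_ ih
      change Option.map _ (Q.actionAt x s d).state = _
      rw [h]; rfl
  have hP : ∀ s d t d₁, P.RunsFrom x s d t d₁ → Q.Runs x d₁ t' d₂ →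
      (P.seq Q).RunsFrom x (.inl s) d (t + t') d₂ := by
    intro s d t d₁ h h'
    induction h with
    | @exit s d t h =>
      refine RunsFrom.mono (t := t' + 1) ?_ (by omega)
      refine .step (P := P.seq Q) (s := .inl s) (s' := .inr Q.start) (d := d) ?_
        (hQ _ _ _ _ h')
      change some (Option.elim (P.actionAt x s d).state _ _) = _
      rw [h]; rfl
    | @step s s' d d' t h _ ih =>
      refine RunsFrom.mono (t := t + t' + 1) ?_ (by omega)
      refine .step (P := P.seq Q) (s := .inl s) (s' := .inl s') (d := d) ?_ (ih h')
      change some (Option.elim (P.actionAt x s d).state _ _) = _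
      rw [h]; rfl
  exact hP _ _ _ _ h h'

open Classical in
/-- While the test holds, perform the action `a`, one step per round; then perform `b`. -/
noncomputable def loop (test : InSym α → (Tape → Sym) → Prop)
    (a b : InSym α → (Tape → Sym) → Action Unit Sym Tape) : Frag α Sym Tape where
  S := Unit
  fin := inferInstance
  start := ()
  next _ i w := if test i w then (a i w).mapState some else (b i w).mapState fun _ => none

/-- The rule for `loop`, with an invariant `I i` for the beginning of round `i`. -/
theorem loop_runs {test : InSym α → (Tape → Sym) → Prop}
    {a b : InSym α → (Tape → Sym) → Action Unit Sym Tape} {x : List α} (k : ℕ)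
    {I : ℕ → Store Sym Tape → Prop} {d : Store Sym Tape} (h0 : I 0 d)
    (hI : ∀ i < k, ∀ d, I i d → test (readInput x d.inPos) d.scan ∧
      I (i + 1) (d.act x.length (a (readInput x d.inPos) d.scan)))
    (hk : ∀ d, I k d → ¬ test (readInput x d.inPos) d.scan) :
    ∃ d', I k d' ∧ (loop test a b).Runs x d (k + 1)
      (d'.act x.length (b (readInput x d'.inPos) d'.scan)) := by
  induction k generalizing I d with
  | zero =>
    refine ⟨d, h0, ?_⟩
    have h1 : (loop test a b).actionAt x () d =
        (b (readInput x d.inPos) d.scan).mapState fun _ => none := if_neg (hk d h0)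
    have := RunsFrom.exit (P := loop test a b) (x := x) (s := ()) (d := d) (t := 0)
      (by rw [h1]; rfl)
    rwa [h1] at this
  | succ k ih =>
    obtain ⟨h1, h2⟩ := hI 0 (by omega) d h0
    obtain ⟨d', h3, h4⟩ := ih (I := fun i => I (i + 1)) h2
      (fun i hi d hd => hI (i + 1) (by omega) d hd) hk
    refine ⟨d', h3, ?_⟩
    have h5 : (loop test a b).actionAt x () d =
        (a (readInput x d.inPos) d.scan).mapState some := if_pos h1
    refine .step (P := loop test a b) (x := x) (s := ()) (s' := ()) (d := d) (by rw [h5]; rfl) ?_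
    rw [h5]
    exact h4

/-- A single action. -/
noncomputable def once (b : InSym α → (Tape → Sym) → Action Unit Sym Tape) : Frag α Sym Tape :=
  loop (fun _ _ => False) b b

theorem once_runs (b : InSym α → (Tape → Sym) → Action Unit Sym Tape) (x : List α)
    (d : Store Sym Tape) :
    (once b).Runs x d 1 (d.act x.length (b (readInput x d.inPos) d.scan)) := by
  obtain ⟨d', rfl, h⟩ := loop_runs (test := fun _ _ => False) (a := b) (b := b) (x := x) 0
    (I := fun _ d' => d' = d) (d := d) rfl (by simp) (by simp)
  exact h

open Classical in
/-- While the test holds, run `P`. -/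
noncomputable def whileDo (test : InSym α → (Tape → Sym) → Prop) (P : Frag α Sym Tape) :
    Frag α Sym Tape where
  S := Option P.S
  fin := by have := P.fin; infer_instance
  start := none
  next
    | none, i, w => if test i w then .idle (some (some P.start)) w else .idle none w
    | some s, i, w => (P.next s i w).mapState some

/-- The rule for `whileDo`, with an invariant `I i` for the beginning of round `i`, which takes
`B i` steps. -/
theorem whileDo_runs {test : InSym α → (Tape → Sym) → Prop} {P : Frag α Sym Tape} {x : List α}
    (k : ℕ) {I : ℕ → Store Sym Tape → Prop} {B : ℕ → ℕ} {d : Store Sym Tape} (h0 : I 0 d)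
    (hI : ∀ i < k, ∀ d, I i d → test (readInput x d.inPos) d.scan ∧
      ∃ d', P.Runs x d (B i) d' ∧ I (i + 1) d')
    (hk : ∀ d, I k d → ¬ test (readInput x d.inPos) d.scan) :
    ∃ d', I k d' ∧ (whileDo test P).Runs x d (∑ i ∈ Finset.range k, (B i + 1) + 1) d' := by
  have body : ∀ s d t d' u d'', P.RunsFrom x s d t d' → (whileDo test P).Runs x d' u d'' →
      (whileDo test P).RunsFrom x (some s) d (t + u) d'' := by
    intro s d t d' u d'' h h'
    induction h with
    | @exit s d t h =>
      refine RunsFrom.mono (t := u + 1) ?_ (by omega)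
      refine .step (P := whileDo test P) (s := some s) (s' := none) (d := d) ?_ h'
      change some (P.actionAt x s d).state = _
      rw [h]; rfl
    | @step s s' d d' t h _ ih =>
      refine RunsFrom.mono (t := t + u + 1) ?_ (by omega)
      refine .step (P := whileDo test P) (s := some s) (s' := some s') (d := d) ?_ (ih h')
      change some (P.actionAt x s d).state = _
      rw [h]; rfl
  induction k generalizing I d B with
  | zero =>
    refine ⟨d, h0, ?_⟩
    have h1 : (whileDo test P).actionAt x none d = .idle none d.scan := if_neg (hk d h0)
    have := RunsFrom.exit (P := whileDo test P) (x := x) (s := none) (d := d) (t := 0)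
      (by rw [h1]; rfl)
    rw [h1, Store.act_idle] at this
    exact this.mono (by simp)
  | succ k ih =>
    obtain ⟨h1, d₁, h2, h3⟩ := hI 0 (by omega) d h0
    obtain ⟨d', h4, h5⟩ := ih (I := fun i => I (i + 1)) (B := fun i => B (i + 1)) h3
      (fun i hi d hd => hI (i + 1) (by omega) d hd) hk
    refine ⟨d', h4, ?_⟩
    have h6 : (whileDo test P).actionAt x none d = .idle (some (some P.start)) d.scan := if_pos h1
    have h7 := body _ _ _ _ _ _ h2 h5
    rw [Finset.sum_range_succ']
    refine RunsFrom.mono (t := B 0 + (∑ i ∈ Finset.range k, (B (i + 1) + 1) + 1) + 1) ?_ (by omega)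
    refine .step (P := whileDo test P) (x := x) (s := none) (s' := some P.start) (d := d)
      (by rw [h6]; rfl) ?_
    rw [h6, Store.act_idle]
    exact h7

/-- Content of an input cell under a map of the letters. -/
def _root_.AltTM.InSym.map {α β : Type} (φ : α → β) : InSym α → InSym β
  | .leftEnd => .leftEnd
  | .letter a => .letter (φ a)
  | .rightEnd => .rightEnd

theorem _root_.AltTM.readInput_map {α β : Type} (φ : α → β) (x : List α) (p : ℕ) :
    readInput (x.map φ) p = (readInput x p).map φ := by
  unfold readInput
  split
  · rfl
  · rw [List.getElem?_map]
    cases x[p - 1]? <;> rfl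

variable {β Sym' Tape' : Type}

/-- The store seen by a fragment that uses the tapes in the range of `ι` and reads symbols
through `r i`. -/
def _root_.AltTM.Store.restrict (r : Tape → Sym' → Sym) (ι : Tape → Tape')
    (d : Store Sym' Tape') :
    Store Sym Tape := ⟨d.inPos, fun i => d.head (ι i), fun i p => r i (d.tape (ι i) p)⟩

/-- The fragment `P` acting on some of the tapes of a larger machine. The symbols on
tape `i` are read through `r i` and written through `e i`, the letters are read through `φ`. -/
noncomputable def lift (P : Frag β Sym Tape) (φ : α → β) (r : Tape → Sym' → Sym)
    (e : Tape → Sym → Sym') (ι : Tape → Tape') : Frag α Sym' Tape' where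
  S := P.S
  fin := P.fin
  start := P.start
  next s i w :=
    let a := P.next s (i.map φ) fun t => r t (w (ι t))
    ⟨a.state, a.inMove, Function.extend ι (fun t => e t (a.write t)) w,
      Function.extend ι a.move fun _ => .stay⟩

/-- A fragment that is lifted to a larger set of tapes does there what it does alone. The tapes
outside the range of `ι` are untouched, and only symbols of the form `e i s` are written on the
others. -/
theorem Runs.lift {P : Frag β Sym Tape} {φ : α → β} {r : Tape → Sym' → Sym}
    {e : Tape → Sym → Sym'} (hre : ∀ i s, r i (e i s) = s) {ι : Tape → Tape'} (hι : ι.Injective)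
    {x : List α}
    {d : Store Sym' Tape'} {t : ℕ} {d₁ : Store Sym Tape}
    (h : P.Runs (x.map φ) (d.restrict r ι) t d₁) :
    ∃ d', (P.lift φ r e ι).Runs x d t d' ∧ d'.restrict r ι = d₁ ∧
      (∀ i, i ∉ Set.range ι → d'.head i = d.head i ∧ d'.tape i = d.tape i) ∧
      ∀ i p, d'.tape (ι i) p ∈ Set.range (e i) ∨ d'.tape (ι i) p = d.tape (ι i) p := by
  have key : ∀ s (d : Store Sym' Tape'),
      ((P.lift φ r e ι).actionAt x s d).state = (P.actionAt (x.map φ) s (d.restrict r ι)).state ∧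
      (d.act x.length ((P.lift φ r e ι).actionAt x s d)).restrict r ι =
        (d.restrict r ι).act (x.map φ).length (P.actionAt (x.map φ) s (d.restrict r ι)) ∧
      (∀ i, i ∉ Set.range ι →
        (d.act x.length ((P.lift φ r e ι).actionAt x s d)).head i = d.head i ∧
        (d.act x.length ((P.lift φ r e ι).actionAt x s d)).tape i = d.tape i) ∧
      ∀ i p, (d.act x.length ((P.lift φ r e ι).actionAt x s d)).tape (ι i) p ∈ Set.range (e i) ∨
        (d.act x.length ((P.lift φ r e ι).actionAt x s d)).tape (ι i) p = d.tape (ι i) p := by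
    intro s d
    have ha : P.next s ((readInput x d.inPos).map φ) (fun t => r t (d.scan (ι t))) =
        P.actionAt (x.map φ) s (d.restrict r ι) := by
      rw [← readInput_map]; rfl
    have hb : (P.lift φ r e ι).actionAt x s d =
        ⟨(P.actionAt (x.map φ) s (d.restrict r ι)).state,
          (P.actionAt (x.map φ) s (d.restrict r ι)).inMove,
          Function.extend ι (fun t => e t ((P.actionAt (x.map φ) s (d.restrict r ι)).write t)) d.scan,
          Function.extend ι (P.actionAt (x.map φ) s (d.restrict r ι)).move fun _ => .stay⟩ := by
      rw [← ha]; rfl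
    refine ⟨by rw [hb], ?_, ?_, ?_⟩
    · rw [hb]
      ext i
      · simp [Store.act, Store.restrict]
      · simp [Store.act, Store.restrict, hι.extend_apply]
      · simp only [Store.act, Store.restrict, hι.extend_apply, Function.update_apply]
        split <;> simp [hre]
    · intro i hi
      rw [hb]
      have hi' : ¬ ∃ a, ι a = i := hi
      constructor
      · simp [Store.act, Function.extend_apply' _ _ _ hi', moveWork]
      · simp [Store.act, Function.extend_apply' _ _ _ hi', Store.scan]
    · intro i p
      rw [hb]
      simp only [Store.act, hι.extend_apply, Function.update_apply]
      split
      · exact .inl ⟨_, rfl⟩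
      · exact .inr rfl
  suffices H : ∀ s d₀ t d₁, P.RunsFrom (x.map φ) s d₀ t d₁ → ∀ d : Store Sym' Tape',
      d.restrict r ι = d₀ → ∃ d', (P.lift φ r e ι).RunsFrom x s d t d' ∧ d'.restrict r ι = d₁ ∧
      (∀ i, i ∉ Set.range ι → d'.head i = d.head i ∧ d'.tape i = d.tape i) ∧
      ∀ i p, d'.tape (ι i) p ∈ Set.range (e i) ∨ d'.tape (ι i) p = d.tape (ι i) p from
    H _ _ _ _ h d rfl
  intro s d₀ t d₁ h
  induction h with
  | @exit s d₀ t h =>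
    rintro d rfl
    obtain ⟨h1, h2, h3, hw⟩ := key s d
    exact ⟨_, .exit (P := P.lift φ r e ι) (h1.trans h), h2, h3, hw⟩
  | @step s s' d₀ d₁ t h _ ih =>
    rintro d rfl
    obtain ⟨h1, h2, h3, hw⟩ := key s d
    obtain ⟨d', h4, h5, h6, h7⟩ := ih _ h2
    refine ⟨d', .step (P := P.lift φ r e ι) (h1.trans h) h4, h5, fun i hi => ?_, fun i p => ?_⟩
    · rw [(h6 i hi).1, (h6 i hi).2]
      exact h3 i hi
    · rcases h7 i p with h8 | h8
      · exact .inl h8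
      · rw [h8]
        exact hw i p

end Frag

/-! ### A machine that starts with a deterministic fragment -/

namespace ATM

variable {α : Type}

/-- The machine that runs the fragment `P`, in states labelled `lab`, and then continues as `N`
with the store left by `P`. The empty input is accepted or rejected at once according to `ans`: time
and space bounds may vanish there. -/
def prefixed (N : ATM α) (P : Frag α N.Sym N.Tape) (lab : Label) (ans : Bool) : ATM α where
  State := Option Bool ⊕ P.S ⊕ N.State
  Sym := N.Sym
  Tape := N.Tape
  finState := by have := P.fin; have := N.finState; infer_instance
  finSym := N.finSym
  finTape := N.finTape
  blank := N.blank
  start := .inl none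
  label
    | .inl none => lab
    | .inl (some b) => if b then .accept else .reject
    | .inr (.inl _) => lab
    | .inr (.inr q) => N.label q
  trans
    | .inl none, .rightEnd, w => {.idle (.inl (some ans)) w}
    | .inl none, _, w => {.idle (.inr (.inl P.start)) w}
    | .inl (some _), _, _ => ∅
    | .inr (.inl s), i, w =>
      {(P.next s i w).mapState fun o => .inr (o.elim (.inr N.start) .inl)}
    | .inr (.inr q), i, w => Action.mapState (fun q => .inr (.inr q)) '' N.trans q i w

section prefixed

variable {N : ATM α} {P : Frag α N.Sym N.Tape} {lab : Label} {ans : Bool}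

theorem prefixed_deterministic (h : N.Deterministic) : (N.prefixed P lab ans).Deterministic := by
  intro q s w
  rcases q with (_ | b) | (s | q)
  · cases s <;> exact Set.subsingleton_singleton
  · exact Set.subsingleton_empty
  · exact Set.subsingleton_singleton
  · exact (h q s w).image _

/-- The configuration of the composed machine for a configuration of the second machine. -/
def prefixedCfg (P : Frag α N.Sym N.Tape) (lab : Label) (ans : Bool) (c : N.Cfg) :
    (N.prefixed P lab ans).Cfg := (N.prefixed P lab ans).cfg (.inr (.inr c.state)) c.store

theorem prefixed_bisim (x : List α) : Bisim N (N.prefixed P lab ans) x x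
    fun c e => e = prefixedCfg P lab ans c := by
  refine ⟨?_, ?_, ?_⟩
  · rintro c e rfl; rfl
  · rintro c e c' rfl ⟨h1, a, h2, rfl⟩
    exact ⟨_, ⟨h1, _, ⟨a, h2, rfl⟩, rfl⟩, rfl⟩
  · rintro c e c' rfl ⟨h1, _, ⟨a, h2, rfl⟩, rfl⟩
    exact ⟨_, ⟨h1, a, h2, rfl⟩, rfl⟩

theorem moveWork_natAbs_le (p : ℤ) (m : Dir) : (moveWork p m).natAbs ≤ p.natAbs + 1 := by
  cases m <;> simp only [moveWork] <;> omega

theorem From.eq_or {M : ATM α} {x : List α} {c c' : M.Cfg} (h : M.From x c c') :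
    c' = c ∨ ∃ c₁, M.Step x c c₁ ∧ M.From x c₁ c' := by
  rcases ReflTransGen.cases_head h with h | ⟨c₁, h1, h2⟩
  · exact .inl h.symm
  · exact .inr ⟨c₁, h1, h2⟩

/-- What is to be known of a run of the fragment inside the composed machine: acceptance,
bounds, and reachable configurations. -/
theorem prefixed_runsFrom (hlab : lab = .ex ∨ lab = .all) {x : List α} {s : P.S}
    {d d' : Store N.Sym N.Tape} {t : ℕ} (h : P.RunsFrom x s d t d') :
    ((N.prefixed P lab ans).AcceptsFrom x ((N.prefixed P lab ans).cfg (.inr (.inl s)) d) ↔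
      N.AcceptsFrom x (N.cfg N.start d')) ∧
    (∀ T A, Bdd x (N.cfg N.start d') T A →
      Bdd x ((N.prefixed P lab ans).cfg (.inr (.inl s)) d) (t + T)
        (A + altCount lab (N.label N.start))) ∧
    ∀ c', (N.prefixed P lab ans).From x ((N.prefixed P lab ans).cfg (.inr (.inl s)) d) c' →
      (∃ i : ℕ, i ≤ t ∧ ∀ j, (c'.head j).natAbs ≤ (d.head j).natAbs + i) ∨
      ∃ c, N.From x (N.cfg N.start d') c ∧ c' = prefixedCfg P lab ans c := by
  have hstep : ∀ (s : P.S) (d : Store N.Sym N.Tape) (c' : (N.prefixed P lab ans).Cfg),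
      (N.prefixed P lab ans).Step x ((N.prefixed P lab ans).cfg (.inr (.inl s)) d) c' ↔
      c' = (N.prefixed P lab ans).cfg
        (.inr ((P.actionAt x s d).state.elim (.inr N.start) .inl))
        (d.act x.length (P.actionAt x s d)) := by
    intro s d c'
    constructor
    · rintro ⟨-, a, rfl, rfl⟩; rfl
    · rintro rfl
      exact ⟨hlab, _, rfl, rfl⟩
  induction h with
  | @exit s d t h =>
    have hs := hstep s d
    rw [h] at hs
    replace hs : ∀ c', (N.prefixed P lab ans).Step x
        ((N.prefixed P lab ans).cfg (.inr (.inl s)) d) c' ↔ c' = prefixedCfg P lab ans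
        (N.cfg N.start (d.act x.length (P.actionAt x s d))) := hs
    refine ⟨?_, fun T A hb => ?_, fun c' hc => ?_⟩
    · rw [acceptsFrom_iff_of_unique ((hs _).2 rfl) fun c' => (hs c').1]
      exact ((prefixed_bisim x).acceptsFrom_iff rfl).symm
    · exact (Bdd.of_unique (fun c' => (hs c').1) ((prefixed_bisim x).bdd rfl hb)).mono
        (by omega) le_rfl
    · rcases hc.eq_or with rfl | ⟨c₁, h1, h2⟩
      · exact .inl ⟨0, by omega, fun j => le_rfl⟩
      · obtain rfl := (hs c₁).1 h1
        exact .inr ((prefixed_bisim x).from_bwd rfl h2)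
  | @step s s' d d' t h _ ih =>
    obtain ⟨ih1, ih2, ih3⟩ := ih
    have hs := hstep s d
    rw [h] at hs
    replace hs : ∀ c', (N.prefixed P lab ans).Step x
        ((N.prefixed P lab ans).cfg (.inr (.inl s)) d) c' ↔ c' = (N.prefixed P lab ans).cfg
        (.inr (.inl s')) (d.act x.length (P.actionAt x s d)) := hs
    refine ⟨?_, fun T A hb => ?_, fun c' hc => ?_⟩
    · rw [acceptsFrom_iff_of_unique ((hs _).2 rfl) fun c' => (hs c').1]
      exact ih1
    · refine (Bdd.of_unique (fun c' => (hs c').1) (ih2 T A hb)).mono (by omega) ?_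
      change _ + altCount lab lab ≤ _
      rw [altCount_self, add_zero]
    · rcases hc.eq_or with rfl | ⟨c₁, h1, h2⟩
      · exact .inl ⟨0, by omega, fun j => le_rfl⟩
      · obtain rfl := (hs c₁).1 h1
        rcases ih3 c' h2 with ⟨i, hi, hj⟩ | h3
        · refine .inl ⟨i + 1, by omega, fun j => (hj j).trans ?_⟩
          have := moveWork_natAbs_le (d.head j) ((P.actionAt x s d).move j)
          change (moveWork (d.head j) ((P.actionAt x s d).move j)).natAbs + i ≤ _
          omega
        · exact .inr h3

theorem prefixed_step_start_nil (c' : (N.prefixed P lab ans).Cfg)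
    (h : (N.prefixed P lab ans).Step [] (N.prefixed P lab ans).init c') :
    c' = (N.prefixed P lab ans).cfg (.inl (some ans)) (Store.initial N.blank) := by
  obtain ⟨-, a, h1, rfl⟩ := h
  change a ∈ ({Action.idle _ _} : Set _) at h1
  obtain rfl := h1
  exact congrArg ((N.prefixed P lab ans).cfg (.inl (some ans)))
    (Store.act_idle (Sum.inl (some ans) : Option Bool ⊕ P.S ⊕ N.State) 0 (Store.initial N.blank))

theorem prefixed_nil (hlab : lab = .ex ∨ lab = .all) :
    ([] ∈ (N.prefixed P lab ans).language ↔ ans = true) ∧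
    Bdd [] (N.prefixed P lab ans).init 1 0 := by
  have hs := prefixed_step_start_nil (N := N) (P := P) (lab := lab) (ans := ans)
  have hx : (N.prefixed P lab ans).Step [] (N.prefixed P lab ans).init
      ((N.prefixed P lab ans).cfg (.inl (some ans)) (Store.initial N.blank)) := by
    have h : (N.prefixed P lab ans).Step [] (N.prefixed P lab ans).init _ :=
      ⟨hlab, _, rfl, rfl⟩
    rwa [hs _ h] at h
  have hl : (N.prefixed P lab ans).label (.inl (some ans)) = if ans then .accept else .reject := rfl
  constructor
  · change (N.prefixed P lab ans).AcceptsFrom _ _ ↔ _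
    rw [acceptsFrom_iff_of_unique hx hs]
    cases ans
    · exact iff_of_false (not_acceptsFrom_of_reject hl) (by simp)
    · exact iff_of_true (.accept hl) rfl
  · refine (Bdd.of_unique hs (.of_halting (T := 0) (A := 0) ?_)).mono le_rfl ?_
    · cases ans
      · exact .inr hl
      · exact .inl hl
    · rw [altCount_of_not, add_zero]
      change ¬ Alternates lab (if ans then .accept else .reject)
      cases ans <;> simp [Alternates]

theorem prefixed_step_start_of_ne_nil (hlab : lab = .ex ∨ lab = .all) {x : List α} (hx : x ≠ [])
    (c' : (N.prefixed P lab ans).Cfg) :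
    (N.prefixed P lab ans).Step x (N.prefixed P lab ans).init c' ↔
    c' = (N.prefixed P lab ans).cfg (.inr (.inl P.start)) (Store.initial N.blank) := by
  obtain ⟨b, y, rfl⟩ := List.exists_cons_of_ne_nil hx
  have h0 := Store.act_idle (Sum.inr (.inl P.start) : Option Bool ⊕ P.S ⊕ N.State) (b :: y).length
    (Store.initial (Tape := N.Tape) N.blank)
  constructor
  · rintro ⟨-, a, h1, rfl⟩
    change a ∈ ({Action.idle _ _} : Set _) at h1
    obtain rfl := h1
    exact congrArg ((N.prefixed P lab ans).cfg (.inr (.inl P.start))) h0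
  · rintro rfl
    refine ⟨hlab, Action.idle (.inr (.inl P.start)) (Store.initial N.blank).scan, rfl, ?_⟩
    exact congrArg ((N.prefixed P lab ans).cfg (.inr (.inl P.start))) h0.symm

theorem prefixed_mem_language_iff (hlab : lab = .ex ∨ lab = .all) {x : List α} (hx : x ≠ [])
    {t : ℕ} {d : Store N.Sym N.Tape} (h : P.Runs x (Store.initial N.blank) t d) :
    x ∈ (N.prefixed P lab ans).language ↔ N.AcceptsFrom x (N.cfg N.start d) := by
  have hs := prefixed_step_start_of_ne_nil (N := N) (P := P) (ans := ans) hlab hx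
  change (N.prefixed P lab ans).AcceptsFrom _ _ ↔ _
  rw [acceptsFrom_iff_of_unique ((hs _).2 rfl) fun c' => (hs c').1]
  exact (prefixed_runsFrom hlab h).1

theorem prefixed_bdd (hlab : lab = .ex ∨ lab = .all) {x : List α} (hx : x ≠ [])
    {t : ℕ} {d : Store N.Sym N.Tape} (h : P.Runs x (Store.initial N.blank) t d) {T A : ℕ}
    (hb : Bdd x (N.cfg N.start d) T A) : Bdd x (N.prefixed P lab ans).init (1 + t + T)
      (A + altCount lab (N.label N.start)) := by
  have hs := prefixed_step_start_of_ne_nil (N := N) (P := P) (ans := ans) hlab hx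
  refine (Bdd.of_unique (fun c' => (hs c').1)
    ((prefixed_runsFrom hlab h).2.1 T A hb)).mono (by omega) ?_
  change _ + altCount lab lab ≤ _
  rw [altCount_self, add_zero]

theorem encard_heads_le {Tape : Type} [Finite Tape] (K : ℕ) :
    Set.encard {ip : Tape × ℤ | ip.2.natAbs ≤ K} ≤ ((Nat.card Tape * (2 * K + 1) : ℕ) : ℕ∞) := by
  have h : {ip : Tape × ℤ | ip.2.natAbs ≤ K} = Set.univ ×ˢ (Set.Icc (-(K : ℤ)) K) := by
    ext ⟨i, p⟩
    simp only [Set.mem_ofPred_eq, Set.mem_prod, Set.mem_univ, Set.mem_Icc, true_and]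
    omega
  have hf : (Set.univ ×ˢ (Set.Icc (-(K : ℤ)) K) : Set (Tape × ℤ)).Finite :=
    Set.finite_univ.prod (Set.finite_Icc _ _)
  rw [h, ← hf.cast_ncard_eq, Set.ncard_prod, Set.ncard_univ]
  have : (Set.Icc (-(K : ℤ)) K).ncard = 2 * K + 1 := by
    rw [← Nat.card_coe_set_eq, Nat.card_eq_fintype_card, Fintype.card_ofFinset, Int.card_Icc]
    omega
  rw [this]

/-- The fragment visits at most `2 * t + 1` cells of each tape. -/
theorem prefixed_visitsAtMost (hlab : lab = .ex ∨ lab = .all) {x : List α} (hx : x ≠ [])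
    {t : ℕ} {d : Store N.Sym N.Tape} (h : P.Runs x (Store.initial N.blank) t d) {S : ℕ}
    (hb : N.VisitsAtMost x (N.cfg N.start d) S) :
    (N.prefixed P lab ans).VisitsAtMost x (N.prefixed P lab ans).init
      (Nat.card N.Tape * (2 * t + 1) + S) := by
  have := N.finTape
  have hs := prefixed_step_start_of_ne_nil (N := N) (P := P) (ans := ans) hlab hx
  have hsub : {ip : N.Tape × ℤ | ∃ c', (N.prefixed P lab ans).From x (N.prefixed P lab ans).init c' ∧
      c'.head ip.1 = ip.2} ⊆ {ip : N.Tape × ℤ | ip.2.natAbs ≤ t} ∪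
      {ip : N.Tape × ℤ | ∃ c', N.From x (N.cfg N.start d) c' ∧ c'.head ip.1 = ip.2} := by
    rintro ⟨i, p⟩ ⟨c', h1, h0⟩
    obtain rfl : c'.head i = p := h0
    rcases h1.eq_or with rfl | ⟨c₁, h2, h3⟩
    · exact .inl (Nat.zero_le _)
    · obtain rfl := (hs c₁).1 h2
      rcases (prefixed_runsFrom hlab h).2.2 c' h3 with ⟨k, hk, hj⟩ | ⟨c, h4, rfl⟩
      · refine .inl ((hj i).trans ?_)
        change 0 + k ≤ t
        omega
      · exact .inr ⟨c, h4, rfl⟩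
  refine (Set.encard_le_encard hsub).trans ((Set.encard_union_le _ _).trans ?_)
  push_cast
  refine add_le_add ?_ hb
  have := encard_heads_le (Tape := N.Tape) t
  push_cast at this
  exact this

theorem prefixed_visitsAtMost_nil :
    (N.prefixed P lab ans).VisitsAtMost [] (N.prefixed P lab ans).init (Nat.card N.Tape) := by
  have := N.finTape
  have hsub : {ip : N.Tape × ℤ | ∃ c', (N.prefixed P lab ans).From []
      (N.prefixed P lab ans).init c' ∧ c'.head ip.1 = ip.2} ⊆
      {ip : N.Tape × ℤ | ip.2.natAbs ≤ 0} := by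
    rintro ⟨i, p⟩ ⟨c', h1, h0⟩
    obtain rfl : c'.head i = p := h0
    rcases h1.eq_or with rfl | ⟨c₁, h2, h3⟩
    · exact Nat.zero_le _
    · obtain rfl := prefixed_step_start_nil c₁ h2
      rcases h3.eq_or with rfl | ⟨c₂, h4, -⟩
      · exact Nat.zero_le _
      · obtain ⟨-, _, h5, -⟩ := h4
        exact h5.elim
  refine (Set.encard_le_encard hsub).trans ?_
  simpa using encard_heads_le (Tape := N.Tape) 0

end prefixed

end ATM

end AltTM

namespace AltTM

/-! ### Time-constructibility in terms of fragments -/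

/-- The content of a tape with `k` symbols `one` in the cells `0, …, k - 1`. -/
noncomputable def unary {Sym : Type} (blank one : Sym) (k : ℕ) : ℤ → Sym := by
  classical exact fun p => if 0 ≤ p ∧ p < k then one else blank

/-- A fragment that writes `f n` in unary on one of its tapes, in time `O(f n)`, and moves the
head of this tape and the input head back to where they started. -/
structure UnaryFrag (f : ℕ → ℕ) where
  Sym : Type
  Tape : Type
  finSym : Finite Sym
  finTape : Finite Tape
  blank : Sym
  one : Sym
  out : Tape
  P : Frag Unit Sym Tape
  b : ℕ
  one_ne : one ≠ blank
  runs : ∀ n, ∃ d, P.Runs (List.replicate n ()) (Store.initial blank) (b * f n + b) d ∧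
    d.inPos = 1 ∧ d.head out = 0 ∧ d.tape out = unary blank one (f n)

/-- The machine that runs a fragment and accepts. -/
def Frag.toATM {α Sym Tape : Type} [Finite Sym] [Finite Tape] (P : Frag α Sym Tape)
    (blank : Sym) : ATM α where
  State := Option P.S
  Sym := Sym
  Tape := Tape
  finState := by have := P.fin; infer_instance
  finSym := inferInstance
  finTape := inferInstance
  blank := blank
  start := some P.start
  label
    | none => .accept
    | some _ => .ex
  trans
    | none, _, _ => ∅
    | some s, i, w => {P.next s i w}

theorem Frag.RunsFrom.reaches {α Sym Tape : Type} [Finite Sym] [Finite Tape]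
    {P : Frag α Sym Tape} {blank : Sym} {x : List α} {s : P.S} {d d' : Store Sym Tape} {t : ℕ}
    (h : P.RunsFrom x s d t d') {u a : ℕ}
    (hr : (P.toATM blank).Reaches x u a ((P.toATM blank).cfg (some s) d)) :
    ∃ u' a', u' ≤ u + t ∧ (P.toATM blank).Reaches x u' a' ((P.toATM blank).cfg none d') := by
  have hstep : ∀ (s : P.S) (d : Store Sym Tape), (P.toATM blank).Step x
      ((P.toATM blank).cfg (some s) d)
      ((P.toATM blank).cfg (P.actionAt x s d).state (d.act x.length (P.actionAt x s d))) :=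
    fun s d => ⟨.inl rfl, _, rfl, rfl⟩
  induction h generalizing u a with
  | @exit s d t h =>
    have h1 := hr.step (hstep s d)
    rw [h] at h1
    exact ⟨_, _, by omega, h1⟩
  | @step s s' d d' t h _ ih =>
    have h1 := hr.step (hstep s d)
    rw [h] at h1
    obtain ⟨u', a', h2, h3⟩ := ih h1
    exact ⟨u', a', by omega, h3⟩

/-- A fragment that moves the input head to the first letter. -/
noncomputable def Frag.rewindInput (α Sym Tape : Type) : Frag α Sym Tape :=
  loop (fun i _ => i ≠ .leftEnd) (fun _ w => ⟨(), .left, w, fun _ => .stay⟩)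
    (fun _ w => ⟨(), .right, w, fun _ => .stay⟩)

theorem readInput_ne_leftEnd {α : Type} (x : List α) {p : ℕ} (h : p ≠ 0) :
    readInput x p ≠ .leftEnd := by
  unfold readInput
  rw [if_neg h]
  split <;> simp

theorem readInput_zero {α : Type} (x : List α) : readInput x 0 = .leftEnd := rfl

theorem Frag.rewindInput_runs {α Sym Tape : Type} (x : List α) (d : Store Sym Tape) :
    (rewindInput α Sym Tape).Runs x d (d.inPos + 1) { d with inPos := 1 } := by
  obtain ⟨d', h1, h2⟩ := loop_runs (test := fun i _ => i ≠ .leftEnd)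
    (a := fun _ w => ⟨(), .left, w, fun _ => .stay⟩)
    (b := fun _ w => ⟨(), .right, w, fun _ => .stay⟩) (x := x) d.inPos
    (I := fun i d' => d' = { d with inPos := d.inPos - i }) (d := d) rfl
    (by
      rintro i hi _ rfl
      refine ⟨readInput_ne_leftEnd x (by simp only; omega), ?_⟩
      ext j
      · simp [Store.act, moveInput]; omega
      · simp [Store.act, moveWork]
      · simp [Store.act, Store.scan])
    (by rintro _ rfl; simp [readInput_zero])
  subst h1
  suffices h : ({ d with inPos := 1 } : Store Sym Tape) = _ by rw [h]; exact h2
  ext j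
  · simp [Store.act, moveInput]
  · simp [Store.act, moveWork]
  · simp [Store.act, Store.scan]

section tracked

open Classical in
/-- The fragment that simulates the deterministic machine `M`, until it halts, and then moves the
head of the tape `out` back to cell `0`. The head of the additional tape `none` moves together
with the head of `out`; cell `0` of this tape is marked. The second component of the state says
on which side of cell `0` the head of `out` is. -/
noncomputable def trackedFrag (M : ATM Unit) (out : M.Tape) :
    Frag Unit (M.Sym × Bool) (Option M.Tape) where
  S := M.State × Bool ⊕ Bool
  fin := by have := M.finState; infer_instance
  start := .inl (M.start, true)
  next
    | .inl (q, s), i, w =>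
      if h : (M.label q = .ex ∨ M.label q = .all) ∧
          (M.trans q i fun t => (w (some t)).1).Nonempty then
        let a := h.2.choose
        ⟨some (.inl (a.state, if (w none).2 then decide (a.move out = .right) else s)), a.inMove,
          fun t => t.elim (w none) fun t => (a.write t, (w (some t)).2),
          fun t => t.elim (a.move out) a.move⟩
      else .idle (some (.inr s)) w
    | .inr s, _, w =>
      if (w none).2 then .idle none w
      else ⟨some (.inr s), .stay, w, fun t =>
        if t = none ∨ t = some out then (if s then .left else .right) else .stay⟩

/-- The store `d` and the side `s` represent the configuration `c`. -/
structure TrackedRel (M : ATM Unit) (out : M.Tape) (c : M.Cfg)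
    (d : Store (M.Sym × Bool) (Option M.Tape)) (s : Bool) : Prop where
  restrict : d.restrict (fun _ => Prod.fst) some = c.store
  head : d.head none = c.head out
  mark : ∀ p, (d.tape none p).2 = decide (p = 0)
  clean : ∀ t p, (d.tape (some t) p).2 = false
  pos : 0 < c.head out → s = true
  neg : c.head out < 0 → s = false

variable {M : ATM Unit} {out : M.Tape} {x : List Unit}

open Classical in
/-- A step of `M` takes one step of the fragment. -/
theorem TrackedRel.step (hM : M.Deterministic) {c c' : M.Cfg}
    {d : Store (M.Sym × Bool) (Option M.Tape)} {s : Bool} (h : TrackedRel M out c d s)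
    (hc : M.Step x c c') : ∃ d' s', TrackedRel M out c' d' s' ∧ ∀ u d'',
      (trackedFrag M out).RunsFrom x (.inl (c'.state, s')) d' u d'' →
      (trackedFrag M out).RunsFrom x (.inl (c.state, s)) d (u + 1) d'' := by
  obtain ⟨h1, a, h2, rfl⟩ := hc
  have hin : d.inPos = c.inPos := congrArg Store.inPos h.restrict
  have hhead : ∀ t, d.head (some t) = c.head t := fun t => congrFun (congrArg Store.head h.restrict) t
  have htape : ∀ t p, (d.tape (some t) p).1 = c.tape t p :=
    fun t p => congrFun (congrFun (congrArg Store.tape h.restrict) t) p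
  have hscan : (fun t => (d.scan (some t)).1) = fun i => c.tape i (c.head i) := by
    funext t; simp only [Store.scan, htape, hhead]
  have h3 : (M.label c.state = .ex ∨ M.label c.state = .all) ∧
      (M.trans c.state (readInput x d.inPos) fun t => (d.scan (some t)).1).Nonempty := by
    rw [hin, hscan]; exact ⟨h1, a, h2⟩
  have h4 : h3.2.choose = a := by
    have h5 := h3.2.choose_spec
    refine hM _ _ _ h5 ?_
    rw [hin, hscan]; exact h2
  set s' := if (d.scan none).2 then decide (a.move out = .right) else s with hs'
  have h6 : (trackedFrag M out).actionAt x (.inl (c.state, s)) d =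
      ⟨some (.inl (a.state, s')), a.inMove,
          fun t => t.elim (d.scan none) fun t => (a.write t, (d.scan (some t)).2),
          fun t => t.elim (a.move out) a.move⟩ := by
    refine (dif_pos h3).trans ?_
    rw [h4]; rfl
  refine ⟨d.act x.length ((trackedFrag M out).actionAt x (.inl (c.state, s)) d), s', ?_,
    fun u d'' h7 => .step (P := trackedFrag M out) (by rw [h6]; rfl) h7⟩
  rw [h6]
  have hmark : (d.scan none).2 = decide (c.head out = 0) := by
    rw [← h.head]; exact h.mark _
  constructor
  · ext t
    · simp [Store.restrict, Store.act, ATM.Cfg.store, ATM.apply, hin]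
    · simp [Store.restrict, Store.act, ATM.Cfg.store, ATM.apply, hhead]
    · simp only [Store.restrict, Store.act, ATM.Cfg.store, ATM.apply, hhead, Function.update_apply]
      split <;> simp [htape]
  · simp [Store.act, ATM.apply, h.head]
  · intro p
    simp only [Store.act, Option.elim, Function.update_apply]
    split
    · rename_i hp
      rw [hp]
      exact h.mark _
    · exact h.mark p
  · intro t p
    simp only [Store.act, Option.elim, Function.update_apply]
    split
    · exact h.clean _ _
    · exact h.clean _ _
  · intro hp
    have hp' : 0 < moveWork (c.head out) (a.move out) := hp
    rw [hs', hmark]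
    have := h.pos
    by_cases h0 : c.head out = 0
    · rw [h0] at hp'
      cases hm : a.move out <;> simp [hm, moveWork] at hp' ⊢
      simp [h0]
    · simp only [h0, decide_false, Bool.false_eq_true, if_false]
      apply this
      cases hm : a.move out <;> simp [hm, moveWork] at hp' <;> omega
  · intro hp
    have hp' : moveWork (c.head out) (a.move out) < 0 := hp
    rw [hs', hmark]
    have := h.neg
    by_cases h0 : c.head out = 0
    · rw [h0] at hp'
      cases hm : a.move out <;> simp [hm, moveWork] at hp' ⊢
      simp [h0]
    · simp only [h0, decide_false, Bool.false_eq_true, if_false]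
      apply this
      cases hm : a.move out <;> simp [hm, moveWork] at hp' <;> omega

/-- The simulation of a path of length `t`, which leaves the heads within distance `t` of their
start. -/
theorem trackedFrag_reaches (hM : M.Deterministic) {t a : ℕ} {c : M.Cfg} (hr : M.Reaches x t a c)
    {d₀ : Store (M.Sym × Bool) (Option M.Tape)} (h₀ : TrackedRel M out M.init d₀ true) :
    ∃ d s, TrackedRel M out c d s ∧ (c.head out).natAbs ≤ t ∧ c.inPos ≤ t + 1 ∧ ∀ u d'',
      (trackedFrag M out).RunsFrom x (.inl (c.state, s)) d u d'' →
      (trackedFrag M out).Runs x d₀ (u + t) d'' := by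
  have hstep : ∀ t (c c' : M.Cfg), (∃ d s, TrackedRel M out c d s ∧ (c.head out).natAbs ≤ t ∧
      c.inPos ≤ t + 1 ∧ ∀ u d'', (trackedFrag M out).RunsFrom x (.inl (c.state, s)) d u d'' →
      (trackedFrag M out).Runs x d₀ (u + t) d'') → M.Step x c c' →
      ∃ d s, TrackedRel M out c' d s ∧ (c'.head out).natAbs ≤ t + 1 ∧ c'.inPos ≤ t + 1 + 1 ∧
      ∀ u d'', (trackedFrag M out).RunsFrom x (.inl (c'.state, s)) d u d'' →
      (trackedFrag M out).Runs x d₀ (u + (t + 1)) d'' := by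
    rintro t c c' ⟨d, s, h1, h2, h3, h4⟩ hc
    obtain ⟨d', s', h5, h6⟩ := h1.step hM hc
    obtain ⟨-, a, -, rfl⟩ := hc
    refine ⟨d', s', h5, ?_, ?_, fun u d'' h7 => ?_⟩
    · have := ATM.moveWork_natAbs_le (c.head out) (a.move out)
      change (moveWork (c.head out) (a.move out)).natAbs ≤ _
      omega
    · change moveInput _ c.inPos a.inMove ≤ _
      cases a.inMove <;> simp only [moveInput] <;> omega
    · exact (h4 _ _ (h6 u d'' h7)).mono (by omega)
  induction hr with
  | init => exact ⟨d₀, true, h₀, by simp [ATM.init], by simp [ATM.init], fun u d'' h => h⟩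
  | same _ h2 _ ih => exact hstep _ _ _ ih h2
  | alt _ h2 _ ih => exact hstep _ _ _ ih h2

/-- Once `M` has halted, the heads of `out` and of the additional tape go back to cell `0`, which is
recognized by its mark, in the direction given by `s`. -/
theorem trackedFrag_rewind {s : Bool} (k : ℕ) {d : Store (M.Sym × Bool) (Option M.Tape)}
    (hhead : d.head none = d.head (some out)) (hmark : ∀ p, (d.tape none p).2 = decide (p = 0))
    (hs : d.head (some out) = if s then (k : ℤ) else -k) :
    ∃ d', (trackedFrag M out).RunsFrom x (.inr s) d (k + 1) d' ∧ d'.inPos = d.inPos ∧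
      d'.head (some out) = 0 ∧ d'.tape = d.tape := by
  induction k generalizing d with
  | zero =>
    have h0 : d.head (some out) = 0 := by rw [hs]; simp
    have h1 : (trackedFrag M out).actionAt x (.inr s) d = .idle none d.scan := by
      refine if_pos ?_
      rw [Store.scan, hmark, hhead, h0]; rfl
    refine ⟨_, .exit (P := trackedFrag M out) (by rw [h1]; rfl), ?_⟩
    rw [h1, Store.act_idle]
    exact ⟨rfl, h0, rfl⟩
  | succ k ih =>
    have h0 : d.head (some out) ≠ 0 := by
      rw [hs]; cases s <;> simp only [if_true, if_false, Bool.false_eq_true] <;> omega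
    have h1 : (trackedFrag M out).actionAt x (.inr s) d = ⟨some (.inr s), .stay, d.scan, fun t =>
        open Classical in
        if t = none ∨ t = some out then (if s then .left else .right) else .stay⟩ := by
      refine if_neg ?_
      rw [Store.scan, hmark, hhead]
      simpa using h0
    set d₁ := d.act x.length ((trackedFrag M out).actionAt x (.inr s) d) with hd₁
    have h2 : d₁.tape = d.tape := by
      rw [hd₁, h1]; funext t; simp [Store.act, Store.scan]
    have h3 : d₁.head none = moveWork (d.head none) (if s then .left else .right) := by
      rw [hd₁, h1]; simp [Store.act]
    have h4 : d₁.head (some out) = moveWork (d.head (some out)) (if s then .left else .right) := by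
      rw [hd₁, h1]; simp [Store.act]
    have h5 : d₁.inPos = d.inPos := by rw [hd₁, h1]; rfl
    obtain ⟨d', h6, h7, h8, h9⟩ := ih (d := d₁) (by rw [h3, h4, hhead]) (by rw [h2]; exact hmark)
      (by rw [h4, hs]; cases s <;> simp [moveWork])
    exact ⟨d', .step (P := trackedFrag M out) (by rw [h1]) h6, h7.trans h5, h8, h9.trans h2⟩

/-- A machine witnessing time-constructibility yields a fragment that, moreover, puts its heads
back. The work head may have gone to either side of cell `0`, and the tape `out` need not show
where this cell is; therefore a second head, on a tape with a mark, is moved along. -/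
theorem TimeConstructible.unaryFrag {f : ℕ → ℕ} (hf : TimeConstructible f) :
    Nonempty (UnaryFrag f) := by
  obtain ⟨-, M, out, one, b, hM, hone, hf⟩ := hf
  have := M.finSym
  have := M.finTape
  let mark : Frag Unit (M.Sym × Bool) (Option M.Tape) := .once fun _ w =>
    ⟨(), .stay, fun t => t.elim ((w none).1, true) fun t => w (some t), fun _ => .stay⟩
  refine ⟨⟨M.Sym × Bool, Option M.Tape, inferInstance, inferInstance, (M.blank, false),
    (one, false), some out, (mark.seq (trackedFrag M out)).seq (.rewindInput _ _ _),
    3 * b + 10, by simpa using hone, fun n => ?_⟩⟩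
  obtain ⟨t, a, c, h1, h2, h3, h4, h5⟩ := hf n
  have h6 := Frag.once_runs (fun (_ : InSym Unit) (w : Option M.Tape → M.Sym × Bool) =>
    (⟨(), .stay, fun t => t.elim ((w none).1, true) fun t => w (some t), fun _ => .stay⟩ :
      Action Unit (M.Sym × Bool) (Option M.Tape)))
    (List.replicate n ()) (Store.initial (M.blank, false))
  set d₀ := Store.act (List.replicate n ()).length (Store.initial (M.blank, false)) _
  have h₀ : TrackedRel M out M.init d₀ true := by
    refine ⟨?_, ?_, ?_, ?_, ?_, ?_⟩
    · ext t
      · rfl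
      · rfl
      · simp [d₀, Store.restrict, Store.act, Store.initial, ATM.Cfg.store, ATM.init, Store.scan]
    · rfl
    · intro p
      by_cases hp : p = 0 <;>
        simp [d₀, Store.act, Store.initial, Store.scan, hp]
    · simp [d₀, Store.act, Store.initial, Store.scan]
    · simp
    · intro h; exact absurd h (by simp [ATM.init])
  obtain ⟨d, s, h7, h8, h9, h10⟩ := trackedFrag_reaches hM h1 h₀
  have h11 : (trackedFrag M out).actionAt (List.replicate n ()) (.inl (c.state, s)) d =
      .idle (some (.inr s)) d.scan := by
    refine dif_neg ?_
    rw [h3]; simp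
  have hh : d.head (some out) = c.head out := congrFun (congrArg Store.head h7.restrict) out
  obtain ⟨d₁, h12, h13, h14, h15⟩ := trackedFrag_rewind (M := M) (out := out)
    (x := List.replicate n ()) (s := s) (c.head out).natAbs (d := d) (by rw [hh, h7.head]) h7.mark
    (by
      rw [hh]
      have h1 := h7.pos
      have h2 := h7.neg
      rcases lt_trichotomy (c.head out) 0 with h | h | h
      · rw [h2 h, if_neg (by simp)]; omega
      · rw [h]; simp
      · rw [h1 h, if_pos rfl]; omega)
  have h16 := h10 _ _ (.step (P := trackedFrag M out) (d := d) (by rw [h11]; rfl)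
    (by rw [h11, Store.act_idle]; exact h12))
  have h17 := (Frag.Runs.seq (P := mark) h6 h16).seq (Frag.rewindInput_runs _ d₁)
  refine ⟨_, h17.mono ?_, rfl, h14, ?_⟩
  · rw [h13, show d.inPos = c.inPos from congrArg Store.inPos h7.restrict]
    nlinarith
  · change d₁.tape (some out) = _
    rw [h15]
    funext p
    have h18 : (d.tape (some out) p).1 = c.tape out p :=
      congrFun (congrFun (congrArg Store.tape h7.restrict) out) p
    refine Prod.ext ?_ ?_
    · rw [h18, unary]
      split
      · rename_i hp; exact h4 p hp.1 hp.2
      · rename_i hp; exact h5 p (by omega)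
    · rw [h7.clean, unary]
      split <;> rfl

end tracked

theorem timeConstructible_of_frag {f : ℕ → ℕ} (hf : ∀ n, n ≤ f n) {Sym Tape : Type}
    [Finite Sym] [Finite Tape] {blank one : Sym} (hone : one ≠ blank) (out : Tape)
    (P : Frag Unit Sym Tape) (b : ℕ)
    (h : ∀ n, ∃ d, P.Runs (List.replicate n ()) (Store.initial blank) (b * f n + b) d ∧
      d.tape out = unary blank one (f n)) : TimeConstructible f := by
  refine ⟨hf, P.toATM blank, out, one, b, ?_, hone, fun n => ?_⟩
  · rintro (_ | s) i w
    · exact Set.subsingleton_empty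
    · exact Set.subsingleton_singleton
  · obtain ⟨d, h1, h2⟩ := h n
    obtain ⟨u, a, h3, h4⟩ := h1.reaches (blank := blank) .init
    refine ⟨u, a, _, h4, by omega, rfl, ?_, ?_⟩
    · intro p hp hp'
      change d.tape out p = one
      rw [h2]
      exact if_pos ⟨hp, hp'⟩
    · intro p hp
      change d.tape out p = blank
      rw [h2]
      exact if_neg (by omega)

/-- Running a fragment for `f` on some of the tapes of a larger machine, on an arbitrary input. -/
theorem UnaryFrag.lift_runs {f : ℕ → ℕ} (T : UnaryFrag f) {α : Type} (x : List α)
    {Sym' Tape' : Type} {r : T.Tape → Sym' → T.Sym} {e : T.Tape → T.Sym → Sym'}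
    (hre : ∀ i s, r i (e i s) = s) {ι : T.Tape → Tape'} (hι : ι.Injective)
    {d : Store Sym' Tape'} (hd : d.restrict r ι = Store.initial T.blank) :
    ∃ d', (T.P.lift (fun _ => ()) r e ι).Runs x d (T.b * f x.length + T.b) d' ∧ d'.inPos = 1 ∧
      d'.head (ι T.out) = 0 ∧
      (∀ p, r T.out (d'.tape (ι T.out) p) = unary T.blank T.one (f x.length) p) ∧
      ∀ i, i ∉ Set.range ι → d'.head i = d.head i ∧ d'.tape i = d.tape i := by
  obtain ⟨d₁, h1, h2, h3, h4⟩ := T.runs x.length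
  rw [← hd] at h1
  obtain ⟨d', h5, rfl, h7, -⟩ := Frag.Runs.lift (φ := fun _ : α => ()) hre hι
    (x := x) (d := d) (t := T.b * f x.length + T.b) (d₁ := d₁) (by
      rwa [List.map_const'])
  exact ⟨d', h5, h2, h3, fun p => congrFun h4 p, h7⟩

end AltTM

namespace AltTM

/-! ### Time-constructible functions are closed under sum, product and exponentiation -/

/-- A store with four tapes holding unary numbers, the input head being on the first letter. -/
noncomputable def counters (h : Fin 4 → ℤ) (k : Fin 4 → ℕ) : Store Bool (Fin 4) :=
  ⟨1, h, fun i => unary false true (k i)⟩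

theorem unary_false_true (k : ℕ) (p : ℤ) : unary false true k p = true ↔ 0 ≤ p ∧ p < k := by
  simp [unary]

/-- The effect of an instruction on a unary tape: nothing is changed, or a symbol is added or
removed at the end. -/
def CounterStep (h : ℤ) (k k' : ℕ) (w : Option Bool) : Prop :=
  (w = none ∧ k' = k) ∨ (w = some true ∧ h = k ∧ k' = k + 1) ∨
    (w = some false ∧ h = k' ∧ k = k' + 1)

/-- The action that writes `w i` on tape `i`, if this is not `none`, and moves its head
by `m i`. -/
def counterAct (w : Fin 4 → Option Bool) (m : Fin 4 → Dir) (s : Fin 4 → Bool) :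
    Action Unit Bool (Fin 4) := ⟨(), .stay, fun i => (w i).getD (s i), m⟩

theorem counters_act {h : Fin 4 → ℤ} {k k' : Fin 4 → ℕ} {w : Fin 4 → Option Bool}
    (hw : ∀ i, CounterStep (h i) (k i) (k' i) (w i)) (m : Fin 4 → Dir) (n : ℕ) :
    (counters h k).act n (counterAct w m (counters h k).scan) =
      counters (fun i => moveWork (h i) (m i)) k' := by
  ext i p
  · rfl
  · rfl
  · rw [Bool.eq_iff_iff]
    simp only [Store.act, counterAct, counters, Store.scan, Function.update_apply,
      unary_false_true]
    have := hw i
    unfold CounterStep at this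
    rcases this with ⟨h1, h2⟩ | ⟨h1, h2, h3⟩ | ⟨h1, h2, h3⟩
    · split
      · rename_i h4
        simp [h1, h2, h4, unary_false_true]
      · rw [h2, unary_false_true]
    · split
      · simp [h1]; omega
      · rw [unary_false_true]; omega
    · split
      · simp [h1]; omega
      · rw [unary_false_true]; omega

/-- A loop moving over the tape `j`. -/
noncomputable def counterLoop (j : Fin 4) (w : Fin 4 → Option Bool) (m m' : Fin 4 → Dir) :
    Frag Unit Bool (Fin 4) :=
  .loop (fun _ s => s j = true) (fun _ s => counterAct w m s)
    (fun _ s => counterAct (fun _ => none) m' s)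

/-- A loop with `N` rounds on unary tapes; `h i` and `k i` are the head positions and the numbers
at the beginning of round `i`. The first and last values are separate variables with equations for
them, so that consecutive loops can be composed by unification. -/
theorem counterLoop_runs (N : ℕ) (h : ℕ → Fin 4 → ℤ) (k : ℕ → Fin 4 → ℕ) {j : Fin 4}
    {w : Fin 4 → Option Bool} {m m' : Fin 4 → Dir} {x : List Unit} {h₀ h₁ : Fin 4 → ℤ}
    {k₀ k₁ : Fin 4 → ℕ}
    (hpos : ∀ i < N, 0 ≤ h i j ∧ h i j < k i j) (hneg : h N j < 0 ∨ (k N j : ℤ) ≤ h N j)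
    (hk : ∀ i < N, ∀ t, CounterStep (h i t) (k i t) (k (i + 1) t) (w t))
    (hh : ∀ i < N, ∀ t, h (i + 1) t = moveWork (h i t) (m t))
    (e₀ : h₀ = h 0) (f₀ : k₀ = k 0) (e₁ : ∀ t, h₁ t = moveWork (h N t) (m' t)) (f₁ : k₁ = k N) :
    (counterLoop j w m m').Runs x (counters h₀ k₀) (N + 1) (counters h₁ k₁) := by
  obtain ⟨d', rfl, h2⟩ := Frag.loop_runs (test := fun _ s => s j = true)
    (a := fun _ s => counterAct w m s)
    (b := fun _ s => counterAct (fun _ => none) m' s) (x := x) N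
    (I := fun i d => d = counters (h i) (k i)) (d := counters h₀ k₀) (by rw [e₀, f₀])
    (by
      rintro i hi _ rfl
      refine ⟨(unary_false_true _ _).2 (hpos i hi), ?_⟩
      rw [counters_act (hk i hi), funext (hh i hi)])
    (by
      rintro _ rfl
      refine fun h3 => ?_
      have h4 : 0 ≤ h N j ∧ h N j < k N j := (unary_false_true _ _).1 h3
      omega)
  rw [counters_act (k' := k N) (fun i => .inl ⟨rfl, rfl⟩), ← funext e₁, ← f₁] at h2
  exact h2

open Classical in
/-- Post-processing of unary numbers: from a fragment that computes `h n` from `f n` and `g n`. -/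
theorem TimeConstructible.of_counters {f g h : ℕ → ℕ} (hf : TimeConstructible f)
    (hg : TimeConstructible g) (hn : ∀ n, n ≤ h n) (Q : Frag Unit Bool (Fin 4)) (b : ℕ)
    (hbf : ∀ n, f n ≤ b * h n + b) (hbg : ∀ n, g n ≤ b * h n + b)
    (hQ : ∀ n, ∃ H k, Q.Runs (List.replicate n ()) (counters (fun _ => 0) ![f n, g n, 0, 0])
      (b * h n + b) (counters H k) ∧ k 2 = h n) : TimeConstructible h := by
  obtain ⟨T⟩ := hf.unaryFrag
  obtain ⟨U⟩ := hg.unaryFrag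
  have := T.finSym
  have := T.finTape
  have := U.finSym
  have := U.finTape
  let ι₁ : T.Tape → T.Tape ⊕ U.Tape ⊕ Fin 2 := .inl
  let ι₂ : U.Tape → T.Tape ⊕ U.Tape ⊕ Fin 2 := fun i => .inr (.inl i)
  let ι₃ : Fin 4 → T.Tape ⊕ U.Tape ⊕ Fin 2 :=
    ![.inl T.out, .inr (.inl U.out), .inr (.inr 0), .inr (.inr 1)]
  let r₃ : Fin 4 → T.Sym × U.Sym × Bool → Bool := fun i s =>
    ![decide (s.1 = T.one), decide (s.2.1 = U.one), s.2.2, s.2.2] i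
  let e₃ : Fin 4 → Bool → T.Sym × U.Sym × Bool := fun i s =>
    ![(if s then T.one else T.blank, U.blank, false), (T.blank, if s then U.one else U.blank, false),
      (T.blank, U.blank, s), (T.blank, U.blank, s)] i
  have hι₃ : ι₃.Injective := by
    intro i j
    fin_cases i <;> fin_cases j <;> simp [ι₃]
  have hre₃ : ∀ i s, r₃ i (e₃ i s) = s := by
    have h1 := T.one_ne.symm
    have h2 := U.one_ne.symm
    intro i s
    fin_cases i <;> cases s <;> simp [r₃, e₃, h1, h2]
  let P₁ : Frag Unit (T.Sym × U.Sym × Bool) (T.Tape ⊕ U.Tape ⊕ Fin 2) :=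
    T.P.lift (fun _ => ()) (fun _ s => s.1) (fun _ s => (s, U.blank, false)) ι₁
  let P₂ : Frag Unit (T.Sym × U.Sym × Bool) (T.Tape ⊕ U.Tape ⊕ Fin 2) :=
    U.P.lift (fun _ => ()) (fun _ s => s.2.1) (fun _ s => (T.blank, s, false)) ι₂
  refine timeConstructible_of_frag hn (blank := (T.blank, U.blank, false))
    (one := (T.blank, U.blank, true)) (by simp) (.inr (.inr 0))
    ((P₁.seq P₂).seq (Q.lift id r₃ e₃ ι₃)) (T.b * (b + 1) + U.b * (b + 1) + b) fun n => ?_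
  set x := List.replicate n ()
  have hx : x.length = n := by simp [x]
  obtain ⟨d₁, h1, h2, h3, h4, h5⟩ := T.lift_runs x (e := fun _ s => (s, U.blank, false))
    (r := fun _ s => s.1) (ι := ι₁) (fun _ _ => rfl) Sum.inl_injective
    (d := Store.initial (T.blank, U.blank, false)) rfl
  have h5' : ∀ i, d₁.head (.inr i) = 0 ∧ d₁.tape (.inr i) = fun _ => (T.blank, U.blank, false) :=
    fun i => h5 _ (by simp [ι₁])
  obtain ⟨d₂, h6, h7, h8, h9, h10⟩ := U.lift_runs x (e := fun _ s => (T.blank, s, false))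
    (r := fun _ s => s.2.1) (ι := ι₂) (fun _ _ => rfl)
    (Sum.inr_injective.comp Sum.inl_injective) (d := d₁) (by
      ext i
      · exact h2
      · exact (h5' _).1
      · simp only [Store.restrict, ι₂, (h5' _).2]; rfl)
  have h11 := h10 (.inl T.out) (by simp [ι₂])
  have h12 : ∀ i, d₂.head (.inr (.inr i)) = 0 ∧
      d₂.tape (.inr (.inr i)) = fun _ => (T.blank, U.blank, false) := by
    intro i
    have := h10 (.inr (.inr i)) (by simp [ι₂])
    rw [this.1, this.2]
    exact h5' _
  obtain ⟨H, k, h13, h14⟩ := hQ n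
  have h15 : d₂.restrict r₃ ι₃ = counters (fun _ => 0) ![f n, g n, 0, 0] := by
    have h1 := T.one_ne.symm
    have h2 := U.one_ne.symm
    rw [hx] at h4 h9
    ext i p
    · exact h7
    · fin_cases i
      · exact h11.1.trans h3
      · exact h8
      · exact (h12 0).1
      · exact (h12 1).1
    · fin_cases i
      · have : (d₂.tape (.inl T.out) p).1 = unary T.blank T.one (f n) p := by rw [h11.2]; exact h4 p
        simp only [Store.restrict, r₃, ι₃, counters, Fin.zero_eta, Matrix.cons_val_zero, this]
        unfold unary; split <;> simp [h1]
      · have : (d₂.tape (.inr (.inl U.out)) p).2.1 = unary U.blank U.one (g n) p := h9 p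
        simp only [Store.restrict, r₃, ι₃, counters, Fin.mk_one, Matrix.cons_val_one,
          Matrix.cons_val_zero, this]
        unfold unary; split <;> simp [h2]
      · have : d₂.tape (.inr (.inr 0)) p = (T.blank, U.blank, false) := by rw [(h12 0).2]
        change (d₂.tape (.inr (.inr 0)) p).2.2 = unary false true 0 p
        rw [this]; unfold unary; split <;> first | rfl | (exfalso; omega)
      · have : d₂.tape (.inr (.inr 1)) p = (T.blank, U.blank, false) := by rw [(h12 1).2]
        change (d₂.tape (.inr (.inr 1)) p).2.2 = unary false true 0 p
        rw [this]; unfold unary; split <;> first | rfl | (exfalso; omega)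
  rw [← h15] at h13
  obtain ⟨d₃, h16, h17, -, h18⟩ := Frag.Runs.lift (φ := id) hre₃ hι₃ (x := x) (d := d₂)
    (by rwa [List.map_id])
  refine ⟨d₃, ((Frag.Runs.seq (P := P₁) (Q := P₂) h1 h6).seq h16).mono ?_, ?_⟩
  · rw [hx]
    have := Nat.mul_le_mul_left T.b (hbf n)
    have := Nat.mul_le_mul_left U.b (hbg n)
    nlinarith
  · funext p
    have h19 : (d₃.tape (.inr (.inr 0)) p).2.2 = unary false true (h n) p := by
      rw [← h14]
      exact congrFun (congrFun (congrArg Store.tape h17) 2) p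
    have h20 : ∃ s, d₃.tape (.inr (.inr 0)) p = (T.blank, U.blank, s) := by
      rcases h18 2 p with ⟨s, hs⟩ | hs
      · exact ⟨s, hs.symm⟩
      · exact ⟨false, hs.trans (by change d₂.tape (.inr (.inr 0)) p = _; rw [(h12 0).2])⟩
    obtain ⟨s, hs⟩ := h20
    rw [hs] at h19 ⊢
    change s = _ at h19
    rw [h19]
    unfold unary
    split <;> rfl

theorem TimeConstructible.add {f g : ℕ → ℕ} (hf : TimeConstructible f)
    (hg : TimeConstructible g) : TimeConstructible (f + g) := by
  refine hf.of_counters hg (fun n => (hf.1 n).trans (Nat.le_add_right _ _))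
    ((counterLoop 0 ![none, none, some true, none] ![.right, .stay, .right, .stay]
        fun _ => .stay).seq
      (counterLoop 1 ![none, none, some true, none] ![.stay, .right, .right, .stay]
        fun _ => .stay)) 2
    (fun n => by simp only [Pi.add_apply]; omega) (fun n => by simp only [Pi.add_apply]; omega)
    fun n => ?_
  refine ⟨![f n, g n, f n + g n, 0], ![f n, g n, f n + g n, 0], ?_, by simp⟩
  refine Frag.Runs.mono (t := f n + 1 + (g n + 1)) (.seq
    (counterLoop_runs (h₁ := ![f n, 0, f n, 0]) (k₁ := ![f n, g n, f n, 0]) (f n)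
      (fun i => ![i, 0, i, 0]) (fun i => ![f n, g n, i, 0]) ?_ ?_ ?_ ?_ ?_ ?_ ?_ ?_)
    (counterLoop_runs (g n)
      (fun i => ![f n, i, f n + i, 0]) (fun i => ![f n, g n, f n + i, 0]) ?_ ?_ ?_ ?_ ?_ ?_ ?_ ?_))
    (by simp only [Pi.add_apply]; omega)
  all_goals
    first
    | (intro i hi; simp [Fin.forall_fin_succ, CounterStep, moveWork]; done)
    | (intro i hi; simp [Fin.forall_fin_succ, CounterStep, moveWork]; omega)
    | (simp [moveWork]; done)
    | (ext i; fin_cases i <;> simp)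

/-- For each of the `f n` symbols on the first tape, the second tape is copied to the end of the
third. -/
theorem TimeConstructible.mul {f g : ℕ → ℕ} (hf : TimeConstructible f)
    (hg : TimeConstructible g) : TimeConstructible (f * g) := by
  have hle : ∀ n, f n ≤ f n * g n + f 0 ∧ g n ≤ f n * g n + g 0 := by
    intro n
    rcases Nat.eq_zero_or_pos n with rfl | hn
    · exact ⟨Nat.le_add_left _ _, Nat.le_add_left _ _⟩
    · have h1 := hf.1 n
      have h2 := hg.1 n
      exact ⟨(Nat.le_mul_of_pos_right _ (by omega)).trans (Nat.le_add_right _ _),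
        (Nat.le_mul_of_pos_left _ (by omega)).trans (Nat.le_add_right _ _)⟩
  have hn : ∀ n, n ≤ (f * g) n := by
    intro n
    rcases Nat.eq_zero_or_pos n with rfl | hn
    · exact Nat.zero_le _
    · have h1 := hf.1 n
      have h2 := hg.1 n
      exact h1.trans (Nat.le_mul_of_pos_right _ (by omega))
  have hexp : ∀ n, (5 * f 0 + g 0 + 7) * (f * g) n =
      5 * (f 0 * (f n * g n)) + g 0 * (f n * g n) + 7 * (f n * g n) := fun n => by
    simp only [Pi.mul_apply]; ring
  refine hf.of_counters hg hn
    (.whileDo (fun _ s => s 0 = true)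
      ((counterLoop 1 ![none, none, some true, none] ![.stay, .right, .right, .stay]
        ![.stay, .left, .stay, .stay]).seq
      (counterLoop 1 (fun _ => none) ![.stay, .left, .stay, .stay]
        ![.right, .right, .stay, .stay]))) (5 * f 0 + g 0 + 7)
    (fun n => by have := (hle n).1; rw [hexp]; omega)
    (fun n => by have := (hle n).2; rw [hexp]; omega) fun n => ?_
  obtain ⟨d', rfl, h2⟩ := Frag.whileDo_runs (test := fun _ s => s 0 = true)
    (P := (counterLoop 1 ![none, none, some true, none] ![.stay, .right, .right, .stay]
        ![.stay, .left, .stay, .stay]).seq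
      (counterLoop 1 (fun _ => none) ![.stay, .left, .stay, .stay]
        ![.right, .right, .stay, .stay])) (x := List.replicate n ()) (f n)
    (I := fun i d => d = counters ![i, 0, i * g n, 0] ![f n, g n, i * g n, 0])
    (B := fun _ => g n + 1 + (g n + 1)) (d := counters (fun _ => 0) ![f n, g n, 0, 0])
    (by congr 1 <;> ext i <;> fin_cases i <;> simp)
    (by
      rintro i hi _ rfl
      refine ⟨(unary_false_true _ _).2 (by simp [counters]; omega), _, ?_, rfl⟩
      refine .seq
        (counterLoop_runs (h₁ := ![i, g n - 1, i * g n + g n, 0])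
          (k₁ := ![f n, g n, i * g n + g n, 0]) (g n)
          (fun m => ![i, m, i * g n + m, 0]) (fun m => ![f n, g n, i * g n + m, 0])
          ?_ ?_ ?_ ?_ ?_ ?_ ?_ ?_)
        (counterLoop_runs (g n) (fun m => ![i, g n - 1 - m, i * g n + g n, 0])
          (fun m => ![f n, g n, i * g n + g n, 0]) ?_ ?_ ?_ ?_ ?_ ?_ ?_ ?_)
      all_goals
        first
        | (intro m hm; simp [Fin.forall_fin_succ, CounterStep, moveWork]; done)
        | (intro m hm; simp [Fin.forall_fin_succ, CounterStep, moveWork]; omega)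
        | (simp [Fin.forall_fin_succ, moveWork]; done)
        | (simp [Fin.forall_fin_succ, moveWork]; ring))
    (by
      rintro _ rfl
      refine fun h => ?_
      have h4 := (unary_false_true _ _).1 h
      simp [counters] at h4)
  refine ⟨_, _, h2.mono ?_, rfl⟩
  have h1 := (hle n).1
  have h3 : ∑ i ∈ Finset.range (f n), (g n + 1 + (g n + 1) + 1) = 2 * (f n * g n) + 3 * f n := by
    simp only [Finset.sum_const, Finset.card_range, smul_eq_mul]; ring
  rw [hexp, h3]
  omega

/-- For each of the `f n` symbols on the first tape, the number on the third tape is doubled: its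
symbols are counted on the fourth tape, and these are then moved to the end of the third. -/
theorem TimeConstructible.two_pow {f : ℕ → ℕ} (hf : TimeConstructible f) :
    TimeConstructible (fun n => 2 ^ f n) := by
  have hle : ∀ n, f n ≤ 2 ^ f n := fun n => Nat.lt_two_pow_self.le
  refine hf.of_counters hf (fun n => (hf.1 n).trans (hle n))
    ((Frag.once fun _ s => counterAct ![none, none, some true, none] (fun _ => .stay) s).seq
    (.whileDo (fun _ s => s 0 = true)
      (((counterLoop 2 ![none, none, none, some true] ![.stay, .stay, .right, .right]
        ![.stay, .stay, .stay, .left]).seq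
      (counterLoop 3 ![none, none, some true, some false] ![.stay, .stay, .right, .left]
        ![.stay, .stay, .left, .right])).seq
      (counterLoop 2 (fun _ => none) ![.stay, .stay, .left, .stay]
        ![.right, .stay, .right, .stay])))) 12
    (fun n => by have := hle n; omega) (fun n => by have := hle n; omega) fun n => ?_
  have h1 := Frag.once_runs (fun _ s => counterAct ![none, none, some true, none]
    (fun _ => .stay) s) (List.replicate n ()) (counters (fun _ => 0) ![f n, f n, 0, 0])
  rw [counters_act (k' := ![f n, f n, 1, 0])
    (by simp [Fin.forall_fin_succ, CounterStep])] at h1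
  obtain ⟨d', rfl, h2⟩ := Frag.whileDo_runs (test := fun _ s => s 0 = true)
    (P := ((counterLoop 2 ![none, none, none, some true] ![.stay, .stay, .right, .right]
        ![.stay, .stay, .stay, .left]).seq
      (counterLoop 3 ![none, none, some true, some false] ![.stay, .stay, .right, .left]
        ![.stay, .stay, .left, .right])).seq
      (counterLoop 2 (fun _ => none) ![.stay, .stay, .left, .stay]
        ![.right, .stay, .right, .stay])) (x := List.replicate n ()) (f n)
    (I := fun i d => d = counters ![i, 0, 0, 0] ![f n, f n, 2 ^ i, 0])
    (B := fun i => 2 ^ i + 1 + (2 ^ i + 1) + (2 * 2 ^ i + 1))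
    (d := counters (fun _ => moveWork 0 .stay) ![f n, f n, 1, 0])
    (by congr 1; ext i; fin_cases i <;> simp [moveWork])
    (by
      rintro i hi _ rfl
      refine ⟨(unary_false_true _ _).2 (by simp [counters]; omega), _, ?_, rfl⟩
      rw [pow_succ]
      generalize 2 ^ i = K
      refine .seq (.seq
        (counterLoop_runs (h₁ := ![i, 0, K, K - 1]) (k₁ := ![f n, f n, K, K]) K
          (fun m => ![i, 0, m, m]) (fun m => ![f n, f n, K, m]) ?_ ?_ ?_ ?_ ?_ ?_ ?_ ?_)
        (counterLoop_runs (h₁ := ![i, 0, 2 * K - 1, 0]) (k₁ := ![f n, f n, 2 * K, 0]) K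
          (fun m => ![i, 0, K + m, K - 1 - m]) (fun m => ![f n, f n, K + m, K - m])
          ?_ ?_ ?_ ?_ ?_ ?_ ?_ ?_))
        (counterLoop_runs (2 * K) (fun m => ![i, 0, 2 * K - 1 - m, 0])
          (fun m => ![f n, f n, 2 * K, 0]) ?_ ?_ ?_ ?_ ?_ ?_ ?_ ?_)
      all_goals
        first
        | (intro m hm; simp [Fin.forall_fin_succ, CounterStep, moveWork]; done)
        | (intro m hm; simp [Fin.forall_fin_succ, CounterStep, moveWork]; omega)
        | (simp [Fin.forall_fin_succ, moveWork]; done)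
        | (simp [Fin.forall_fin_succ, moveWork]; omega))
    (by
      rintro _ rfl
      refine fun h => ?_
      have h4 := (unary_false_true _ _).1 h
      simp [counters] at h4)
  refine ⟨_, _, (h1.seq h2).mono ?_, rfl⟩
  have h3 : ∀ k : ℕ, ∑ i ∈ Finset.range k, (2 ^ i + 1 + (2 ^ i + 1) + (2 * 2 ^ i + 1) + 1) + 4 =
      4 * 2 ^ k + 4 * k := by
    intro k
    induction k with
    | zero => simp
    | succ k ih => rw [Finset.sum_range_succ, pow_succ]; omega
  have := h3 (f n)
  have := hle n
  omega

theorem TimeConstructible.id : TimeConstructible fun n => n := by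
  refine timeConstructible_of_frag (fun _ => le_rfl) (blank := false) (one := true) (by simp) ()
    (.loop (fun i _ => i ≠ .rightEnd) (fun _ _ => ⟨(), .right, fun _ => true, fun _ => .right⟩)
      (fun _ w => .idle () w)) 1 fun n => ?_
  obtain ⟨d', rfl, h2⟩ := Frag.loop_runs (test := fun i _ => i ≠ .rightEnd)
    (a := fun _ _ => ⟨(), .right, fun _ => true, fun _ => .right⟩)
    (b := fun _ w => .idle () w) (x := List.replicate n ()) n
    (I := fun i d => d = (⟨i + 1, fun _ => i, fun _ => unary false true i⟩ : Store Bool Unit))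
    (d := Store.initial false)
    (by ext <;> simp [Store.initial, unary])
    (by
      rintro i hi _ rfl
      refine ⟨by simp [readInput, hi], ?_⟩
      ext t p
      · simp [Store.act, moveInput]; omega
      · simp [Store.act, moveWork]
      · rw [Bool.eq_iff_iff]
        simp only [Store.act, Function.update_apply]
        rw [unary_false_true]
        split
        · simp; omega
        · rw [unary_false_true]; push_cast; omega)
    (by rintro _ rfl; simp [readInput])
  rw [Store.act_idle] at h2
  exact ⟨_, h2.mono (by omega), rfl⟩

end AltTM

namespace AltTM

/-! ### Words that carry a second word and a computation path -/

instance : Finite Dir := Finite.of_injective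
  (fun d : Dir => (match d with | .left => 0 | .stay => 1 | .right => 2 : Fin 3)) (by
    intro a b h
    cases a <;> cases b <;> simp at h ⊢)

instance {State Sym Tape : Type} [Finite State] [Finite Sym] [Finite Tape] :
    Finite (Action State Sym Tape) := Finite.of_injective
  (fun a => (a.state, a.inMove, a.write, a.move)) (by
    rintro ⟨_, _, _, _⟩ ⟨_, _, _, _⟩ h
    simpa using h)

variable {α β γ : Type}

/-- The longest prefix of `y` all of whose letters are decoded by `δ`, decoded. -/
def decodePrefix (δ : β → Option α) : List β → List α
  | [] => []
  | b :: y => match δ b with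
    | none => []
    | some a => a :: decodePrefix δ y

/-- The content of an input cell, letters without a decoding being taken for the right end. -/
def decodeCell (δ : β → Option α) : InSym β → InSym α
  | .leftEnd => .leftEnd
  | .letter b => match δ b with
    | none => .rightEnd
    | some a => .letter a
  | .rightEnd => .rightEnd

/-- Movement of a head that is stopped by the right end marker. -/
def clampRight : InSym α → Dir → Dir
  | .rightEnd, .right => .stay
  | _, m => m

theorem decodePrefix_getElem? (δ : β → Option α) (y : List β) (i : ℕ)
    (hi : i ≤ (decodePrefix δ y).length) : (decodePrefix δ y)[i]? = y[i]?.bind δ := by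
  induction y generalizing i with
  | nil => simp [decodePrefix]
  | cons b y ih =>
    simp only [decodePrefix] at hi ⊢
    cases h : δ b with
    | none =>
      simp only [h, List.length_nil, Nat.le_zero] at hi
      subst hi
      simp [h]
    | some a =>
      cases i with
      | zero => simp [h]
      | succ i => simpa using ih i (by simpa [h] using hi)

theorem decodePrefix_length_le (δ : β → Option α) (y : List β) :
    (decodePrefix δ y).length ≤ y.length := by
  induction y with
  | nil => simp [decodePrefix]
  | cons b y ih =>
    simp only [decodePrefix]
    cases δ b <;> simp [ih]

theorem decodePrefix_eq (δ : β → Option α) (x : List α) (y : List β)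
    (h : ∀ i ≤ x.length, y[i]?.bind δ = x[i]?) : decodePrefix δ y = x := by
  induction x generalizing y with
  | nil =>
    have h0 := h 0 le_rfl
    cases y with
    | nil => rfl
    | cons b y =>
      have h1 : δ b = none := by simpa using h0
      simp [decodePrefix, h1]
  | cons a x ih =>
    have h0 := h 0 (Nat.zero_le _)
    cases y with
    | nil => simp at h0
    | cons b y =>
      have h1 : δ b = some a := by simpa using h0
      simp only [decodePrefix, h1]
      rw [ih y fun i hi => by simpa using h (i + 1) (by simpa using hi)]

theorem readInput_decodePrefix (δ : β → Option α) (y : List β) (p : ℕ)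
    (hp : p ≤ (decodePrefix δ y).length + 1) :
    readInput (decodePrefix δ y) p = decodeCell δ (readInput y p) := by
  unfold readInput
  by_cases h0 : p = 0
  · simp [h0, decodeCell]
  · rw [if_neg h0, if_neg h0, decodePrefix_getElem? δ y _ (by omega)]
    cases h1 : y[p - 1]? with
    | none => simp [decodeCell]
    | some b => cases h2 : δ b <;> simp [h2, decodeCell]

theorem readInput_eq_rightEnd_iff (x : List α) (p : ℕ) :
    readInput x p = .rightEnd ↔ x.length < p := by
  unfold readInput
  by_cases h0 : p = 0
  · simp [h0]
  · rw [if_neg h0]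
    cases h1 : x[p - 1]? with
    | none =>
      rw [List.getElem?_eq_none_iff] at h1
      simp; omega
    | some a =>
      obtain ⟨h2, -⟩ := List.getElem?_eq_some_iff.1 h1
      simp; omega

theorem clampRight_of_ne {i : InSym α} (h : i ≠ .rightEnd) (m : Dir) : clampRight i m = m := by
  cases i <;> simp [clampRight] at h ⊢

theorem moveInput_le (n p : ℕ) (h : p ≤ n + 1) (m : Dir) : moveInput n p m ≤ n + 1 := by
  cases m <;> simp only [moveInput] <;> omega

/-- On the longer word, the head moves as on its decoded prefix if it is stopped at the first letter
without a decoding. -/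
theorem moveInput_decodePrefix (δ : β → Option α) (y : List β) (p : ℕ)
    (hp : p ≤ (decodePrefix δ y).length + 1) (m : Dir) :
    moveInput y.length p (clampRight (decodeCell δ (readInput y p)) m) =
      moveInput (decodePrefix δ y).length p m := by
  rw [← readInput_decodePrefix δ y p hp]
  have h1 := decodePrefix_length_le δ y
  by_cases h : readInput (decodePrefix δ y) p = .rightEnd
  · rw [h]
    rw [readInput_eq_rightEnd_iff] at h
    cases m <;> simp only [clampRight, moveInput]
    omega
  · rw [clampRight_of_ne h]
    rw [readInput_eq_rightEnd_iff] at h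
    cases m <;> simp only [moveInput]
    omega

/-- The word of length `N` whose letters carry, on two tracks, the letters of `x` and the
entries of `π`. -/
def trackWord (e : β ≃ Option α × Option γ) (x : List α) (π : List γ) (N : ℕ) : List β :=
  (List.range N).map fun i => e.symm (x[i]?, π[i]?)

@[simp] theorem trackWord_length (e : β ≃ Option α × Option γ) (x : List α) (π : List γ) (N : ℕ) :
    (trackWord e x π N).length = N := by simp [trackWord]

theorem trackWord_getElem? (e : β ≃ Option α × Option γ) (x : List α) (π : List γ) {N i : ℕ}
    (hi : i < N) : (trackWord e x π N)[i]? = some (e.symm (x[i]?, π[i]?)) := by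
  simp [trackWord, hi]

theorem decodePrefix_trackWord (e : β ≃ Option α × Option γ) (x : List α) (π : List γ) {N : ℕ}
    (hN : x.length ≤ N) : decodePrefix (fun b => (e b).1) (trackWord e x π N) = x := by
  refine decodePrefix_eq _ _ _ fun i hi => ?_
  by_cases h : i < N
  · simp [trackWord_getElem? e x π h]
  · rw [List.getElem?_eq_none (by simpa using h), List.getElem?_eq_none (by omega)]
    rfl

namespace ATM

/-- The sequence `π` of actions leads from the initial configuration to `c`, with `a`
alternations. -/
inductive Trace (M : ATM α) (x : List α) : List (Action M.State M.Sym M.Tape) → ℕ → M.Cfg → Prop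
  | nil : Trace M x [] 0 M.init
  | snoc {π : List (Action M.State M.Sym M.Tape)} {a : ℕ} {c : M.Cfg}
      {s : Action M.State M.Sym M.Tape} (h : Trace M x π a c)
      (hl : M.label c.state = .ex ∨ M.label c.state = .all)
      (hs : s ∈ M.trans c.state (readInput x c.inPos) c.store.scan) :
      Trace M x (π ++ [s]) (a + altCount (M.label c.state) (M.label s.state)) (M.apply x.length c s)

/-- The sequence `π` of actions leads from the initial configuration to `c`, with `m`
alternations; if `m > 0`, then the last action is the `m`-th alternation, and if `m = 0`, then
`π` is empty. -/
inductive HitsAlternation (M : ATM α) (x : List α) :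
    ℕ → List (Action M.State M.Sym M.Tape) → M.Cfg → Prop
  | zero : HitsAlternation M x 0 [] M.init
  | succ {π : List (Action M.State M.Sym M.Tape)} {a : ℕ} {c : M.Cfg}
      {s : Action M.State M.Sym M.Tape} (h : Trace M x π a c)
      (hl : M.label c.state = .ex ∨ M.label c.state = .all)
      (hs : s ∈ M.trans c.state (readInput x c.inPos) c.store.scan)
      (ha : Alternates (M.label c.state) (M.label s.state)) :
      HitsAlternation M x (a + 1) (π ++ [s]) (M.apply x.length c s)

theorem Trace.reaches {M : ATM α} {x : List α} {π : List (Action M.State M.Sym M.Tape)} {a : ℕ}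
    {c : M.Cfg} (h : M.Trace x π a c) : M.Reaches x π.length a c := by
  induction h with
  | nil => exact .init
  | snoc h hl hs ih =>
    rw [List.length_append]
    exact ih.step ⟨hl, _, hs, rfl⟩

/-- The label of the non-halting states after `a` alternations, starting from `ex`. -/
def altLabel (a : ℕ) : Label := if Even a then .ex else .all

theorem altLabel_eq (a : ℕ) : altLabel a = .ex ∨ altLabel a = .all := by
  unfold altLabel; split <;> simp

theorem altLabel_succ (a : ℕ) : altLabel (a + 1) = (altLabel a).swap := by
  unfold altLabel
  by_cases h : Even a <;> simp [h, Nat.even_add_one, Label.swap]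

/-- Along a path with `a` alternations, non-halting states have the label `altLabel a`. -/
def TypedBy (l : Label) (a : ℕ) : Prop := l = .ex ∨ l = .all → l = altLabel a

theorem TypedBy.next {l l' : Label} {a : ℕ} (h : TypedBy l a) (hl : l = .ex ∨ l = .all) :
    TypedBy l' (a + altCount l l') := by
  have h1 := h hl
  intro h2
  by_cases h3 : Alternates l l'
  · rw [altCount_of _ _ h3, altLabel_succ, ← h1]
    rcases h3 with ⟨rfl, rfl⟩ | ⟨rfl, rfl⟩ <;> rfl
  · rw [altCount_of_not _ _ h3, add_zero, ← h1]
    unfold Alternates at h3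
    rcases hl with rfl | rfl <;> rcases h2 with rfl | rfl <;> simp at h3 ⊢

/-- A time bound and a bound on the alternations that are known from different arguments hold
together. -/
theorem Bdd.inf {M : ATM α} {x : List α} {c : M.Cfg} {T A T' A' : ℕ} (h : Bdd x c T A)
    (h' : Bdd x c T' A') : Bdd x c T A' := by
  induction h using Bdd.induct generalizing T' A' with
  | mk c T A _ ih =>
    refine .mk fun c' hc => ?_
    obtain ⟨T₁, A₁, h1, -, -, h2⟩ := ih c' hc
    obtain ⟨T₂, A₂, -, h3, h4⟩ := h'.next hc
    exact ⟨T₁, A₂, h1, h3, h2 h4⟩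

/-! ### The replaying machine -/

section replay

/-- The symbols of the replaying machine: a symbol of `M`, or `none` in a cell that has not been
visited, and an entry of the second track of the input, or `none` beyond the end of the input. -/
abbrev ReplaySym (M : ATM α) : Type :=
  Option M.Sym × Option (Option (Action M.State M.Sym M.Tape))

/-- The stores of the replaying machine, with a clock tape `none` besides the tapes of `M`. -/
abbrev ReplayStore (M : ATM α) : Type := Store (ReplaySym M) (Option M.Tape)

variable (M : ATM α) (e : β ≃ Option α × Option (Action M.State M.Sym M.Tape)) (m : ℕ)
  (always : Prop) (T : Label)

open Classical in
/-- The action of the replaying machine that simulates the action `a` of `M`. The clock advances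
if `always` holds or if some scanned cell has never been visited. -/
noncomputable def replayAct (q : M.State) (i : Fin (m + 1)) (s : InSym β)
    (w : Option M.Tape → ReplaySym M)
    (a : Action M.State M.Sym M.Tape) : Action (Option (M.State × Fin (m + 1)))
      (ReplaySym M) (Option M.Tape) :=
  ⟨some (a.state, ⟨min (i + altCount (M.label q) (M.label a.state)) m, by omega⟩),
    clampRight (decodeCell (fun b => (e b).1) s) a.inMove,
    fun t => t.elim (w none) fun t => (some (a.write t), (w (some t)).2),
    fun t => t.elim (if always ∨ ∃ t, (w (some t)).1 = none then .right else .stay) a.move⟩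

/-- The simulation of `M` on the word on the first track of the input. The tape `none` holds the
second track of the input, and its head is a clock: when it leaves the word, the machine rejects.
The second component of a state is the number of alternations of `M` so far, capped at `m`. As
long as it is less than `m`, the machine may only take the actions on the clock tape, in
states labelled `T`; from then on it behaves like `M`. On the other tapes, the symbol `none` marks
the cells that have not been visited. -/
noncomputable def replayCore : ATM β where
  State := Option (M.State × Fin (m + 1))
  Sym := ReplaySym M
  Tape := Option M.Tape
  finState := by have := M.finState; infer_instance
  finSym := by
    have := M.finState; have := M.finSym; have := M.finTape; infer_instance
  finTape := by have := M.finTape; infer_instance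
  blank := (none, none)
  start := some (M.start, 0)
  label
    | none => .reject
    | some (q, i) => if (i : ℕ) = m then M.label q else
      match M.label q with
      | .ex | .all => T
      | l => l
  trans
    | none, _, _ => ∅
    | some (q, i), s, w => {b | ((w none).2 = none ∧ b = .idle none w) ∨
        ∃ o, (w none).2 = some o ∧ ∃ a ∈ M.trans q (decodeCell (fun b => (e b).1) s)
          fun t => (w (some t)).1.getD M.blank,
          ((i : ℕ) < m → o = some a) ∧ b = replayAct M e m always q i s w a}

/-- The store `d` of the replaying machine, on the input `y`, represents the configuration `c`
of `M`, with the clock at `k`. -/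
structure ReplayRel (y : List β) (c : M.Cfg) (k : ℕ)
    (d : ReplayStore M) :
    Prop where
  inPos : d.inPos = c.inPos
  inPos_le : c.inPos ≤ (decodePrefix (fun b => (e b).1) y).length + 1
  head : ∀ t, d.head (some t) = c.head t
  tape : ∀ t p, (d.tape (some t) p).1.getD M.blank = c.tape t p
  clockHead : d.head none = k
  clock : ∀ p : ℕ, (d.tape none p).2 = y[p]?.map fun b => (e b).2

open Classical in
/-- Whether the clock advances in the next step. -/
noncomputable def tick
    (d : ReplayStore M) :
    ℕ := if always ∨ ∃ t, (d.scan (some t)).1 = none then 1 else 0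

/-- The configuration of the replaying machine with the state `q` of `M`, after `a`
alternations. -/
noncomputable def replayCfg (q : M.State) (a : ℕ)
    (d : ReplayStore M) :
    (replayCore M e m always T).Cfg :=
  (replayCore M e m always T).cfg (some (q, ⟨min a m, by omega⟩)) d

/-- The rejecting configuration of the replaying machine. -/
noncomputable def replayReject
    (d : ReplayStore M) :
    (replayCore M e m always T).Cfg := (replayCore M e m always T).cfg none d

variable {M e m always T}

theorem replayCfg_label_of_le {q : M.State} {a : ℕ} (h : m ≤ a)
    (d : ReplayStore M) :
    (replayCore M e m always T).label (replayCfg M e m always T q a d).state = M.label q :=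
  if_pos (min_eq_right h)

theorem replayCfg_label_of_lt {q : M.State} {a : ℕ} (h : a < m)
    (d : ReplayStore M) :
    (replayCore M e m always T).label (replayCfg M e m always T q a d).state =
      match M.label q with
      | .ex | .all => T
      | l => l :=
  if_neg (by simp only; omega)

theorem replayCore_label_eq (hT : T = .ex ∨ T = .all) (q : M.State) (i : Fin (m + 1)) :
    ((replayCore M e m always T).label (some (q, i)) = .ex ∨
      (replayCore M e m always T).label (some (q, i)) = .all) ↔
    (M.label q = .ex ∨ M.label q = .all) := by
  simp only [replayCore]
  split
  · rfl
  · rcases hT with rfl | rfl <;> cases M.label q <;> simp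

theorem ReplayRel.scan {y : List β} {c : M.Cfg} {k : ℕ}
    {d : ReplayStore M}
    (h : ReplayRel M e y c k d) :
    (fun t => (d.scan (some t)).1.getD M.blank) = c.store.scan := by
  funext t
  simp only [Store.scan, h.head, h.tape]
  rfl

theorem ReplayRel.act {y : List β} {c : M.Cfg} {k : ℕ}
    {d : ReplayStore M}
    (h : ReplayRel M e y c k d) (i : Fin (m + 1)) (a : Action M.State M.Sym M.Tape) :
    ReplayRel M e y (M.apply (decodePrefix (fun b => (e b).1) y).length c a)
      (k + tick M always d)
      (d.act y.length (replayAct M e m always c.state i (readInput y d.inPos) d.scan a)) := by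
  have h1 := moveInput_decodePrefix (fun b => (e b).1) y c.inPos h.inPos_le a.inMove
  constructor
  · rw [← h.inPos] at h1
    simp only [Store.act, replayAct, ATM.apply]
    rw [h1, h.inPos]
  · exact moveInput_le _ _ h.inPos_le _
  · intro t
    simp [Store.act, replayAct, ATM.apply, h.head]
  · intro t p
    simp only [Store.act, replayAct, ATM.apply, h.head, Function.update_apply, Option.elim]
    split
    · simp
    · exact h.tape t p
  · simp only [Store.act, replayAct, Option.elim, tick, h.clockHead]
    split <;> simp [moveWork]
  · intro p
    simp only [Store.act, replayAct, Option.elim, Function.update_apply]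
    split
    · rename_i hp
      rw [← h.clock, hp]; rfl
    · exact h.clock p

/-- The steps of the replaying machine: rejection when the clock has left the word, or else a step
of `M`, which is forced to be the recorded one as long as there were less than `m` alternations. -/
theorem replayCore_step_iff (hT : T = .ex ∨ T = .all) {y : List β} {c : M.Cfg} {k : ℕ}
    {d : ReplayStore M}
    (h : ReplayRel M e y c k d) (a : ℕ) (c' : (replayCore M e m always T).Cfg) :
    (replayCore M e m always T).Step y (replayCfg M e m always T c.state a d) c' ↔
    (M.label c.state = .ex ∨ M.label c.state = .all) ∧
      ((y[k]? = none ∧ c' = replayReject M e m always T d) ∨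
      ∃ b, y[k]? = some b ∧ ∃ s ∈ M.trans c.state
        (readInput (decodePrefix (fun b => (e b).1) y) c.inPos) c.store.scan,
        (a < m → (e b).2 = some s) ∧
        c' = replayCfg M e m always T s.state (a + altCount (M.label c.state) (M.label s.state))
          (d.act y.length (replayAct M e m always c.state ⟨min a m, by omega⟩
            (readInput y d.inPos) d.scan s))) := by
  have hk : (d.scan none).2 = y[k]?.map fun b => (e b).2 := by
    rw [Store.scan, h.clockHead, h.clock]
  have hr : readInput (decodePrefix (fun b => (e b).1) y) c.inPos =
      decodeCell (fun b => (e b).1) (readInput y d.inPos) := by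
    rw [readInput_decodePrefix _ _ _ h.inPos_le, h.inPos]
  have hcfg : ∀ s : Action M.State M.Sym M.Tape,
      replayCfg M e m always T s.state (a + altCount (M.label c.state) (M.label s.state))
        (d.act y.length (replayAct M e m always c.state ⟨min a m, by omega⟩
          (readInput y d.inPos) d.scan s)) =
      (replayCore M e m always T).cfg (replayAct M e m always c.state ⟨min a m, by omega⟩
        (readInput y d.inPos) d.scan s).state
        (d.act y.length (replayAct M e m always c.state ⟨min a m, by omega⟩
          (readInput y d.inPos) d.scan s)) := by
    intro s
    have : min (a + altCount (M.label c.state) (M.label s.state)) m =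
        min (min a m + altCount (M.label c.state) (M.label s.state)) m := by omega
    simp only [replayCfg, replayAct, this]
    rfl
  rw [hr, ← h.scan]
  refine and_congr (replayCore_label_eq hT c.state ⟨min a m, by omega⟩) ?_
  constructor
  · rintro ⟨s, (⟨h1, rfl⟩ | ⟨o, h1, s, h2, h3, rfl⟩), rfl⟩
    · refine .inl ⟨?_, ?_⟩
      · exact Option.map_eq_none_iff.1 (hk.symm.trans h1)
      · exact congrArg ((replayCore M e m always T).cfg none) (Store.act_idle _ y.length _)
    · obtain ⟨b, h4, rfl⟩ := Option.map_eq_some_iff.1 (hk.symm.trans h1)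
      exact .inr ⟨b, h4, s, h2, fun ha => h3 (lt_of_le_of_lt (min_le_left _ _) ha),
        (hcfg s).symm⟩
  · rintro (⟨h1, rfl⟩ | ⟨b, h1, s, h2, h3, rfl⟩)
    · refine ⟨.idle none d.scan, .inl ⟨by rw [← Option.map_eq_none_iff] at h1; exact hk.trans h1,
        rfl⟩, ?_⟩
      exact congrArg ((replayCore M e m always T).cfg none) (Store.act_idle _ y.length _).symm
    · refine ⟨_, .inr ⟨_, hk.trans (by rw [h1]; rfl), s, h2, fun ha => h3 ?_, rfl⟩, hcfg s⟩
      simp only [inf_lt_right] at ha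
      omega

theorem replayCore_deterministic (hM : M.Deterministic) :
    (replayCore M e 0 always T).Deterministic := by
  rintro (_ | ⟨q, i⟩) s w
  · exact Set.subsingleton_empty
  · rintro b (⟨h1, rfl⟩ | ⟨o, h1, a, h2, -, rfl⟩) b' (⟨h3, rfl⟩ | ⟨o', h3, a', h4, -, rfl⟩)
    · rfl
    · simp [h1] at h3
    · simp [h1] at h3
    · rw [hM _ _ _ h2 h4]

/-- The alternations of the replaying machine: the first `m` alternations of `M` are saved. -/
theorem replayCfg_altCount (hT : T = altLabel m) {q q' : M.State} {a A A' : ℕ}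
    (hl : M.label q = .ex ∨ M.label q = .all) (ha : m = 0 ∨ TypedBy (M.label q) a)
    (hA : A' + altCount (M.label q) (M.label q') ≤ A)
    (d d' : ReplayStore M) :
    A' - (m - (a + altCount (M.label q) (M.label q'))) +
      altCount ((replayCore M e m always T).label (replayCfg M e m always T q a d).state)
        ((replayCore M e m always T).label (replayCfg M e m always T q'
          (a + altCount (M.label q) (M.label q')) d').state) ≤ A - (m - a) := by
  by_cases h : m ≤ a
  · rw [replayCfg_label_of_le h, replayCfg_label_of_le (by omega)]
    omega
  push Not at h
  have h1 : (match M.label q with | .ex | .all => T | l => l) = T := by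
    rcases hl with hl | hl <;> rw [hl]
  have h2 : ∀ l : Label, altCount T (match l with | .ex | .all => T | l => l) = 0 := by
    intro l
    have : ¬ Alternates T .accept ∧ ¬ Alternates T .reject := by simp [Alternates]
    cases l
    · exact altCount_self T
    · exact altCount_self T
    · exact altCount_of_not _ _ this.1
    · exact altCount_of_not _ _ this.2
  rw [replayCfg_label_of_lt h, h1]
  by_cases h3 : a + altCount (M.label q) (M.label q') < m
  · rw [replayCfg_label_of_lt h3, h2]
    omega
  · rw [replayCfg_label_of_le (by omega)]
    have h4 := altCount_le (M.label q) (M.label q')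
    have h5 : a + altCount (M.label q) (M.label q') = m := by omega
    have h6 : TypedBy (M.label q') m := by
      rw [← h5]
      exact (ha.resolve_left (by omega)).next hl
    have h7 : altCount T (M.label q') = 0 := by
      by_cases h8 : M.label q' = .ex ∨ M.label q' = .all
      · rw [h6 h8, hT, altCount_self]
      · refine altCount_of_not _ _ ?_
        unfold Alternates
        tauto
    omega

/-- Bounds for the replaying machine in terms of those for `M`. -/
theorem replayCore_bdd (hT : T = altLabel m) {y : List β} {c : M.Cfg} {t A : ℕ}
    (hb : Bdd (decodePrefix (fun b => (e b).1) y) c t A) {k a : ℕ}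
    {d : ReplayStore M}
    (h : ReplayRel M e y c k d) (ha : m = 0 ∨ TypedBy (M.label c.state) a) :
    Bdd y (replayCfg M e m always T c.state a d) (t + 1) (A - (m - a)) := by
  have hT' : T = .ex ∨ T = .all := hT ▸ altLabel_eq m
  induction hb using Bdd.induct generalizing k a d with
  | mk c t A hb ih =>
    refine .mk fun c' hc' => ?_
    rw [replayCore_step_iff hT' h] at hc'
    obtain ⟨hl, (⟨h1, rfl⟩ | ⟨b, h1, s, h2, h3, rfl⟩)⟩ := hc'
    · refine ⟨0, 0, by omega, ?_, .of_halting (.inr rfl) _ _⟩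
      rw [altCount_of_not]
      · omega
      · change ¬ Alternates _ .reject
        simp [Alternates]
    · obtain ⟨t', A', h4, h5, -, h6⟩ := ih _ ⟨hl, s, h2, rfl⟩
      change A' + altCount (M.label c.state) (M.label s.state) ≤ A at h5
      exact ⟨t' + 1, _, by omega, replayCfg_altCount hT hl ha h5 _ _,
        h6 (h.act (always := always) ⟨min a m, by omega⟩ s) (ha.imp_right fun ha => ha.next hl)⟩

/-- If the clock always advances, then it bounds the computation time. -/
theorem replayCore_bdd_clock (hT : T = .ex ∨ T = .all) {y : List β} (n : ℕ) {c : M.Cfg} {k a : ℕ}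
    {d : ReplayStore M}
    (h : ReplayRel M e y c k d) (hn : y.length ≤ k + n) :
    Bdd y (replayCfg M e m True T c.state a d) (n + 1) (n + 1) := by
  induction n generalizing c k a d with
  | zero =>
    refine Bdd.alt_le_time (A := 1) (.mk fun c' hc' => ?_)
    rw [replayCore_step_iff hT h] at hc'
    obtain ⟨hl, (⟨h1, rfl⟩ | ⟨b, h1, s, h2, h3, rfl⟩)⟩ := hc'
    · exact ⟨0, 0, le_rfl, by have := altCount_le; rw [zero_add]; exact this _ _,
        .of_halting (.inr rfl) _ _⟩
    · obtain ⟨h4, -⟩ := List.getElem?_eq_some_iff.1 h1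
      omega
  | succ n ih =>
    refine Bdd.alt_le_time (A := n + 2) (.mk fun c' hc' => ?_)
    rw [replayCore_step_iff hT h] at hc'
    obtain ⟨hl, (⟨h1, rfl⟩ | ⟨b, h1, s, h2, h3, rfl⟩)⟩ := hc'
    · exact ⟨0, 0, by omega, by
        have := altCount_le; rw [zero_add]; exact (this _ _).trans (by omega), .of_halting (.inr rfl) _ _⟩
    · have h4 := h.act (m := m) (always := True) ⟨min a m, by omega⟩ s
      have h5 : tick M True d = 1 := if_pos (.inl trivial)
      rw [h5] at h4
      exact ⟨n + 1, n + 1, le_rfl, by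
        have := altCount_le; exact Nat.add_le_add_left (this _ _) _,
        ih h4 (by omega)⟩

/-- In the replaying phase the computation is forced. -/
theorem replayCore_acceptsFrom_iff_of_lt (hT : T = .ex ∨ T = .all) {y : List β} {c : M.Cfg}
    {k a : ℕ} {s : Action M.State M.Sym M.Tape} {b : β}
    {d : ReplayStore M}
    (h : ReplayRel M e y c k d) (ha : a < m) (hy : y[k]? = some b) (hb : (e b).2 = some s)
    (hl : M.label c.state = .ex ∨ M.label c.state = .all) (hs : s ∈ M.trans c.state
      (readInput (decodePrefix (fun b => (e b).1) y) c.inPos) c.store.scan) :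
    ∃ d', ReplayRel M e y (M.apply (decodePrefix (fun b => (e b).1) y).length c s)
        (k + tick M always d) d' ∧
      ((replayCore M e m always T).AcceptsFrom y (replayCfg M e m always T c.state a d) ↔
      (replayCore M e m always T).AcceptsFrom y (replayCfg M e m always T s.state
        (a + altCount (M.label c.state) (M.label s.state)) d')) := by
  refine ⟨_, h.act (m := m) (always := always) ⟨min a m, by omega⟩ s, ?_⟩
  refine acceptsFrom_iff_of_unique ((replayCore_step_iff hT h a _).2 ⟨hl, .inr
    ⟨b, hy, s, hs, fun _ => hb, rfl⟩⟩) fun c' hc' => ?_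
  rw [replayCore_step_iff hT h] at hc'
  obtain ⟨-, (⟨h1, rfl⟩ | ⟨b', h1, s', h2, h3, rfl⟩)⟩ := hc'
  · simp [h1] at hy
  · rw [hy, Option.some.injEq] at h1
    subst h1
    have := h3 ha
    rw [hb, Option.some.injEq] at this
    rw [this]

/-- The free phase: the replaying machine accepts from a configuration if and only if `M` does,
provided that an invariant `R` guarantees that the clock suffices. -/
theorem replayCore_acceptsFrom_iff_of_le (hT : T = .ex ∨ T = .all) {y : List β}
    {R : M.Cfg → ℕ → ReplayStore M → Prop}
    (hclock : ∀ c k d, R c k d → k < y.length)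
    (hR : ∀ c k d s (i : Fin (m + 1)), ReplayRel M e y c k d → R c k d →
      (M.label c.state = .ex ∨ M.label c.state = .all) → s ∈ M.trans c.state
        (readInput (decodePrefix (fun b => (e b).1) y) c.inPos) c.store.scan →
      R (M.apply (decodePrefix (fun b => (e b).1) y).length c s) (k + tick M always d)
        (d.act y.length (replayAct M e m always c.state i (readInput y d.inPos) d.scan s)))
    {c : M.Cfg} {k a : ℕ}
    {d : ReplayStore M}
    (h : ReplayRel M e y c k d) (hc : R c k d) (ha : m ≤ a) :
    M.AcceptsFrom (decodePrefix (fun b => (e b).1) y) c ↔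
      (replayCore M e m always T).AcceptsFrom y (replayCfg M e m always T c.state a d) := by
  refine Bisim.acceptsFrom_iff (R := fun c c' => ∃ k a d, m ≤ a ∧ ReplayRel M e y c k d ∧ R c k d ∧
    c' = replayCfg M e m always T c.state a d) ⟨?_, ?_, ?_⟩ ⟨k, a, d, ha, h, hc, rfl⟩
  · rintro c _ ⟨k, a, d, ha, h, hc, rfl⟩
    exact replayCfg_label_of_le ha d
  · rintro c _ _ ⟨k, a, d, ha, h, hc, rfl⟩ ⟨hl, s, hs, rfl⟩
    refine ⟨_, (replayCore_step_iff hT h a _).2 ⟨hl, .inr ⟨_,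
      List.getElem?_eq_getElem (hclock _ _ _ hc), s, hs, fun h => by omega, rfl⟩⟩, _, _, _,
      ha.trans (Nat.le_add_right _ _), h.act _ s, hR _ _ _ _ _ h hc hl hs, rfl⟩
  · rintro c _ c' ⟨k, a, d, ha, h, hc, rfl⟩ hc'
    rw [replayCore_step_iff hT h] at hc'
    obtain ⟨hl, (⟨h1, rfl⟩ | ⟨b, h1, s, hs, -, rfl⟩)⟩ := hc'
    · have := hclock _ _ _ hc
      rw [List.getElem?_eq_none_iff] at h1
      omega
    · exact ⟨_, ⟨hl, s, hs, rfl⟩, _, _, _,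
        ha.trans (Nat.le_add_right _ _), h.act _ s, hR _ _ _ _ _ h hc hl hs, rfl⟩

/-- The replaying machine, started with the clock tape in place. -/
theorem replayCore_acceptsFrom_start_iff (hT : T = .ex ∨ T = .all) {x : List α} {N t A : ℕ}
    (hN : x.length ≤ N) (ht : t < N) (hb : Bdd x M.init t A)
    {π : List (Action M.State M.Sym M.Tape)} {c : M.Cfg} (hc : M.HitsAlternation x m π c)
    {d : ReplayStore M}
    (h : ReplayRel M e (trackWord e x π N) M.init 0 d) :
    (replayCore M e m True T).AcceptsFrom (trackWord e x π N)
      (replayCfg M e m True T M.start 0 d) ↔ M.AcceptsFrom x c := by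
  have hx := decodePrefix_trackWord e x π hN
  have htick : ∀ d, tick M True d = 1 := fun d => if_pos (.inl trivial)
  -- from the `m`-th alternation on, `M` is simulated freely
  have free : ∀ k a c d, ReplayRel M e (trackWord e x π N) c k d → M.Reaches x k a c → m ≤ a →
      (M.AcceptsFrom x c ↔ (replayCore M e m True T).AcceptsFrom (trackWord e x π N)
        (replayCfg M e m True T c.state a d)) := by
    intro k a c d h hr ha
    have := replayCore_acceptsFrom_iff_of_le (e := e) (m := m) (always := True) hT
      (y := trackWord e x π N) (R := fun c k _ => ∃ a, M.Reaches x k a c) (by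
        rintro c k d ⟨a, hr⟩
        obtain ⟨_, _, h1, -⟩ := reaches_bounded_of_bdd hb hr
        rw [trackWord_length]
        omega) (by
        rintro c k d s i - ⟨a, hr⟩ hl hs
        rw [hx] at hs ⊢
        rw [htick]
        exact ⟨_, hr.step ⟨hl, s, hs, rfl⟩⟩) h ⟨a, hr⟩ ha
    rwa [hx] at this
  -- before it, the actions are those of `π`
  have forcedStep : ∀ π' a c s d', ReplayRel M e (trackWord e x π N) c π'.length d' →
      M.Trace x π' a c → a < m → π' ++ [s] <+: π →
      (M.label c.state = .ex ∨ M.label c.state = .all) →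
      s ∈ M.trans c.state (readInput x c.inPos) c.store.scan →
      ∃ d'', ReplayRel M e (trackWord e x π N) (M.apply x.length c s) (π'.length + 1) d'' ∧
        ((replayCore M e m True T).AcceptsFrom (trackWord e x π N)
          (replayCfg M e m True T c.state a d') ↔
        (replayCore M e m True T).AcceptsFrom (trackWord e x π N)
          (replayCfg M e m True T s.state
            (a + altCount (M.label c.state) (M.label s.state)) d'')) := by
    rintro π' a c s d' h1 htr ha ⟨ρ, rfl⟩ hl hs
    obtain ⟨_, _, h3, -⟩ := reaches_bounded_of_bdd hb htr.reaches
    obtain ⟨d'', h4, h5⟩ := replayCore_acceptsFrom_iff_of_lt (always := True) hT h1 ha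
      (s := s) (trackWord_getElem? e x _ (by omega)) (by simp) hl (by rw [hx]; exact hs)
    rw [htick, hx] at h4
    exact ⟨d'', h4, h5⟩
  have forced : ∀ π' a c, M.Trace x π' a c → a < m → π' <+: π → ∃ d',
      ReplayRel M e (trackWord e x π N) c π'.length d' ∧
      ((replayCore M e m True T).AcceptsFrom (trackWord e x π N)
        (replayCfg M e m True T M.start 0 d) ↔
      (replayCore M e m True T).AcceptsFrom (trackWord e x π N)
        (replayCfg M e m True T c.state a d')) := by
    intro π' a c htr
    induction htr with
    | nil => exact fun _ _ => ⟨d, h, Iff.rfl⟩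
    | snoc htr hl hs ih =>
      intro ha hpre
      obtain ⟨d', h1, h2⟩ := ih (by omega) ((List.prefix_append _ _).trans hpre)
      obtain ⟨d'', h3, h4⟩ := forcedStep _ _ _ _ d' h1 htr (by omega) hpre hl hs
      rw [List.length_append]
      exact ⟨d'', h3, h2.trans h4⟩
  cases hc with
  | zero => exact (free 0 0 _ d h .init le_rfl).symm
  | succ htr hl hs ha =>
    obtain ⟨d', h1, h2⟩ := forced _ _ _ htr (by omega) (List.prefix_append _ _)
    obtain ⟨d'', h3, h4⟩ := forcedStep _ _ _ _ d' h1 htr (by omega) List.prefix_rfl hl hs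
    have hr := htr.reaches.step ⟨hl, _, hs, rfl⟩
    refine h2.trans (h4.trans (free _ _ _ d'' h3 hr ?_).symm)
    exact Nat.add_le_add_left (altCount_of _ _ ha).ge _

/-- The clock tape while the second track of `y` is being copied, `i` letters having been
treated. -/
noncomputable def clockTape (e : β ≃ Option α × Option (Action M.State M.Sym M.Tape))
    (y : List β) (i : ℕ) :
    ℤ → ReplaySym M := by
  classical exact fun p =>
    (none, if 0 ≤ p ∧ p < i then y[p.toNat]?.map fun b => (e b).2 else none)

/-- The fragment that copies the second track of the input to the clock tape. -/
noncomputable def copyTrack (M : ATM α)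
    (e : β ≃ Option α × Option (Action M.State M.Sym M.Tape)) :
    Frag β (ReplaySym M) (Option M.Tape) :=
  (Frag.loop (fun s _ => s ≠ .rightEnd)
    (fun s w => ⟨(), .right, fun t => t.elim (none, match s with
      | .letter b => some (e b).2
      | _ => none) fun t => w (some t), fun t => t.elim .right fun _ => .stay⟩)
    fun _ w => .idle () w).seq
  (Frag.loop (fun s _ => s ≠ .leftEnd)
    (fun _ w => ⟨(), .left, w, fun t => t.elim .left fun _ => .stay⟩)
    (fun _ w => ⟨(), .right, w, fun t => t.elim .right fun _ => .stay⟩))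

theorem copyTrack_runs (y : List β) : ∃ d, (copyTrack M e).Runs y (Store.initial (none, none))
    (2 * y.length + 3) d ∧ ReplayRel M e y M.init 0 d ∧
    ∀ t p, (d.tape (some t) p).1 = none := by
  obtain ⟨d', rfl, h1⟩ := Frag.loop_runs (test := fun s _ => s ≠ .rightEnd)
    (a := fun s w => ⟨(), .right, fun t => t.elim (none, match s with
      | .letter b => some (e b).2
      | _ => none) fun t => w (some t), fun t => t.elim .right fun _ => .stay⟩)
    (b := fun _ w => .idle () w) (x := y) y.length
    (I := fun i d => d = (⟨i + 1, fun t => t.elim i fun _ => 0,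
      fun t => t.elim (clockTape e y i) fun _ _ => (none, none)⟩ :
      ReplayStore M))
    (d := Store.initial (none, none))
    (by
      refine Store.ext rfl ?_ ?_
      · funext t; cases t <;> rfl
      · funext t p
        cases t with
        | none => simp [clockTape, Store.initial]
        | some t => rfl)
    (by
      rintro i hi _ rfl
      have hr : readInput y (i + 1) = .letter y[i] := by simp [readInput, hi]
      refine ⟨by simp [hr], Store.ext ?_ ?_ ?_⟩
      · simp [Store.act, moveInput]; omega
      · funext t; cases t <;> simp [Store.act, moveWork]
      · funext t
        cases t with
        | none =>
          funext p
          simp only [Store.act, hr, Option.elim, Function.update_apply, clockTape]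
          split
          · rename_i hp
            subst hp
            rw [if_pos (by push_cast; omega)]
            simp [hi]
          · congr 1
            refine if_congr ?_ rfl rfl
            push_cast; omega
        | some t => simp [Store.act, Store.scan])
    (by rintro _ rfl; simp [readInput])
  rw [Store.act_idle] at h1
  obtain ⟨d', rfl, h2⟩ := Frag.loop_runs (test := fun s _ => s ≠ .leftEnd)
    (a := fun _ w => ⟨(), .left, w, fun t => t.elim .left fun _ => .stay⟩)
    (b := fun _ w => ⟨(), .right, w, fun t => t.elim .right fun _ => .stay⟩) (x := y)
    (y.length + 1)
    (I := fun i d => d = (⟨y.length + 1 - i, fun t => t.elim (y.length - i) fun _ => 0,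
      fun t => t.elim (clockTape e y y.length) fun _ _ => (none, none)⟩ :
      ReplayStore M))
    (d := ⟨y.length + 1, fun t => t.elim y.length fun _ => 0,
      fun t => t.elim (clockTape e y y.length) fun _ _ => (none, none)⟩)
    (by
      refine Store.ext rfl ?_ rfl
      funext t; cases t <;> simp)
    (by
      rintro i hi _ rfl
      refine ⟨readInput_ne_leftEnd y (by simp only; omega), Store.ext ?_ ?_ ?_⟩
      · simp [Store.act, moveInput]; omega
      · funext t; cases t <;> simp [Store.act, moveWork, sub_sub]
      · funext t; simp [Store.act, Store.scan])
    (by rintro _ rfl; simp [readInput_zero])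
  refine ⟨_, (h1.seq h2).mono (by omega), ⟨?_, ?_, ?_, ?_, ?_, ?_⟩, ?_⟩
  · simp [Store.act, moveInput, ATM.init]
  · simp [ATM.init]
  · intro t; simp [Store.act, moveWork, ATM.init]
  · intro t p; simp [Store.act, Store.scan, ATM.init]
  · simp [Store.act, moveWork]
  · intro p
    simp only [Store.act, Store.scan, Option.elim, Function.update_eq_self, clockTape]
    split
    · simp
    · rw [List.getElem?_eq_none (by omega)]; rfl
  · intro t p; simp [Store.act, Store.scan]

end replay

end ATM

end AltTM

namespace AltTM

variable {α β γ : Type}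

/-! ### Deterministic machines and halting machines -/

namespace ATM

theorem Deterministic.step_unique {M : ATM α} (hM : M.Deterministic) {x : List α}
    {c c₁ c₂ : M.Cfg} (h₁ : M.Step x c c₁) (h₂ : M.Step x c c₂) : c₁ = c₂ := by
  obtain ⟨-, a, ha, rfl⟩ := h₁
  obtain ⟨-, b, hb, rfl⟩ := h₂
  rw [hM _ _ _ ha hb]

/-- A halting deterministic computation has a last configuration. -/
theorem Deterministic.exists_final {M : ATM α} (hM : M.Deterministic) {x : List α} {c : M.Cfg}
    {t A : ℕ} (hb : Bdd x c t A) : ∃ cf, M.From x c cf ∧ ∀ c', M.From x c c' → M.From x c' cf := by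
  induction hb using Bdd.induct with
  | mk c t A hb ih =>
    by_cases h : ∃ c', M.Step x c c'
    · obtain ⟨c₁, h₁⟩ := h
      obtain ⟨_, _, -, -, -, cf, h2, h3⟩ := ih c₁ h₁
      refine ⟨cf, h2.head h₁, fun c' hc' => ?_⟩
      rcases hc'.eq_or with rfl | ⟨c₂, h4, h5⟩
      · exact h2.head h₁
      · rw [hM.step_unique h4 h₁] at h5
        exact h3 c' h5
    · refine ⟨c, .refl, fun c' hc' => ?_⟩
      rcases hc'.eq_or with rfl | ⟨c₂, h4, h5⟩
      · exact .refl
      · exact (h ⟨c₂, h4⟩).elim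

theorem VisitsAtMost.mono {M : ATM α} {x : List α} {c : M.Cfg} {S S' : ℕ}
    (h : M.VisitsAtMost x c S) (hS : S ≤ S') : M.VisitsAtMost x c S' :=
  le_trans (b := (S : ℕ∞)) h (by exact_mod_cast hS)

theorem Reaches.alt_le {M : ATM α} {x : List α} {t a : ℕ} {c : M.Cfg} (h : M.Reaches x t a c) :
    a ≤ t := by
  induction h with
  | init => exact le_rfl
  | same _ _ _ ih => omega
  | alt _ _ _ ih => omega

theorem halts_iff {M : ATM α} : M.Halts ↔ ∀ x, ∃ t A, Bdd x M.init t A := by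
  constructor
  · intro h x
    obtain ⟨B, hB⟩ := h x
    exact ⟨B, B, bdd_init_iff.2 fun t a c hr => ⟨hB t a c hr, hr.alt_le.trans (hB t a c hr)⟩⟩
  · intro h x
    obtain ⟨t, A, hb⟩ := h x
    exact ⟨t, fun _ _ _ hr => (bdd_init_iff.1 hb _ _ _ hr).1⟩

/-! ### Space used by the replaying machine -/

section replaySpace

variable {M : ATM α} {e : β ≃ Option α × Option (Action M.State M.Sym M.Tape)} {m : ℕ}
  {always : Prop} {T : Label}

/-- The work cells of `M` that have been visited before the current step. -/
def writtenCells
    (d : ReplayStore M) :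
    Set (M.Tape × ℤ) := {ip | (d.tape (some ip.1) ip.2).1 ≠ none}

/-- The work cells of `M` that are being scanned. -/
def scannedCells
    (d : ReplayStore M) :
    Set (M.Tape × ℤ) := {ip | d.head (some ip.1) = ip.2}

theorem encard_scannedCells_le
    (d : ReplayStore M) :
    (scannedCells d).encard ≤ Nat.card M.Tape := by
  have := M.finTape
  have h : scannedCells d = (fun t => (t, d.head (some t))) '' Set.univ := by
    ext ⟨t, p⟩
    simp [scannedCells]
  rw [h]
  refine (Set.encard_image_le _ _).trans ?_
  rw [Set.encard_univ, ENat.card_eq_coe_natCard]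

theorem writtenCells_act
    (d : ReplayStore M)
    (n : ℕ) (q : M.State) (i : Fin (m + 1)) (s : InSym β) (a : Action M.State M.Sym M.Tape) :
    writtenCells (d.act n (replayAct M e m always q i s d.scan a)) =
      writtenCells d ∪ scannedCells d := by
  ext ⟨t, p⟩
  simp only [writtenCells, scannedCells, Store.act, replayAct, Option.elim, Set.mem_union,
    Set.mem_ofPred_eq, Function.update_apply]
  by_cases h : p = d.head (some t)
  · simp [h]
  · simp [h, Ne.symm h]

theorem scannedCells_subset_of_tick_eq_zero
    {d : ReplayStore M}
    (h : tick M always d = 0) : scannedCells d ⊆ writtenCells d := by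
  rintro ⟨t, p⟩ hp
  obtain rfl : d.head (some t) = p := hp
  intro h1
  unfold tick at h
  rw [if_pos (.inr ⟨t, h1⟩)] at h
  exact one_ne_zero h

/-- The clock advances whenever new cells are visited, and at most one cell per tape is new. -/
theorem encard_writtenCells_le (n : ℕ) (q : M.State) (i : Fin (m + 1)) (s : InSym β)
    (d : ReplayStore M)
    (a : Action M.State M.Sym M.Tape) :
    (writtenCells (d.act n (replayAct M e m always q i s d.scan a))).encard ≤
      (writtenCells d).encard + (Nat.card M.Tape * tick M always d : ℕ) := by
  rw [writtenCells_act]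
  by_cases h : tick M always d = 0
  · rw [Set.union_eq_self_of_subset_right (scannedCells_subset_of_tick_eq_zero h)]
    exact le_self_add
  · have h1 : tick M always d = 1 := by
      unfold tick at h ⊢
      split <;> simp_all
    rw [h1, mul_one]
    exact (Set.encard_union_le _ _).trans (by gcongr; exact encard_scannedCells_le d)

/-- A clock that advances only when a new cell is visited counts at most the visited cells. -/
theorem le_encard_writtenCells (n : ℕ) (q : M.State) (i : Fin (m + 1)) (s : InSym β)
    (d : ReplayStore M)
    (a : Action M.State M.Sym M.Tape) :
    (writtenCells d).encard + (tick M False d : ℕ) ≤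
      (writtenCells (d.act n (replayAct M e m False q i s d.scan a))).encard := by
  rw [writtenCells_act]
  unfold tick
  split
  · rename_i h
    obtain ⟨t, ht⟩ := h.resolve_left id
    have h1 : (t, d.head (some t)) ∉ writtenCells d := fun h => h ht
    rw [Nat.cast_one, ← Set.encard_insert_of_notMem h1]
    refine Set.encard_le_encard (Set.insert_subset (.inr ?_) Set.subset_union_left)
    exact (rfl : d.head (some t) = d.head (some t))
  · simpa using Set.encard_le_encard Set.subset_union_left

theorem replayCore_step_cases {y : List β} {c c' : (replayCore M e m always T).Cfg}
    (h : (replayCore M e m always T).Step y c c') : c'.store = c.store ∨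
    ∃ q i a, c'.store = Store.act y.length c.store (replayAct M e m always q i
      (readInput y c.inPos) (Store.scan c.store) a) ∧ (c.store.scan none).2 ≠ none := by
  obtain ⟨-, b, hb, rfl⟩ := h
  obtain ⟨(_ | ⟨q, i⟩), p, hd, tp⟩ := c
  · exact hb.elim
  · rcases hb with ⟨h1, rfl⟩ | ⟨o, h1, a, h2, -, rfl⟩
    · exact .inl (Store.act_idle (Sym := ReplaySym M)
        (Tape := Option M.Tape) (none : Option (M.State × Fin (m + 1))) y.length ⟨p, hd, tp⟩)
    · refine .inr ⟨q, i, a, rfl, ?_⟩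
      intro h3
      have h4 := h3.symm.trans h1
      simp at h4

/-- Invariant for the number of visited cells: it is bounded in terms of the clock. -/
structure SpaceInv (e : β ≃ Option α × Option (Action M.State M.Sym M.Tape)) (y : List β) (k : ℕ)
    (d : ReplayStore M) :
    Prop where
  le : k ≤ y.length
  clockHead : d.head none = k
  clock : ∀ p : ℕ, (d.tape none p).2 = y[p]?.map fun b => (e b).2
  encard_le : (writtenCells d).encard ≤ (Nat.card M.Tape * k : ℕ)

theorem SpaceInv.act {y : List β} {k : ℕ}
    {d : ReplayStore M}
    (h : SpaceInv e y k d) (q : M.State) (i : Fin (m + 1)) (s : InSym β)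
    (a : Action M.State M.Sym M.Tape) (hd : (d.scan none).2 ≠ none) :
    SpaceInv e y (k + tick M always d) (d.act y.length (replayAct M e m always q i s d.scan a)) := by
  refine ⟨?_, ?_, ?_, ?_⟩
  · rw [Store.scan, h.clockHead, h.clock] at hd
    have h1 : k < y.length := by
      by_contra hk
      rw [List.getElem?_eq_none (by omega)] at hd
      exact hd rfl
    unfold tick
    split <;> omega
  · simp only [Store.act, replayAct, Option.elim, tick, h.clockHead]
    split <;> simp [moveWork]
  · intro p
    simp only [Store.act, replayAct, Option.elim, Function.update_apply]
    split
    · rename_i hp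
      rw [← h.clock, hp]; rfl
    · exact h.clock p
  · refine (encard_writtenCells_le y.length q i s d a).trans ?_
    rw [mul_add, Nat.cast_add]
    exact add_le_add_left h.encard_le _

/-- The space used by the replaying machine. -/
theorem replayCore_visitsAtMost (hM : M.Deterministic) {y : List β}
    {c : (replayCore M e 0 always T).Cfg} {t A : ℕ} (hb : Bdd y c t A)
    (h : SpaceInv e y 0 c.store) :
    (replayCore M e 0 always T).VisitsAtMost y c
      (Nat.card (Option M.Tape) * (2 * y.length + 1) + (Nat.card M.Tape * (y.length + 1))) := by
  have := M.finTape
  have hinv : ∀ c', (replayCore M e 0 always T).From y c c' → ∃ k, SpaceInv e y k c'.store := by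
    intro c' hc'
    unfold From at hc'
    induction hc' with
    | refl => exact ⟨0, h⟩
    | tail _ h2 ih =>
      obtain ⟨k, hk⟩ := ih
      rcases replayCore_step_cases h2 with h3 | ⟨q, i, a, h3, h4⟩
      · exact ⟨k, h3 ▸ hk⟩
      · exact ⟨_, h3 ▸ hk.act q i _ a h4⟩
  have hmono : ∀ c' c'', (replayCore M e 0 always T).From y c' c'' →
      scannedCells (M := M) c'.store ⊆
        writtenCells (M := M) c''.store ∪ scannedCells (M := M) c''.store := by
    intro c' c'' hc
    unfold From at hc
    induction hc with
    | refl => exact Set.subset_union_right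
    | @tail b c _ h2 ih =>
      rcases replayCore_step_cases h2 with h3 | ⟨q, i, a, h3, h4⟩
      · rw [h3]; exact ih
      · have h5 := writtenCells_act (M := M) (e := e) (m := 0) (always := always) b.store y.length q
          i (readInput y b.inPos) a
        have h6 := (congrArg (writtenCells (M := M)) h3).trans h5
        exact fun p hp => .inl (h6.symm.subset (ih hp))
  -- all cells of `M` that are ever visited are visited in the last configuration
  obtain ⟨cf, h1, h2⟩ := (replayCore_deterministic (e := e) (always := always) (T := T)
    hM).exists_final hb
  obtain ⟨kf, hkf⟩ := hinv cf h1
  have hsub : {ip : Option M.Tape × ℤ | ∃ c', (replayCore M e 0 always T).From y c c' ∧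
      c'.head ip.1 = ip.2} ⊆ {ip : Option M.Tape × ℤ | ip.2.natAbs ≤ y.length} ∪
      (fun ip : M.Tape × ℤ => (some ip.1, ip.2)) ''
        (writtenCells (M := M) cf.store ∪ scannedCells (M := M) cf.store) := by
    rintro ⟨(_ | t), p⟩ ⟨c', h3, h4⟩
    · obtain ⟨k, hk⟩ := hinv c' h3
      have h5 : p = k := by rw [← hk.clockHead]; exact h4.symm
      refine .inl ?_
      change p.natAbs ≤ y.length
      have := hk.le
      omega
    · exact .inr ⟨(t, p), hmono _ _ (h2 c' h3) h4, rfl⟩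
  refine (Set.encard_le_encard hsub).trans ((Set.encard_union_le _ _).trans ?_)
  rw [Nat.cast_add]
  refine add_le_add (encard_heads_le _) ?_
  refine (Set.encard_image_le _ _).trans ((Set.encard_union_le _ _).trans ?_)
  rw [mul_add, mul_one, Nat.cast_add]
  refine add_le_add (hkf.encard_le.trans ?_) (encard_scannedCells_le _)
  exact_mod_cast Nat.mul_le_mul_left _ hkf.le

/-- The replaying machine whose clock counts the visited cells of `M`. -/
theorem replayCore_acceptsFrom_start_iff_of_space (hT : T = .ex ∨ T = .all) {x : List α} {N S : ℕ}
    (hN : x.length ≤ N) (hS : S < N) (hb : M.VisitsAtMost x M.init S)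
    {d : ReplayStore M}
    (h : ReplayRel M e (trackWord e x [] N) M.init 0 d)
    (hd : ∀ t p, (d.tape (some t) p).1 = none) :
    (replayCore M e 0 False T).AcceptsFrom (trackWord e x [] N)
      (replayCfg M e 0 False T M.start 0 d) ↔ x ∈ M.language := by
  have hx := decodePrefix_trackWord e x [] hN
  have h1 := replayCore_acceptsFrom_iff_of_le (e := e) (m := 0) (always := False) (T := T) hT
    (y := trackWord e x [] N) (c := M.init) (k := 0) (a := 0) (d := d)
    (R := fun c k d => (k : ℕ∞) ≤ (writtenCells d).encard ∧ M.From x M.init c ∧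
      writtenCells d ⊆ {ip : M.Tape × ℤ | ∃ c', M.From x M.init c' ∧ c'.head ip.1 = ip.2})
    (by
      rintro c k d ⟨h1, -, h2⟩
      have h3 := h1.trans ((Set.encard_le_encard h2).trans hb)
      rw [trackWord_length]
      exact lt_of_le_of_lt (by exact_mod_cast h3) hS)
    (by
      rintro c k d s i hr ⟨h1, h2, h3⟩ hl hs
      rw [hx] at hs ⊢
      refine ⟨?_, h2.tail ⟨hl, s, hs, rfl⟩, ?_⟩
      · refine le_trans ?_ (le_encard_writtenCells _ c.state i _ d s)
        rw [Nat.cast_add]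
        gcongr
      · rw [writtenCells_act]
        refine Set.union_subset h3 ?_
        rintro ⟨t, p⟩ hp
        exact ⟨c, h2, (hr.head t).symm.trans hp⟩) h
    ⟨by simp, .refl, fun ip hp => (hp (hd _ _)).elim⟩ le_rfl
  rw [hx] at h1
  exact h1.symm

end replaySpace

end ATM

end AltTM

namespace AltTM

variable {α β : Type}

/-! ### Time, space and language of the replaying machine -/

namespace ATM

section replayMachine

variable {M : ATM α} {e : β ≃ Option α × Option (Action M.State M.Sym M.Tape)} {m : ℕ}
  {always : Prop} {T : Label}

/-- The replaying machine: it copies the second track of its input to the clock tape and then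
simulates `M` on the first track. -/
noncomputable def replay (M : ATM α) (e : β ≃ Option α × Option (Action M.State M.Sym M.Tape))
    (m : ℕ) (always : Prop) (T : Label) : ATM β :=
  (replayCore M e m always T).prefixed (copyTrack M e) T false

theorem replayCore_cfg_start
    (d : ReplayStore M) :
    (replayCore M e m always T).cfg (replayCore M e m always T).start d =
      replayCfg M e m always T M.start 0 d := by
  have h : (0 : Fin (m + 1)) = ⟨min 0 m, by omega⟩ := Fin.ext (by simp)
  have h2 : (replayCore M e m always T).start = some (M.start, 0) := rfl
  rw [replayCfg, h2, h]

theorem replay_label_start : (replay M e m always T).label (replay M e m always T).start = T := rfl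

theorem replayCore_label_start (hT : T = altLabel m) (hM : M.label M.start ≠ .all) :
    altCount T ((replayCore M e m always T).label (replayCore M e m always T).start) = 0 := by
  refine altCount_of_not _ _ ?_
  change ¬ Alternates T (if (0 : ℕ) = m then M.label M.start else match M.label M.start with
      | .ex | .all => T
      | l => l)
  split
  · rename_i h
    subst h
    rw [hT]
    cases h : M.label M.start <;> simp [Alternates, altLabel, h] at hM ⊢
  · rcases altLabel_eq m with h | h <;> rw [hT, h] <;>
    cases h : M.label M.start <;> simp [Alternates]

theorem replay_deterministic (hM : M.Deterministic) : (replay M e 0 always T).Deterministic :=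
  prefixed_deterministic (replayCore_deterministic hM)

/-- If the clock always advances, then the replaying machine runs in linear time, whatever the
machine `M`. -/
theorem replay_bdd_time (hT : T = .ex ∨ T = .all) (y : List β) :
    Bdd y (replay M e m True T).init (3 * y.length + 6) (3 * y.length + 6) := by
  by_cases hy : y = []
  · subst hy
    exact (prefixed_nil hT).2.mono (by omega) (by omega)
  · obtain ⟨d, h1, h2, -⟩ := copyTrack_runs (M := M) (e := e) y
    have h4 := replayCore_bdd_clock (m := m) (a := 0) hT y.length h2 (by omega)
    refine Bdd.alt_le_time ((prefixed_bdd (N := replayCore M e m True T) (ans := false) hT hy h1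
      (T := y.length + 1) (A := y.length + 1) ?_).mono (by omega) le_rfl)
    exact (replayCore_cfg_start d).symm ▸ h4

theorem replay_bdd_of_bdd (hT : T = altLabel m) (hM : m = 0 ∨ M.label M.start ≠ .all)
    (y : List β) {t A : ℕ} (hb : Bdd (decodePrefix (fun b => (e b).1) y) M.init t A) :
    ∃ t', Bdd y (replay M e m always T).init t' (A - m +
      altCount T ((replayCore M e m always T).label (replayCore M e m always T).start)) := by
  have hT' : T = .ex ∨ T = .all := hT ▸ altLabel_eq m
  by_cases hy : y = []
  · subst hy
    exact ⟨_, (prefixed_nil hT').2.mono le_rfl (by omega)⟩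
  · obtain ⟨d, h1, h2, -⟩ := copyTrack_runs (M := M) (e := e) y
    have h3 := replayCore_bdd (always := always) (a := 0) hT hb h2 (hM.imp_right fun hM h => by
      rcases h with h | h
      · exact h.trans (by simp [altLabel])
      · exact (hM h).elim)
    refine ⟨_, prefixed_bdd (N := replayCore M e m always T) (ans := false) hT' hy h1
      (T := t + 1) (A := A - m) ?_⟩
    exact (replayCore_cfg_start d).symm ▸ h3

/-- The first `m` alternations of `M` are prescribed by the input and cost the replaying machine
nothing. -/
theorem replay_bdd (hT : T = altLabel m) (hM : M.label M.start ≠ .all) (y : List β) {t A : ℕ}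
    (hb : Bdd (decodePrefix (fun b => (e b).1) y) M.init t A) :
    Bdd y (replay M e m True T).init (3 * y.length + 6) (A - m) := by
  obtain ⟨t', h⟩ := replay_bdd_of_bdd (always := True) hT (.inr hM) y hb
  rw [replayCore_label_start hT hM, add_zero] at h
  exact (replay_bdd_time (hT ▸ altLabel_eq m) y).inf h

/-- Given a word of sufficient length that carries `x` and a path to the `m`-th alternation, the
replaying machine decides whether `M` accepts from the end of this path. -/
theorem replay_mem_language_iff (hT : T = .ex ∨ T = .all) {x : List α} {N t A : ℕ}
    (hN : x.length ≤ N) (ht : t < N) (hb : Bdd x M.init t A)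
    {π : List (Action M.State M.Sym M.Tape)} {c : M.Cfg} (hc : M.HitsAlternation x m π c) :
    trackWord e x π N ∈ (replay M e m True T).language ↔ M.AcceptsFrom x c := by
  have hy : trackWord e x π N ≠ [] := by
    rw [← List.length_pos_iff, trackWord_length]; omega
  obtain ⟨d, h1, h2, -⟩ := copyTrack_runs (M := M) (e := e) (trackWord e x π N)
  refine (prefixed_mem_language_iff (N := replayCore M e m True T) hT hy h1).trans ?_
  rw [replayCore_cfg_start]
  exact replayCore_acceptsFrom_start_iff hT hN ht hb hc h2

/-- With the clock that advances only when a new cell is visited, the length of the word has to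
exceed only the space used by `M`. -/
theorem replay_mem_language_iff_of_space (hT : T = .ex ∨ T = .all) {x : List α} {N S : ℕ}
    (hN : x.length ≤ N) (hS : S < N) (hb : M.VisitsAtMost x M.init S) :
    trackWord e x [] N ∈ (replay M e 0 False T).language ↔ x ∈ M.language := by
  have hy : trackWord e x [] N ≠ [] := by
    rw [← List.length_pos_iff, trackWord_length]; omega
  obtain ⟨d, h1, h2, h3⟩ := copyTrack_runs (M := M) (e := e) (trackWord e x [] N)
  refine (prefixed_mem_language_iff (N := replayCore M e 0 False T) hT hy h1).trans ?_
  rw [replayCore_cfg_start]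
  exact replayCore_acceptsFrom_start_iff_of_space hT hN hS hb h2 h3

theorem replay_halts (hT : T = .ex) (hM : M.Halts) : (replay M e 0 always T).Halts := by
  rw [halts_iff] at hM ⊢
  intro y
  obtain ⟨t, A, hb⟩ := hM (decodePrefix (fun b => (e b).1) y)
  obtain ⟨t', h⟩ := replay_bdd_of_bdd (m := 0) (always := always) (T := T) (by rw [hT]; rfl)
    (.inl rfl) y hb
  exact ⟨t', _, h⟩

/-- The space is linear because the clock bounds the number of visited cells. -/
theorem replay_spaceBounded (hT : T = .ex) (hM : M.Deterministic) (hM' : M.Halts) :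
    ∃ b : ℕ, (replay M e 0 always T).SpaceBounded fun n => b * n + b := by
  have hT' : T = .ex ∨ T = .all := .inl hT
  refine ⟨Nat.card (Option M.Tape) * 16 + Nat.card M.Tape, fun y => ?_⟩
  rw [← visitsAtMost_init_iff]
  by_cases hy : y = []
  · subst hy
    refine VisitsAtMost.mono (prefixed_visitsAtMost_nil (N := replayCore M e 0 always T)) ?_
    change Nat.card (Option M.Tape) ≤ _ * 0 + _
    omega
  · obtain ⟨d, h1, h2, h3⟩ := copyTrack_runs (M := M) (e := e) y
    obtain ⟨t, A, hb⟩ := halts_iff.1 hM' (decodePrefix (fun b => (e b).1) y)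
    have h4 := replayCore_bdd (m := 0) (always := always) (T := T) (a := 0)
      (by rw [hT]; rfl) hb h2 (.inl rfl)
    have h5 := replayCore_visitsAtMost hM h4 (y := y)
      ⟨Nat.zero_le _, h2.clockHead, h2.clock, by
        have : writtenCells d = ∅ := Set.eq_empty_of_forall_notMem fun ip hp => hp (h3 _ _)
        exact (congrArg Set.encard this).le.trans (by simp)⟩
    replace h5 := (replayCore_cfg_start d).symm ▸ h5
    refine VisitsAtMost.mono (prefixed_visitsAtMost (N := replayCore M e 0 always T) hT' hy h1 h5) ?_
    change Nat.card (Option M.Tape) * (2 * (2 * y.length + 3) + 1) + _ ≤ _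
    nlinarith [Nat.zero_le (Nat.card (Option M.Tape)), Nat.zero_le (Nat.card M.Tape),
      Nat.zero_le (Nat.card (Option M.Tape) * y.length), Nat.zero_le (Nat.card M.Tape * y.length)]

end replayMachine

end ATM

end AltTM

namespace AltTM

variable {α β : Type}

/-! ### The machine that records a computation path and asks about it -/

instance [Finite α] : Finite (InSym α) := Finite.of_injective
  (fun s : InSym α => (match s with
    | .leftEnd => none
    | .letter a => some (some a)
    | .rightEnd => some none : Option (Option α))) (by
    intro a b h
    cases a <;> cases b <;> simp_all)

/-- The letter in an input cell. -/
def InSym.letter? : InSym α → Option α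
  | .letter a => some a
  | _ => none

theorem letter?_readInput (x : List α) (i : ℕ) : (readInput x (i + 1)).letter? = x[i]? := by
  unfold readInput
  rw [if_neg (by omega), Nat.add_sub_cancel]
  cases x[i]? <;> rfl

theorem readInput_of_length_lt (x : List α) {p : ℕ} (h : x.length < p) :
    readInput x p = .rightEnd := (readInput_eq_rightEnd_iff x p).2 h

theorem readInput_trackWord {γ : Type} (e : β ≃ Option α × Option γ) (x : List α) (π : List γ)
    (N p : ℕ) : readInput (trackWord e x π N) p = if p = 0 then .leftEnd else if p ≤ N then
      .letter (e.symm (x[p - 1]?, π[p - 1]?)) else .rightEnd := by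
  split
  · rename_i h; rw [h]; rfl
  · split
    · rename_i h0 h
      rw [readInput, if_neg h0, trackWord_getElem? e x π (by omega)]
    · exact readInput_of_length_lt _ (by rw [trackWord_length]; omega)

/-- Head movement on a tape with end markers. -/
def clamp : InSym β → Dir → Dir
  | .leftEnd, .left => .stay
  | .rightEnd, .right => .stay
  | _, m => m

/-- A work head on a tape that holds `y` with its end markers moves like an input head. -/
theorem moveWork_clamp (y : List β) {p : ℕ} (hp : p ≤ y.length + 1) (m : Dir) :
    moveWork p (clamp (readInput y p) m) = (moveInput y.length p m : ℕ) := by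
  by_cases h0 : p = 0
  · subst h0
    rw [readInput_zero]
    cases m <;> simp [clamp, moveWork, moveInput]
  · by_cases h1 : y.length < p
    · rw [readInput_of_length_lt y h1]
      cases m <;> simp only [clamp, moveWork, moveInput] <;> omega
    · have h2 : ∃ b, readInput y p = .letter b := by
        rw [readInput, if_neg h0, List.getElem?_eq_getElem (by omega)]
        exact ⟨_, rfl⟩
      obtain ⟨b, h2⟩ := h2
      rw [h2]
      cases m <;> simp only [clamp, moveWork, moveInput] <;> omega

namespace ATM

section ask

variable (M : ATM α) (M' : ATM β) {f : ℕ → ℕ} (U : UnaryFrag f)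
  (e : β ≃ Option α × Option (Action M.State M.Sym M.Tape)) (m : ℕ)

/-- The symbols of the asking machine. Each tape uses one of the components. -/
abbrev AskSym : Type := InSym β × M.Sym × M'.Sym × U.Sym

/-- The tapes of the asking machine: the question tape, the tapes of `M`, those of `M'`, and those
needed for the construction of the length of the question. -/
abbrev AskTape : Type := Option (M.Tape ⊕ M'.Tape ⊕ U.Tape)

/-- The states of the asking machine: those of `M` with the number of alternations so far, a
state for rewinding the question tape, and those of `M'`. -/
abbrev AskState : Type := (M.State × Fin m) ⊕ Unit ⊕ M'.State

variable {M M' U m}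

/-- The action that simulates the action `a` of `M` and records it on the question tape. -/
noncomputable def recordAct (q : M.State) (i : Fin m) (w : AskTape M M' U → AskSym M M' U)
    (a : Action M.State M.Sym M.Tape) :
    Action (AskState M M' m) (AskSym M M' U) (AskTape M M' U) :=
  ⟨if h : i + altCount (M.label q) (M.label a.state) < m then .inl (a.state, ⟨_, h⟩)
    else .inr (.inl ()), a.inMove,
   fun
    | none => (match (w none).1 with
      | .letter b => .letter (e.symm ((e b).1, some a))
      | s => s, (w none).2)
    | some (.inl t) => ((w (some (.inl t))).1, a.write t, (w (some (.inl t))).2.2)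
    | some (.inr t) => w (some (.inr t)),
   fun
    | none => .right
    | some (.inl t) => a.move t
    | some (.inr _) => .stay⟩

/-- The action that moves the head of the question tape. -/
def questionAct (q : AskState M M' m) (w : AskTape M M' U → AskSym M M' U) (d : Dir) :
    Action (AskState M M' m) (AskSym M M' U) (AskTape M M' U) :=
  ⟨q, .stay, w, fun t => t.elim d fun _ => .stay⟩

open Classical in
/-- The action that moves the head of the question tape back, and finally starts `M'`. -/
noncomputable def rewindAct (w : AskTape M M' U → AskSym M M' U) :
    Action (AskState M M' m) (AskSym M M' U) (AskTape M M' U) :=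
  if (w none).1 = .leftEnd then questionAct (.inr (.inr M'.start)) w .right
  else questionAct (.inr (.inl ())) w .left

/-- The action that simulates the action `a` of `M'`, the question tape serving as the input. -/
def answerAct (w : AskTape M M' U → AskSym M M' U) (a : Action M'.State M'.Sym M'.Tape) :
    Action (AskState M M' m) (AskSym M M' U) (AskTape M M' U) :=
  ⟨.inr (.inr a.state), .stay,
   fun
    | some (.inr (.inl t)) => ((w (some (.inr (.inl t)))).1, (w (some (.inr (.inl t)))).2.1,
        a.write t, (w (some (.inr (.inl t)))).2.2.2)
    | t => w t,
   fun
    | none => clamp (w none).1 a.inMove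
    | some (.inr (.inl t)) => a.move t
    | _ => .stay⟩

variable (M M' U m)

/-- Simulate `M` until its `m`-th alternation, recording the actions on the question tape, then
rewind the question tape and run `M'` on its content. -/
noncomputable def askCore [Finite β] : ATM α where
  State := AskState M M' m
  Sym := AskSym M M' U
  Tape := AskTape M M' U
  finState := by have := M.finState; have := M'.finState; infer_instance
  finSym := by have := M.finSym; have := M'.finSym; have := U.finSym; infer_instance
  finTape := by have := M.finTape; have := M'.finTape; have := U.finTape; infer_instance
  blank := (.rightEnd, M.blank, M'.blank, U.blank)
  start := if h : 0 < m then .inl (M.start, ⟨0, h⟩) else .inr (.inr M'.start)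
  label
    | .inl (q, _) => M.label q
    | .inr (.inl _) => altLabel (m - 1)
    | .inr (.inr q) => M'.label q
  trans
    | .inl (q, i), s, w => {b | ∃ a ∈ M.trans q s fun t => (w (some (.inl t))).2.1,
        b = recordAct e q i w a}
    | .inr (.inl _), _, w => {rewindAct w}
    | .inr (.inr q), _, w => {b | ∃ a ∈ M'.trans q (w none).1
        fun t => (w (some (.inr (.inl t)))).2.2.1, b = answerAct w a}

variable {M M' U m}

theorem askCore_deterministic [Finite β] (hM' : M'.Deterministic) :
    (askCore M M' U e 0).Deterministic := by
  rintro (⟨q, i⟩ | _ | q) s w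
  · exact i.elim0
  · exact Set.subsingleton_singleton
  · rintro _ ⟨a, ha, rfl⟩ _ ⟨b, hb, rfl⟩
    rw [hM' _ _ _ ha hb]

/-- The configuration of the asking machine in which `M` is in state `q`, after `a` alternations,
or, if `a ≥ m`, in which the question tape is being rewound. -/
noncomputable def runCfg [Finite β] (q : M.State) (a : ℕ)
    (d : Store (AskSym M M' U) (AskTape M M' U)) : (askCore M M' U e m).Cfg :=
  (askCore M M' U e m).cfg (if h : a < m then .inl (q, ⟨a, h⟩) else .inr (.inl ())) d

theorem runCfg_eq_of_lt [Finite β] (q : M.State) {a : ℕ} (h : a < m)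
    (d : Store (AskSym M M' U) (AskTape M M' U)) :
    runCfg e q a d = (askCore M M' U e m).cfg (.inl (q, ⟨a, h⟩)) d :=
  congrArg (fun s => (askCore M M' U e m).cfg s d) (dif_pos h)

theorem runCfg_eq_of_le [Finite β] (q : M.State) {a : ℕ} (h : m ≤ a)
    (d : Store (AskSym M M' U) (AskTape M M' U)) :
    runCfg e q a d = (askCore M M' U e m).cfg (.inr (.inl ())) d :=
  congrArg (fun s => (askCore M M' U e m).cfg s d) (dif_neg h.not_gt)

/-- The configuration of the asking machine in which `M'` is in state `q`. -/
noncomputable def simCfg [Finite β] (q : M'.State) (d : Store (AskSym M M' U) (AskTape M M' U)) :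
    (askCore M M' U e m).Cfg := (askCore M M' U e m).cfg (.inr (.inr q)) d

/-- The store `d` contains the configuration `c'` of `M'` on the input `y`, and its other heads
are placed as in `d₀`. -/
structure SimRel (y : List β) (d₀ : Store (AskSym M M' U) (AskTape M M' U)) (c' : M'.Cfg)
    (d : Store (AskSym M M' U) (AskTape M M' U)) : Prop where
  head_none : d.head none = c'.inPos
  inPos_le : c'.inPos ≤ y.length + 1
  tape_none : ∀ p : ℕ, (d.tape none p).1 = readInput y p
  head : ∀ t, d.head (some (.inr (.inl t))) = c'.head t
  tape : ∀ t p, (d.tape (some (.inr (.inl t))) p).2.2.1 = c'.tape t p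
  frame_left : ∀ t, d.head (some (.inl t)) = d₀.head (some (.inl t))
  frame_right : ∀ t, d.head (some (.inr (.inr t))) = d₀.head (some (.inr (.inr t)))

/-- The store `d` contains the configuration `c` of `M`. -/
structure RunRel (c : M.Cfg) (d : Store (AskSym M M' U) (AskTape M M' U)) : Prop where
  inPos : d.inPos = c.inPos
  head : ∀ t, d.head (some (.inl t)) = c.head t
  tape : ∀ t p, (d.tape (some (.inl t)) p).2.1 = c.tape t p

/-- The question tape contains `y`, its head is in cell `p`, and the tapes of `M'` are blank. -/
structure QuestionRel (y : List β) (p : ℕ) (d : Store (AskSym M M' U) (AskTape M M' U)) :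
    Prop where
  head_none : d.head none = p
  tape_none : ∀ p : ℕ, (d.tape none p).1 = readInput y p
  head : ∀ t, d.head (some (.inr (.inl t))) = 0
  tape : ∀ t p, (d.tape (some (.inr (.inl t))) p).2.2.1 = M'.blank

theorem QuestionRel.simRel {y : List β} {d : Store (AskSym M M' U) (AskTape M M' U)}
    (h : QuestionRel y 1 d) : SimRel y d M'.init d :=
  ⟨h.head_none, by simp [ATM.init], h.tape_none, h.head, h.tape, fun _ => rfl, fun _ => rfl⟩

theorem SimRel.act {y : List β} {d₀ d : Store (AskSym M M' U) (AskTape M M' U)} {c' : M'.Cfg}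
    (h : SimRel y d₀ c' d) (n : ℕ) (a : Action M'.State M'.Sym M'.Tape) :
    SimRel y d₀ (M'.apply y.length c' a) (d.act n (answerAct (m := m) d.scan a)) := by
  have hs : (d.scan none).1 = readInput y c'.inPos := by
    rw [Store.scan, h.head_none, h.tape_none]
  constructor
  · simp only [Store.act, answerAct, hs, h.head_none]
    exact moveWork_clamp y h.inPos_le _
  · exact moveInput_le _ _ h.inPos_le _
  · intro p
    simp only [Store.act, answerAct, Function.update_apply]
    split
    · rename_i hp
      rw [← h.tape_none, hp]; rfl
    · exact h.tape_none p
  · intro t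
    simp [Store.act, answerAct, ATM.apply, h.head]
  · intro t p
    simp only [Store.act, answerAct, ATM.apply, h.head, Function.update_apply]
    split
    · rfl
    · exact h.tape t p
  · intro t
    simp [Store.act, answerAct, moveWork, h.frame_left]
  · intro t
    simp [Store.act, answerAct, moveWork, h.frame_right]

theorem simCfg_bisim [Finite β] (x : List α) (y : List β)
    (d₀ : Store (AskSym M M' U) (AskTape M M' U)) :
    Bisim M' (askCore M M' U e m) y x
      fun c' k => ∃ d, SimRel y d₀ c' d ∧ k = simCfg e c'.state d := by
  have hw : ∀ (c' : M'.Cfg) (d : Store (AskSym M M' U) (AskTape M M' U)), SimRel y d₀ c' d →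
      (d.scan none).1 = readInput y c'.inPos ∧
      (fun t => (d.scan (some (.inr (.inl t)))).2.2.1) = c'.store.scan := by
    intro c' d h
    constructor
    · rw [Store.scan, h.head_none, h.tape_none]
    · funext t
      simp only [Store.scan, h.head, h.tape]
      rfl
  refine ⟨?_, ?_, ?_⟩
  · rintro c' _ ⟨d, h, rfl⟩; rfl
  · rintro c' _ c'' ⟨d, h, rfl⟩ ⟨hl, a, ha, rfl⟩
    obtain ⟨h1, h2⟩ := hw c' d h
    refine ⟨_, ⟨hl, answerAct d.scan a, ⟨a, ?_, rfl⟩, rfl⟩, _, h.act x.length a, rfl⟩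
    rw [← h1] at ha
    exact (congrArg (fun w => a ∈ M'.trans c'.state (d.scan none).1 w) h2).mpr ha
  · rintro c' _ k ⟨d, h, rfl⟩ ⟨hl, _, ⟨a, ha, rfl⟩, rfl⟩
    obtain ⟨h1, h2⟩ := hw c' d h
    refine ⟨_, ⟨hl, a, ?_, rfl⟩, _, h.act x.length a, rfl⟩
    rw [← h1]
    exact (congrArg (fun w => a ∈ M'.trans c'.state (d.scan none).1 w) h2).mp ha

theorem QuestionRel.move {y : List β} {p p' : ℕ} {d : Store (AskSym M M' U) (AskTape M M' U)}
    (h : QuestionRel y p d) (n : ℕ) (q : AskState M M' m) {v : Dir} (hp : moveWork p v = p') :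
    QuestionRel y p' (d.act n (questionAct q d.scan v)) := by
  constructor
  · simp [Store.act, questionAct, h.head_none, hp]
  · intro p
    simpa [Store.act, questionAct, Store.scan] using h.tape_none p
  · intro t; simp [Store.act, questionAct, moveWork, h.head]
  · intro t p
    simpa [Store.act, questionAct, Store.scan] using h.tape t p

theorem rewind_step_iff [Finite β] (x : List α) {d : Store (AskSym M M' U) (AskTape M M' U)}
    {b : Action (AskState M M' m) (AskSym M M' U) (AskTape M M' U)} (hb : rewindAct d.scan = b)
    (k : (askCore M M' U e m).Cfg) :
    (askCore M M' U e m).Step x ((askCore M M' U e m).cfg (.inr (.inl ())) d) k ↔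
      k = (askCore M M' U e m).cfg b.state (d.act x.length b) := by
  subst hb
  constructor
  · rintro ⟨-, b, rfl, rfl⟩; rfl
  · rintro rfl
    exact ⟨altLabel_eq _, _, rfl, rfl⟩

/-- Rewinding the question tape and running `M'` on it. -/
theorem runCfg_of_le [Finite β] (x : List α) {y : List β} {p : ℕ}
    {d : Store (AskSym M M' U) (AskTape M M' U)} (h : QuestionRel y p d) (q : M.State) {a : ℕ}
    (ha : m ≤ a) :
    ((askCore M M' U e m).AcceptsFrom x (runCfg e q a d) ↔ y ∈ M'.language) ∧
    ∀ T A, Bdd y M'.init T A → Bdd x (runCfg (m := m) e q a d) (p + 1 + T)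
      (A + altCount (altLabel (m - 1)) (M'.label M'.start)) := by
  have hr : ∀ d : Store (AskSym M M' U) (AskTape M M' U), runCfg (m := m) e q a d =
      (askCore M M' U e m).cfg (.inr (.inl ())) d :=
    fun d => runCfg_eq_of_le e q ha d
  have hs : (d.scan none).1 = readInput y p := by rw [Store.scan, h.head_none, h.tape_none]
  induction p generalizing d with
  | zero =>
    rw [hr]
    have hstep : ∀ k, _ ↔ k = simCfg (m := m) e M'.start _ :=
      rewind_step_iff (m := m) e x (d := d) (if_pos hs)
    have h1 := (h.move (m := m) x.length (.inr (.inr M'.start)) (p' := 1) (v := .right) rfl).simRel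
    constructor
    · rw [acceptsFrom_iff_of_unique ((hstep _).2 rfl) fun c' => (hstep c').1]
      exact ((simCfg_bisim e x y _).acceptsFrom_iff ⟨_, h1, rfl⟩).symm
    · intro T A hb
      exact (Bdd.of_unique (fun c' => (hstep c').1)
        ((simCfg_bisim e x y _).bdd ⟨_, h1, rfl⟩ hb)).mono (by omega) le_rfl
  | succ p ih =>
    have h1 := h.move (m := m) x.length (.inr (.inl ())) (p' := p) (v := .left)
      (by simp [moveWork])
    obtain ⟨ih1, ih2⟩ := ih h1 (by rw [Store.scan, h1.head_none, h1.tape_none])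
    rw [hr] at ih1 ⊢
    have hstep : ∀ k, _ ↔ k = (askCore M M' U e m).cfg (.inr (.inl ())) _ :=
      rewind_step_iff (m := m) e x (d := d) (if_neg (by
        rw [hs]; exact readInput_ne_leftEnd y (by omega)))
    constructor
    · rw [acceptsFrom_iff_of_unique ((hstep _).2 rfl) fun c' => (hstep c').1]
      exact ih1
    · intro T A hb
      have h2 := ih2 T A hb
      rw [hr] at h2
      refine (Bdd.of_unique (fun c' => (hstep c').1) h2).mono (by omega) ?_
      change _ + altCount (altLabel _) (altLabel _) ≤ _
      rw [altCount_self, add_zero]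

theorem RunRel.act {c : M.Cfg} {d : Store (AskSym M M' U) (AskTape M M' U)} (h : RunRel c d)
    (n : ℕ) (i : Fin m) (a : Action M.State M.Sym M.Tape) :
    RunRel (M.apply n c a) (d.act n (recordAct e c.state i d.scan a)) := by
  constructor
  · simp [Store.act, recordAct, ATM.apply, h.inPos]
  · intro t
    simp [Store.act, recordAct, ATM.apply, h.head]
  · intro t p
    simp only [Store.act, recordAct, ATM.apply, h.head, Function.update_apply]
    split
    · rfl
    · exact h.tape t p

/-- Recording an action extends the path on the second track of the question. -/
theorem QuestionRel.record {x : List α} {π : List (Action M.State M.Sym M.Tape)} {N : ℕ}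
    {d : Store (AskSym M M' U) (AskTape M M' U)}
    (h : QuestionRel (trackWord e x π N) (π.length + 1) d) (hN : π.length < N)
    (n : ℕ) (q : M.State) (i : Fin m) (a : Action M.State M.Sym M.Tape) :
    QuestionRel (trackWord e x (π ++ [a]) N) ((π ++ [a]).length + 1)
      (d.act n (recordAct e q i d.scan a)) := by
  have hs : (d.scan none).1 = .letter (e.symm (x[π.length]?, none)) := by
    rw [Store.scan, h.head_none, h.tape_none, readInput_trackWord, if_neg (by omega),
      if_pos (by omega)]
    simp
  constructor
  · simp [Store.act, recordAct, h.head_none, moveWork]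
  · intro p
    simp only [Store.act, recordAct, hs, Function.update_apply, h.head_none, Nat.cast_inj]
    rw [readInput_trackWord]
    split
    · rename_i hp
      rw [if_neg (by omega), if_pos (by omega), hp]
      simp
    · rename_i hp
      rw [h.tape_none, readInput_trackWord]
      split
      · rfl
      · split
        · rw [List.getElem?_append]
          split
          · rfl
          · rw [List.getElem?_eq_none (l := π) (by omega),
              List.getElem?_eq_none (l := [a]) (by simp; omega)]
        · rfl
  · intro t; simp [Store.act, recordAct, moveWork, h.head]
  · intro t p
    simp only [Store.act, recordAct, Function.update_apply]
    split
    · rename_i hp; rw [← h.tape t p, hp]; rfl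
    · exact h.tape t p

theorem runCfg_step_iff [Finite β] {x : List α} {c : M.Cfg}
    {d : Store (AskSym M M' U) (AskTape M M' U)} (h : RunRel c d) {a : ℕ} (ha : a < m)
    (k : (askCore M M' U e m).Cfg) :
    (askCore M M' U e m).Step x (runCfg e c.state a d) k ↔
    (M.label c.state = .ex ∨ M.label c.state = .all) ∧
    ∃ s ∈ M.trans c.state (readInput x c.inPos) c.store.scan,
      k = runCfg e s.state (a + altCount (M.label c.state) (M.label s.state))
        (d.act x.length (recordAct e c.state ⟨a, ha⟩ d.scan s)) := by
  have hw : (fun t => (d.scan (some (.inl t))).2.1) = c.store.scan := by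
    funext t
    simp only [Store.scan, h.head, h.tape]
    rfl
  have hr : runCfg e c.state a d = (askCore M M' U e m).cfg (.inl (c.state, ⟨a, ha⟩)) d :=
    runCfg_eq_of_lt e _ ha d
  rw [hr, ← h.inPos, ← hw]
  constructor
  · rintro ⟨hl, _, ⟨s, hs, rfl⟩, rfl⟩
    exact ⟨hl, s, hs, rfl⟩
  · rintro ⟨hl, s, hs, rfl⟩
    exact ⟨hl, _, ⟨s, hs, rfl⟩, rfl⟩

theorem runCfg_label_of_lt [Finite β] (q : M.State) {a : ℕ} (ha : a < m)
    (d : Store (AskSym M M' U) (AskTape M M' U)) :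
    (askCore M M' U e m).label (runCfg e q a d).state = M.label q := by
  rw [runCfg_eq_of_lt e q ha]; rfl

theorem runCfg_label_of_le [Finite β] (q : M.State) {a : ℕ} (ha : m ≤ a)
    (d : Store (AskSym M M' U) (AskTape M M' U)) :
    (askCore M M' U e m).label (runCfg e q a d).state = altLabel (m - 1) := by
  rw [runCfg_eq_of_le e q ha]; rfl

theorem alternates_of_altCount {l l' : Label} (h : altCount l l' ≠ 0) : Alternates l l' := by
  by_contra h1
  exact h (altCount_of_not _ _ h1)

/-- If `M'` knows whether `M` accepts from the configuration after a recorded path, then the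
asking machine decides the language of `M`. -/
theorem runCfg_acceptsFrom_iff [Finite β] {x : List α} {N : ℕ}
    (key : ∀ π c, M.HitsAlternation x m π c →
      (trackWord e x π N ∈ M'.language ↔ M.AcceptsFrom x c))
    {c : M.Cfg} {t A : ℕ} (hb : Bdd x c t A) {π : List (Action M.State M.Sym M.Tape)} {a : ℕ}
    (htr : M.Trace x π a c) (ha : a < m) (ht : π.length + t < N)
    {d : Store (AskSym M M' U) (AskTape M M' U)} (hr : RunRel c d)
    (hq : QuestionRel (trackWord e x π N) (π.length + 1) d) :
    M.AcceptsFrom x c ↔ (askCore M M' U e m).AcceptsFrom x (runCfg e c.state a d) := by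
  induction hb using Bdd.induct generalizing π a d with
  | mk c t A hb ih =>
    have main : ∀ s ∈ M.trans c.state (readInput x c.inPos) c.store.scan,
        M.label c.state = .ex ∨ M.label c.state = .all →
        (M.AcceptsFrom x (M.apply x.length c s) ↔ (askCore M M' U e m).AcceptsFrom x
          (runCfg e s.state (a + altCount (M.label c.state) (M.label s.state))
        (d.act x.length (recordAct e c.state ⟨a, ha⟩ d.scan s)))) := by
      intro s hs hl
      obtain ⟨t', A', h1, h2, -, h3⟩ := ih _ ⟨hl, s, hs, rfl⟩
      have hq' := hq.record e (by omega) x.length c.state ⟨a, ha⟩ s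
      by_cases h4 : a + altCount (M.label c.state) (M.label s.state) < m
      · exact h3 (htr.snoc hl hs) h4 (by rw [List.length_append, List.length_singleton]; omega)
          (hr.act e x.length ⟨a, ha⟩ s) hq'
      · have h5 := altCount_le (M.label c.state) (M.label s.state)
        have h6 : Alternates (M.label c.state) (M.label s.state) :=
          alternates_of_altCount (by omega)
        obtain rfl : m = a + 1 := by omega
        rw [← key _ _ (.succ htr hl hs h6)]
        exact (runCfg_of_le e x hq' s.state (by omega)).1.symm
    refine acceptsFrom_congr (runCfg_label_of_lt e _ ha d) ?_ ?_
    · rintro c' ⟨hl, s, hs, rfl⟩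
      exact ⟨_, (runCfg_step_iff e hr ha _).2 ⟨hl, s, hs, rfl⟩, main s hs hl⟩
    · intro k hk
      obtain ⟨hl, s, hs, rfl⟩ := (runCfg_step_iff e hr ha _).1 hk
      exact ⟨_, ⟨hl, s, hs, rfl⟩, main s hs hl⟩

/-- Before the question, the asking machine makes at most `m - 1` alternations: the `m`-th
alternation of `M` is not carried out, since the rewinding state has the label of the states before
it. -/
theorem runCfg_bdd [Finite β] {x : List α} {N T' A' : ℕ}
    (hM' : ∀ y : List β, y.length = N → Bdd y M'.init T' A')
    {c : M.Cfg} {t A : ℕ} (hb : Bdd x c t A) {π : List (Action M.State M.Sym M.Tape)} {a : ℕ}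
    (hty : TypedBy (M.label c.state) a) (ha : a < m) (ht : π.length + t < N)
    {d : Store (AskSym M M' U) (AskTape M M' U)} (hr : RunRel c d)
    (hq : QuestionRel (trackWord e x π N) (π.length + 1) d) :
    Bdd x (runCfg (m := m) e c.state a d) (t + (N + 2) + T')
      ((m - 1 - a) + A' + altCount (altLabel (m - 1)) (M'.label M'.start)) := by
  induction hb using Bdd.induct generalizing π a d with
  | mk c t A hb ih =>
    refine .mk fun k hk => ?_
    obtain ⟨hl, s, hs, rfl⟩ := (runCfg_step_iff e hr ha _).1 hk
    obtain ⟨t', A₁, h1, h2, -, h3⟩ := ih _ ⟨hl, s, hs, rfl⟩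
    have hq' := hq.record e (by omega) x.length c.state ⟨a, ha⟩ s
    rw [runCfg_label_of_lt e _ ha d]
    have h5 := altCount_le (M.label c.state) (M.label s.state)
    by_cases h4 : a + altCount (M.label c.state) (M.label s.state) < m
    · have h6 : Bdd x (runCfg (m := m) e s.state _ _) (t' + (N + 2) + T')
          ((m - 1 - (a + altCount (M.label c.state) (M.label s.state))) + A' +
            altCount (altLabel (m - 1)) (M'.label M'.start)) := h3 (hty.next hl) h4
        (by rw [List.length_append, List.length_singleton]; omega)
        (hr.act e x.length ⟨a, ha⟩ s) hq'
      refine ⟨_, _, ?_, ?_, h6⟩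
      · omega
      · rw [runCfg_label_of_lt e _ h4]
        omega
    · refine ⟨_, _, ?_, ?_, (runCfg_of_le e x hq' s.state (by omega)).2 T' A'
        (hM' _ (trackWord_length _ _ _ _))⟩
      · rw [List.length_append, List.length_singleton]; omega
      · rw [runCfg_label_of_le e _ (by omega), hty hl, show m - 1 = a by omega, altCount_self]
        omega

end ask

end ATM

end AltTM

namespace AltTM

variable {α β : Type}

/-! ### The length of the question, and the asking machine -/

namespace ATM

section ask

variable (M : ATM α) (M' : ATM β) {f : ℕ → ℕ} (U : UnaryFrag f)
  (e : β ≃ Option α × Option (Action M.State M.Sym M.Tape)) (m : ℕ)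

open Classical in
/-- The fragment that writes a word on the question tape, with the input on its first track and an
empty second track: its length is computed in unary by `U`, the left end marker and the letters are
written, and the heads of the question tape and of the input are moved back. -/
noncomputable def questionPrelude : Frag α (AskSym M M' U) (AskTape M M' U) :=
  (((U.P.lift (fun _ => ()) (fun _ s => s.2.2.2) (fun _ s => (.rightEnd, M.blank, M'.blank, s))
    fun t => some (.inr (.inr t))).seq
  (.once fun _ w => ⟨(), .stay, fun t => t.elim (.leftEnd, (w none).2) fun t => w (some t),
    fun t => t.elim .right fun _ => .stay⟩)).seq
  (.loop (fun _ w => (w (some (.inr (.inr U.out)))).2.2.2 = U.one)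
    (fun s w => ⟨(), .right, fun t => t.elim (.letter (e.symm (s.letter?, none)), (w none).2)
        fun t => w (some t),
      fun t => if t = none ∨ t = some (.inr (.inr U.out)) then .right else .stay⟩)
    fun _ w => .idle () w)).seq
  (.loop (fun _ w => (w none).1 ≠ .leftEnd)
    (fun _ w => ⟨(), .left, w, fun t => t.elim .left fun _ => .stay⟩)
    (fun _ w => ⟨(), .right, w, fun t => t.elim .right fun _ => .stay⟩))

variable {M M' U}

/-- An intermediate store of the prelude: the question tape contains `y` and its head is in
cell `p`, the input head is in cell `i`, and the tapes of `M` and `M'` are blank. -/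
structure PreludeRel (y : List β) (p i : ℕ) (d : Store (AskSym M M' U) (AskTape M M' U)) :
    Prop where
  inPos : d.inPos = i
  question : QuestionRel y p d
  head : ∀ t, d.head (some (.inl t)) = 0
  tape : ∀ t p, (d.tape (some (.inl t)) p).2.1 = M.blank

/-- The question is longer than the input, so that the input head is back at the left end marker
when the question has been rewound. -/
theorem questionPrelude_runs (hf : ∀ n, n ≤ f n) (x : List α) :
    ∃ d, (questionPrelude M M' U e).Runs x
      (Store.initial (.rightEnd, M.blank, M'.blank, U.blank))
      ((U.b + 2) * f x.length + U.b + 4) d ∧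
      QuestionRel (trackWord e x [] (f x.length)) 1 d ∧ RunRel M.init d := by
  set N := f x.length with hN
  obtain ⟨d₁, h1, hin, hout, hone, hframe⟩ := U.lift_runs x
    (Sym' := AskSym M M' U) (Tape' := AskTape M M' U) (r := fun _ s => s.2.2.2)
    (e := fun _ s => (.rightEnd, M.blank, M'.blank, s)) (fun _ _ => rfl)
    (ι := fun t => some (.inr (.inr t))) (fun a b h => by simpa using h)
    (d := Store.initial (.rightEnd, M.blank, M'.blank, U.blank)) rfl
  have hnone := hframe none (by simp)
  have hM := fun t => hframe (some (.inl t)) (by simp)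
  have hM' := fun t => hframe (some (.inr (.inl t))) (by simp)
  have h2 := Frag.once_runs (fun (_ : InSym α) (w : AskTape M M' U → AskSym M M' U) =>
    (⟨(), .stay, fun t => t.elim (.leftEnd, (w none).2) fun t => w (some t),
      fun t => t.elim .right fun _ => .stay⟩ : Action Unit _ _)) x d₁
  set d₂ := d₁.act x.length _
  have hr₂ : PreludeRel (trackWord e x [] 0) 1 1 d₂ := by
    refine ⟨by simp [d₂, Store.act, moveInput, hin], ⟨?_, ?_, ?_, ?_⟩, ?_, ?_⟩
    · simp [d₂, Store.act, moveWork, hnone, Store.initial]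
    · intro p
      simp only [d₂, Store.act, hnone, Store.initial, Function.update_apply, readInput_trackWord,
        Option.elim]
      by_cases hp : p = 0
      · simp [hp]
      · simp [hp]
    · intro t; simp [d₂, Store.act, moveWork, hM', Store.initial]
    · intro t p; simp [d₂, Store.act, Store.scan, hM', Store.initial]
    · intro t; simp [d₂, Store.act, moveWork, hM, Store.initial]
    · intro t p; simp [d₂, Store.act, Store.scan, hM, Store.initial]
  have hout₂ : d₂.head (some (.inr (.inr U.out))) = 0 := by
    simp [d₂, Store.act, moveWork, hout]
  have hone₂ : ∀ p, (d₂.tape (some (.inr (.inr U.out))) p).2.2.2 = unary U.blank U.one N p := by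
    intro p; rw [← hone p]; simp [d₂, Store.act, Store.scan]
  clear_value d₂
  classical
  obtain ⟨d₃, ⟨hr₃, -⟩, h3⟩ := Frag.loop_runs
    (test := fun (_ : InSym α) (w : AskTape M M' U → AskSym M M' U) =>
      (w (some (.inr (.inr U.out)))).2.2.2 = U.one)
    (a := fun s w => ⟨(), .right, fun t => t.elim (.letter (e.symm (s.letter?, none)), (w none).2)
        fun t => w (some t),
      fun t => if t = none ∨ t = some (.inr (.inr U.out)) then .right else .stay⟩)
    (b := fun _ w => .idle () w) (x := x) N
    (I := fun i d => PreludeRel (trackWord e x [] i) (i + 1) (min (i + 1) (x.length + 1)) d ∧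
      d.head (some (.inr (.inr U.out))) = i ∧
      ∀ p, (d.tape (some (.inr (.inr U.out))) p).2.2.2 = unary U.blank U.one N p) (d := d₂)
    ⟨by simpa using hr₂, by simpa using hout₂, hone₂⟩
    (by
      rintro i hi d ⟨hr, ho, ht⟩
      have hl : (readInput x d.inPos).letter? = x[i]? := by
        rw [hr.inPos]
        by_cases h : i < x.length
        · rw [min_eq_left (by omega), letter?_readInput]
        · rw [min_eq_right (by omega), letter?_readInput, List.getElem?_eq_none le_rfl,
            List.getElem?_eq_none (by omega)]
      refine ⟨?_, ⟨?_, ⟨?_, ?_, ?_, ?_⟩, ?_, ?_⟩, ?_, ?_⟩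
      · rw [Store.scan, ht, ho, unary, if_pos ⟨by omega, by omega⟩]
      · simp only [Store.act, moveInput, hr.inPos]; omega
      · simp [Store.act, moveWork, hr.question.head_none]
      · intro p
        simp only [Store.act, hr.question.head_none, Function.update_apply, Nat.cast_inj, hl,
          Option.elim]
        rw [readInput_trackWord]
        split
        · rename_i hp
          rw [if_neg (by omega), if_pos (by omega), hp]
          simp
        · rw [hr.question.tape_none, readInput_trackWord]
          refine if_congr Iff.rfl rfl (if_congr ?_ rfl rfl)
          omega
      · intro t; simp [Store.act, moveWork, hr.question.head]
      · intro t p; simpa [Store.act, Store.scan] using hr.question.tape t p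
      · intro t; simp [Store.act, moveWork, hr.head]
      · intro t p; simpa [Store.act, Store.scan] using hr.tape t p
      · simp [Store.act, moveWork, ho]
      · intro p; simpa [Store.act, Store.scan] using ht p)
    (by
      rintro d ⟨hr, ho, ht⟩
      rw [Store.scan, ht, ho, unary, if_neg (by omega)]
      exact U.one_ne.symm)
  rw [Store.act_idle] at h3
  obtain ⟨d₄, hr₄, h4⟩ := Frag.loop_runs
    (test := fun (_ : InSym α) (w : AskTape M M' U → AskSym M M' U) => (w none).1 ≠ .leftEnd)
    (a := fun _ w => ⟨(), .left, w, fun t => t.elim .left fun _ => .stay⟩)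
    (b := fun _ w => ⟨(), .right, w, fun t => t.elim .right fun _ => .stay⟩) (x := x) (N + 1)
    (I := fun i d => PreludeRel (trackWord e x [] N) (N + 1 - i)
      (min (N + 1) (x.length + 1) - i) d) (d := d₃) (by simpa using hr₃)
    (by
      rintro i hi d hr
      refine ⟨?_, ⟨?_, ⟨?_, ?_, ?_, ?_⟩, ?_, ?_⟩⟩
      · rw [Store.scan, hr.question.head_none, hr.question.tape_none]
        exact readInput_ne_leftEnd _ (by omega)
      · simp only [Store.act, moveInput, hr.inPos]; omega
      · simp only [Store.act, moveWork, hr.question.head_none, Option.elim]; omega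
      · intro p; simpa [Store.act, Store.scan] using hr.question.tape_none p
      · intro t; simp [Store.act, moveWork, hr.question.head]
      · intro t p; simpa [Store.act, Store.scan] using hr.question.tape t p
      · intro t; simp [Store.act, moveWork, hr.head]
      · intro t p; simpa [Store.act, Store.scan] using hr.tape t p)
    (by
      intro d hr
      rw [Store.scan, hr.question.head_none, hr.question.tape_none, Nat.sub_self, readInput_zero]
      simp)
  have hn := hf x.length
  refine ⟨_, (((h1.seq h2).seq h3).seq h4).mono ?_, ⟨?_, ?_, ?_, ?_⟩, ?_, ?_, ?_⟩
  · rw [← hN, add_mul]; omega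
  · simp [Store.act, moveWork, hr₄.question.head_none]
  · intro p; simpa [Store.act, Store.scan] using hr₄.question.tape_none p
  · intro t; simp [Store.act, moveWork, hr₄.question.head]
  · intro t p; simpa [Store.act, Store.scan] using hr₄.question.tape t p
  · simp only [Store.act, moveInput, hr₄.inPos, ATM.init]; omega
  · intro t; simp [Store.act, moveWork, hr₄.head, ATM.init]
  · intro t p; simpa [Store.act, Store.scan, ATM.init] using hr₄.tape t p

variable (M M' U)

/-- The asking machine: it writes a word on the question tape, simulates `M` until its `m`-th
alternation, recording the actions on the question tape, and asks `M'`. -/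
noncomputable def ask [Finite β] (ans : Bool) : ATM α :=
  (askCore M M' U e m).prefixed (questionPrelude M M' U e) .ex ans

variable {M M' U m}

theorem ask_nil_mem [Finite β] {ans : Bool} : [] ∈ (ask M M' U e m ans).language ↔ ans = true :=
  (prefixed_nil (.inl rfl)).1

theorem ask_nil_bdd [Finite β] {ans : Bool} : Bdd [] (ask M M' U e m ans).init 1 0 :=
  (prefixed_nil (.inl rfl)).2

theorem ask_deterministic [Finite β] (hM' : M'.Deterministic) {ans : Bool} :
    (ask M M' U e 0 ans).Deterministic :=
  prefixed_deterministic (askCore_deterministic e hM')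

theorem askCore_cfg_start [Finite β] (h : 0 < m) (d : Store (AskSym M M' U) (AskTape M M' U)) :
    (askCore M M' U e m).cfg (askCore M M' U e m).start d = runCfg e M.start 0 d :=
  (congrArg (fun s => (askCore M M' U e m).cfg s d) (dif_pos h)).trans
    (runCfg_eq_of_lt e _ h d).symm

theorem askCore_cfg_start_zero [Finite β] (d : Store (AskSym M M' U) (AskTape M M' U)) :
    (askCore M M' U e 0).cfg (askCore M M' U e 0).start d = simCfg e M'.start d := rfl

/-- For `m = 0` the machine `M` is not simulated at all. -/
theorem ask_zero_mem_language_iff [Finite β] (hf : ∀ n, n ≤ f n) {x : List α} (hx : x ≠ [])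
    {ans : Bool} : x ∈ (ask M M' U e 0 ans).language ↔
      trackWord e x [] (f x.length) ∈ M'.language := by
  obtain ⟨d, h1, h2, h3⟩ := questionPrelude_runs (M' := M') (U := U) e hf x
  refine (prefixed_mem_language_iff (N := askCore M M' U e 0) (.inl rfl) hx h1).trans ?_
  rw [askCore_cfg_start_zero]
  exact ((simCfg_bisim e x _ d).acceptsFrom_iff ⟨d, h2.simRel, rfl⟩).symm

/-- If `M'` knows, for each path of `M` to its `m`-th alternation, whether `M` accepts from there,
then the asking machine decides the language of `M`. -/
theorem ask_mem_language_iff [Finite β] (hf : ∀ n, n ≤ f n) {x : List α} (hx : x ≠ []) {t A : ℕ}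
    (hb : Bdd x M.init t A) (ht : t < f x.length)
    (key : ∀ π c, M.HitsAlternation x m π c →
      (trackWord e x π (f x.length) ∈ M'.language ↔ M.AcceptsFrom x c)) {ans : Bool} :
    x ∈ (ask M M' U e m ans).language ↔ x ∈ M.language := by
  rcases Nat.eq_zero_or_pos m with rfl | hm
  · exact (ask_zero_mem_language_iff e hf hx).trans (key _ _ .zero)
  · obtain ⟨d, h1, h2, h3⟩ := questionPrelude_runs (M' := M') (U := U) e hf x
    refine (prefixed_mem_language_iff (N := askCore M M' U e m) (.inl rfl) hx h1).trans ?_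
    rw [askCore_cfg_start e hm]
    exact (runCfg_acceptsFrom_iff e key hb .nil hm (by simpa using ht) h3 h2).symm

theorem ask_bdd [Finite β] (hf : ∀ n, n ≤ f n) (hM : m = 0 ∨ M.label M.start ≠ .all) {x : List α}
    (hx : x ≠ []) {t A : ℕ} (hb : m = 0 ∨ Bdd x M.init t A) (ht : t < f x.length) {T' A' : ℕ}
    (hM' : ∀ y : List β, y.length = f x.length → Bdd y M'.init T' A') {ans : Bool} :
    Bdd x (ask M M' U e m ans).init ((U.b + 4) * f x.length + U.b + 7 + T')
      ((m - 1) + A' + altCount (altLabel (m - 1)) (M'.label M'.start)) := by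
  obtain ⟨d, h1, h2, h3⟩ := questionPrelude_runs (M' := M') (U := U) e hf x
  have htime : (U.b + 4) * f x.length = (U.b + 2) * f x.length + f x.length + f x.length := by ring
  rcases Nat.eq_zero_or_pos m with rfl | hm
  · have h4 := (simCfg_bisim (m := 0) e x _ d).bdd ⟨d, h2.simRel, rfl⟩
      (hM' _ (trackWord_length _ _ _ _))
    refine (prefixed_bdd (N := askCore M M' U e 0) (.inl rfl) hx h1
      (T := T') (A := A') h4).mono ?_ ?_
    · omega
    · change A' + altCount (altLabel 0) (M'.label M'.start) ≤
        0 + A' + altCount (altLabel 0) (M'.label M'.start)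
      omega
  · have h4 := runCfg_bdd (m := m) e hM' (hb.resolve_left (by omega)) (π := []) (a := 0)
      (d := d) (fun h => by
        rcases h with h | h
        · exact h.trans (by simp [altLabel])
        · exact ((hM.resolve_left (by omega)) h).elim) hm (by simpa using ht) h3 h2
    refine (prefixed_bdd (N := askCore M M' U e m) (.inl rfl) hx h1
      (T := t + (f x.length + 2) + T')
      (A := m - 1 + A' + altCount (altLabel (m - 1)) (M'.label M'.start)) ?_).mono ?_ ?_
    · exact (askCore_cfg_start e hm d).symm ▸ h4
    · omega
    · have h5 : altCount .ex ((askCore M M' U e m).label (askCore M M' U e m).start) = 0 := by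
        refine altCount_of_not _ _ ?_
        have h6 := runCfg_label_of_lt (M' := M') (U := U) e M.start hm d
        have h7 : (askCore M M' U e m).label (askCore M M' U e m).start = M.label M.start :=
          (congrArg (fun c => (askCore M M' U e m).label c.state)
            (askCore_cfg_start e hm d)).trans h6
        rw [h7]
        rintro (⟨-, h8⟩ | ⟨h8, -⟩)
        · exact hM.resolve_left (by omega) h8
        · simp at h8
      rw [h5]
      omega

theorem ask_visitsAtMost [Finite β] (hf : ∀ n, n ≤ f n) {x : List α} (hx : x ≠ []) {S : ℕ}
    (hM' : M'.VisitsAtMost (trackWord e x [] (f x.length)) M'.init S) {ans : Bool} :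
    (ask M M' U e 0 ans).VisitsAtMost x (ask M M' U e 0 ans).init
      (Nat.card (AskTape M M' U) * ((2 * U.b + 6) * f x.length + 2 * U.b + 13) + S) := by
  have := M.finTape
  have := M'.finTape
  have := U.finTape
  obtain ⟨d, h1, h2, h3⟩ := questionPrelude_runs (M' := M') (U := U) e hf x
  set N := f x.length
  have hb := simCfg_bisim (m := 0) e x (trackWord e x [] N) d
  have h4 : (askCore M M' U e 0).VisitsAtMost x
      ((askCore M M' U e 0).cfg (askCore M M' U e 0).start d)
      (Nat.card (AskTape M M' U) * (2 * (N + 1) + 1) + Nat.card (AskTape M M' U) + S) := by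
    have hsub : {ip : AskTape M M' U × ℤ | ∃ c', (askCore M M' U e 0).From x
        ((askCore M M' U e 0).cfg (askCore M M' U e 0).start d) c' ∧ c'.head ip.1 = ip.2} ⊆
        ({ip : AskTape M M' U × ℤ | ip.2.natAbs ≤ N + 1} ∪
        (fun t => (t, d.head t)) '' Set.univ) ∪ (fun ip : M'.Tape × ℤ =>
          ((some (.inr (.inl ip.1)), ip.2) : AskTape M M' U × ℤ)) ''
        {ip : M'.Tape × ℤ | ∃ c', M'.From (trackWord e x [] N) M'.init c' ∧ c'.head ip.1 = ip.2} := by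
      rintro ⟨i, p⟩ ⟨c', h5, h6⟩
      obtain rfl : c'.head i = p := h6
      obtain ⟨c₁, h7, d', h8, rfl⟩ := hb.from_bwd ⟨d, h2.simRel, rfl⟩ h5
      change (i, d'.head i) ∈ _
      rcases i with _ | (t | t | t)
      · refine .inl (.inl ?_)
        have h9 := h8.inPos_le
        rw [trackWord_length] at h9
        rw [h8.head_none]
        simpa using h9
      · exact .inl (.inr ⟨_, trivial, by rw [h8.frame_left]⟩)
      · exact .inr ⟨(t, c₁.head t), ⟨c₁, h7, rfl⟩, by rw [h8.head]⟩
      · exact .inl (.inr ⟨_, trivial, by rw [h8.frame_right]⟩)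
    refine (Set.encard_le_encard hsub).trans ((Set.encard_union_le _ _).trans ?_)
    rw [Nat.cast_add]
    refine add_le_add ((Set.encard_union_le _ _).trans ?_) ((Set.encard_image_le _ _).trans hM')
    rw [Nat.cast_add]
    refine add_le_add (encard_heads_le _) ((Set.encard_image_le _ _).trans ?_)
    rw [Set.encard_univ, ENat.card_eq_coe_natCard]
  refine (prefixed_visitsAtMost (N := askCore M M' U e 0) (.inl rfl) hx h1 h4).mono ?_
  change Nat.card (AskTape M M' U) * _ + _ ≤ _
  nlinarith [Nat.zero_le (Nat.card (AskTape M M' U))]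

theorem ask_visitsAtMost_nil [Finite β] {ans : Bool} :
    (ask M M' U e 0 ans).VisitsAtMost [] (ask M M' U e 0 ans).init
      (Nat.card (AskTape M M' U)) := prefixed_visitsAtMost_nil

end ask

end ATM

end AltTM

namespace AltTM

/-! ### Closure properties of the classes -/

section classes

open ATM

variable {α : Type} {F : Set (ℕ → ℕ)}

theorem hasLevel_zero_iff {M : ATM α} {T : ℕ → ℕ} : M.HasLevel 0 ∧ M.TimeBounded T ↔
    M.Deterministic ∧ ∀ x, Bdd x M.init (T x.length) (T x.length) := by
  refine and_congr Iff.rfl (forall_congr' fun x => ?_)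
  rw [bdd_init_iff]
  exact forall₃_congr fun t a c => ⟨fun h hr => ⟨h hr, hr.alt_le.trans (h hr)⟩,
    fun h hr => (h hr).1⟩

theorem hasLevel_succ_iff {M : ATM α} {j : ℕ} {T : ℕ → ℕ} :
    M.HasLevel (j + 1) ∧ M.TimeBounded T ↔
    M.label M.start ≠ .all ∧ ∀ x, Bdd x M.init (T x.length) j := by
  unfold HasLevel TimeBounded
  rw [and_assoc]
  refine and_congr Iff.rfl ?_
  simp only [bdd_init_iff]
  exact ⟨fun h x t a c hr => ⟨h.2 x t a c hr, h.1 x t a c hr⟩,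
    fun h => ⟨fun x t a c hr => (h x t a c hr).2, fun x t a c hr => (h x t a c hr).1⟩⟩

theorem mem_atime_zero_iff {L : Lang} : L ∈ ATIME F 0 ↔ ∃ f ∈ F, ∃ (b : ℕ) (M : ATM (Fin L.1)),
    M.Deterministic ∧ (∀ x, Bdd x M.init (b * f x.length + b) (b * f x.length + b)) ∧
    M.language = L.2 := by
  refine exists_congr fun f => and_congr Iff.rfl (exists₂_congr fun b M => ?_)
  rw [← and_assoc, ← and_assoc]
  exact and_congr (hasLevel_zero_iff (T := fun n => b * f n + b)) Iff.rfl

theorem mem_atime_succ_iff {L : Lang} {j : ℕ} : L ∈ ATIME F (j + 1) ↔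
    ∃ f ∈ F, ∃ (b : ℕ) (M : ATM (Fin L.1)),
    M.label M.start ≠ .all ∧ (∀ x, Bdd x M.init (b * f x.length + b) j) ∧
    M.language = L.2 := by
  refine exists_congr fun f => and_congr Iff.rfl (exists₂_congr fun b M => ?_)
  rw [← and_assoc, ← and_assoc]
  exact and_congr (hasLevel_succ_iff (T := fun n => b * f n + b)) Iff.rfl

@[simp] theorem Lang.compl_compl (L : Lang) : L.compl.compl = L := by
  exact congrArg (Sigma.mk L.1) (_root_.compl_compl L.2)

theorem dual_label_start (M : ATM α) :
    M.dual.label M.dual.start = (M.label M.start).swap := rfl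

/-- The complements of the languages of level `j + 1` are decided by the machines with as many
alternations that do not begin in an existential state. -/
theorem mem_coatime_succ_iff {L : Lang} {j : ℕ} : L ∈ coATIME F (j + 1) ↔
    ∃ f ∈ F, ∃ (b : ℕ) (M : ATM (Fin L.1)),
    M.label M.start ≠ .ex ∧ (∀ x, Bdd x M.init (b * f x.length + b) j) ∧
    M.language = L.2 := by
  refine (mem_atime_succ_iff (L := L.compl)).trans (exists_congr fun f => and_congr Iff.rfl
    (exists_congr fun b => ⟨?_, ?_⟩))
  · rintro ⟨M, h1, h2, h3⟩
    refine ⟨M.dual, ?_, fun x => (h2 x).dual, ?_⟩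
    · rw [dual_label_start]
      cases h : M.label M.start <;> simp [h, Label.swap] at h1 ⊢
    · refine (dual_language fun x => ⟨_, _, h2 x⟩).trans ?_
      rw [h3]
      exact _root_.compl_compl L.2
  · rintro ⟨M, h1, h2, h3⟩
    refine ⟨M.dual, ?_, fun x => (h2 x).dual, ?_⟩
    · rw [dual_label_start]
      cases h : M.label M.start <;> simp [h, Label.swap] at h1 ⊢
    · exact (dual_language fun x => ⟨_, _, h2 x⟩).trans (congrArg _ h3)

theorem compl_mem_atime_zero {L : Lang} (h : L ∈ ATIME F 0) : L.compl ∈ ATIME F 0 := by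
  rw [mem_atime_zero_iff] at h ⊢
  obtain ⟨f, hf, b, M, h1, h2, h3⟩ := h
  refine ⟨f, hf, b, M.dual, h1, fun x => (h2 x).dual, ?_⟩
  exact (dual_language fun x => ⟨_, _, h2 x⟩).trans (congrArg _ h3)

/-- A class of languages that contains all complements of its members is closed under
complement. -/
theorem atime_eq_coatime {j : ℕ} (h : ∀ L ∈ ATIME F j, L.compl ∈ ATIME F j) :
    ATIME F j = coATIME F j := by
  ext L
  exact ⟨h L, fun hL => by simpa using h _ hL⟩

theorem atime_eq_coatime_of_subset {j : ℕ} (h : coATIME F j ⊆ ATIME F j) :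
    ATIME F j = coATIME F j :=
  atime_eq_coatime fun L hL => h (by
    change L.compl.compl ∈ ATIME F j
    rwa [Lang.compl_compl])

theorem atime_zero_eq_coatime : ATIME F 0 = coATIME F 0 :=
  atime_eq_coatime fun _ => compl_mem_atime_zero

theorem atime_mono {j k : ℕ} (hj : 1 ≤ j) (hk : j ≤ k) : ATIME F j ⊆ ATIME F k := by
  obtain ⟨j, rfl⟩ := Nat.exists_eq_add_of_le' hj
  obtain ⟨k, rfl⟩ := Nat.exists_eq_add_of_le' (hj.trans hk)
  intro L hL
  rw [mem_atime_succ_iff] at hL ⊢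
  obtain ⟨f, hf, b, M, h1, h2, h3⟩ := hL
  exact ⟨f, hf, b, M, h1, fun x => (h2 x).mono le_rfl (by omega), h3⟩

theorem language_eq_of_nil {L : Lang} {M : ATM (Fin L.1)} {ans : Bool} (h : ans = true ↔ [] ∈ L.2)
    (h1 : [] ∈ M.language ↔ ans = true) (h2 : ∀ x ≠ [], (x ∈ M.language ↔ x ∈ L.2)) :
    M.language = L.2 := by
  ext x
  by_cases hx : x = []
  · rw [hx, h1, h]
  · exact h2 x hx

/-- A machine that begins in a universal state can be started in an existential one, at the cost
of an alternation. -/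
theorem coatime_subset_atime_succ (j : ℕ) (hj : 1 ≤ j) : coATIME F j ⊆ ATIME F (j + 1) := by
  classical
  obtain ⟨j, rfl⟩ := Nat.exists_eq_add_of_le' hj
  intro L hL
  rw [mem_coatime_succ_iff] at hL
  rw [mem_atime_succ_iff]
  obtain ⟨f, hf, b, M, -, h2, h3⟩ := hL
  have hrun : ∀ x : List (Fin L.1), (Frag.once fun _ w => Action.idle () w).Runs x
      (Store.initial M.blank) 1
      (Store.initial (Tape := M.Tape) M.blank) := by
    intro x
    have := Frag.once_runs (fun (_ : InSym (Fin L.1)) (w : M.Tape → M.Sym) => Action.idle () w) x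
      (Store.initial M.blank)
    rwa [Store.act_idle] at this
  refine ⟨f, hf, b + 2, M.prefixed (.once fun _ w => .idle () w) .ex (decide ([] ∈ L.2)),
    by simp [prefixed], fun x => ?_, ?_⟩
  · by_cases hx : x = []
    · subst hx
      exact (prefixed_nil (.inl rfl)).2.mono (by omega) (by omega)
    · refine (prefixed_bdd (.inl rfl) hx (hrun x) (h2 x)).mono ?_ ?_
      · rw [add_mul]; omega
      · have := altCount_le .ex (M.label M.start)
        omega
  · refine language_eq_of_nil (by simp) (prefixed_nil (.inl rfl)).1 fun x hx => ?_
    rw [prefixed_mem_language_iff (.inl rfl) hx (hrun x), ← h3]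
    rfl

end classes

/-! ### Transfer between classes of bounds -/

section transfer

open ATM

/-- The hypotheses on the small bounds `D` and the large bounds `C`. -/
structure TransferPair (D C : Set (ℕ → ℕ)) : Prop where
  linear : ∀ a : ℕ, 1 ≤ a → (fun n => a * n) ∈ D
  timeConstructible : ∀ f ∈ C, TimeConstructible f
  add : ∀ f ∈ C, ∀ g ∈ C, f + g ∈ C
  comp : ∀ g ∈ D, ∀ f ∈ C, g ∘ f ∈ C

variable {C D : Set (ℕ → ℕ)}

/-- A bound `b * f n + b` is absorbed by a multiple of `f`, except on the empty input, where `f` may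
vanish. -/
theorem TransferPair.exists_lt (h : TransferPair D C) {f : ℕ → ℕ} (hf : f ∈ C) (b : ℕ) :
    ∃ g ∈ C, ∀ n, 1 ≤ n → b * f n + b < g n := by
  refine ⟨_, h.comp _ (h.linear (2 * b + 1) (by omega)) f hf, fun n hn => ?_⟩
  have h1 := (h.timeConstructible f hf).1 n
  simp only [Function.comp]
  nlinarith

theorem exists_letters {n : ℕ} (M : ATM (Fin n)) :
    ∃ m, Nonempty (Fin m ≃ Option (Fin n) × Option (Action M.State M.Sym M.Tape)) := by
  have := M.finState
  have := M.finSym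
  have := M.finTape
  obtain ⟨m, ⟨e⟩⟩ := Finite.exists_equiv_fin
    (Option (Fin n) × Option (Action M.State M.Sym M.Tape))
  exact ⟨m, ⟨e.symm⟩⟩

/-- The words of `L`, padded to the length `h n`, can be recognized by means of `L'`. The letters
of the padded words have a second track, which is empty. -/
def PadsTo (L : Lang) (h : ℕ → ℕ) (L' : Lang) : Prop :=
  ∃ (M : ATM (Fin L.1)) (e : Fin L'.1 ≃ Option (Fin L.1) × Option (Action M.State M.Sym M.Tape)),
    ∀ x ≠ [], (trackWord e x [] (h x.length) ∈ L'.2 ↔ x ∈ L.2)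

/-- Padded to a length above the running time, a language of level `j` becomes one of level `j`
with a linear time bound. -/
theorem TransferPair.exists_padsTo_of_mem_atime (h : TransferPair D C) {j : ℕ} {L : Lang}
    (hL : L ∈ ATIME C j) : ∃ g ∈ C, ∃ L' ∈ ATIME D j, PadsTo L g L' := by
  have hlen : ∀ {x : List (Fin L.1)}, x ≠ [] → 1 ≤ x.length := List.length_pos_iff.2
  rcases j with _ | j
  · obtain ⟨f, hf, b, M, h1, h2, h3⟩ := mem_atime_zero_iff.1 hL
    obtain ⟨g, hg, hlt⟩ := h.exists_lt hf b
    obtain ⟨m, ⟨e⟩⟩ := exists_letters M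
    refine ⟨g, hg, ⟨m, (replay M e 0 True .ex).language⟩, mem_atime_zero_iff.2
      ⟨_, h.linear 1 le_rfl, 6, _, replay_deterministic h1, fun y => ?_, rfl⟩, M, e, fun x hx => ?_⟩
    · exact (replay_bdd_time (.inl rfl) y).mono (by omega) (by omega)
    · rw [← h3]
      exact replay_mem_language_iff (.inl rfl) ((h.timeConstructible g hg).1 _)
        (hlt _ (hlen hx)) (h2 x) .zero
  · obtain ⟨f, hf, b, M, h1, h2, h3⟩ := mem_atime_succ_iff.1 hL
    obtain ⟨g, hg, hlt⟩ := h.exists_lt hf b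
    obtain ⟨m, ⟨e⟩⟩ := exists_letters M
    refine ⟨g, hg, ⟨m, (replay M e 0 True .ex).language⟩, mem_atime_succ_iff.2
      ⟨_, h.linear 1 le_rfl, 6, replay M e 0 True .ex, ?_, fun y => ?_, rfl⟩, M, e, fun x hx => ?_⟩
    · rw [replay_label_start]; simp
    · exact (replay_bdd (m := 0) (by simp [altLabel]) h1 y (h2 _)).mono (by omega) (by omega)
    · rw [← h3]
      exact replay_mem_language_iff (.inl rfl) ((h.timeConstructible g hg).1 _)
        (hlt _ (hlen hx)) (h2 x) .zero

/-- Padded to a length above the space used, a language becomes one that is decided in linear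
space. -/
theorem TransferPair.exists_padsTo_of_mem_space (h : TransferPair D C) {L : Lang}
    (hL : L ∈ SPACE C) : ∃ g ∈ C, ∃ L' ∈ SPACE D, PadsTo L g L' := by
  obtain ⟨f, hf, b, M, h1, h2, h3, h4⟩ := hL
  obtain ⟨g, hg, hlt⟩ := h.exists_lt hf b
  obtain ⟨m, ⟨e⟩⟩ := exists_letters M
  obtain ⟨b', hb'⟩ := replay_spaceBounded (e := e) (always := False) (T := .ex) rfl h1 h2
  refine ⟨g, hg, ⟨m, (replay M e 0 False .ex).language⟩, ⟨_, h.linear 1 le_rfl, b',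
    replay M e 0 False .ex, replay_deterministic h1, replay_halts rfl h2, by simpa using hb', rfl⟩,
    M, e, fun x hx => ?_⟩
  rw [← h4]
  exact replay_mem_language_iff_of_space (.inl rfl) ((h.timeConstructible g hg).1 _)
    (hlt _ (List.length_pos_iff.2 hx)) (visitsAtMost_init_iff.2 (h3 x))

/-- The padding can be produced within the bounds in `C`, which are time-constructible. -/
theorem TransferPair.mem_atime_of_padsTo (h : TransferPair D C) {j : ℕ} {L L' : Lang} {g : ℕ → ℕ}
    (hg : g ∈ C) (hL : PadsTo L g L') (hL' : L' ∈ ATIME D j) : L ∈ ATIME C j := by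
  classical
  obtain ⟨M, e, hL⟩ := hL
  have htc := h.timeConstructible g hg
  obtain ⟨U⟩ := htc.unaryFrag
  have hpos : ∀ x : List (Fin L.1), x ≠ [] → 0 < g x.length := fun x hx =>
    (List.length_pos_iff.2 hx).trans_le (htc.1 _)
  have hbound : ∀ b u v : ℕ, (U.b + 4) * u + U.b + 7 + (b * v + b) ≤
      (U.b + b + 7) * (u + v) + (U.b + b + 7) := by
    intro b u v
    nlinarith [Nat.zero_le (U.b * v), Nat.zero_le (b * u)]
  rcases j with _ | j
  · obtain ⟨f, hf, b, M', h1, h2, h3⟩ := mem_atime_zero_iff.1 hL'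
    refine mem_atime_zero_iff.2 ⟨_, h.add g hg _ (h.comp f hf g hg), U.b + b + 7,
      ask M M' U e 0 (decide ([] ∈ L.2)), ask_deterministic e h1, fun x => ?_, ?_⟩
    · by_cases hx : x = []
      · subst hx
        exact (ask_nil_bdd e).mono (by omega) (by omega)
      · exact ((ask_bdd e htc.1 (.inl rfl) hx (A := 0) (.inl rfl) (hpos x hx)
          (fun y hy => hy ▸ h2 y)).mono (hbound b _ _) le_rfl).alt_le_time
    · refine language_eq_of_nil (by simp) (ask_nil_mem e) fun x hx => ?_
      rw [ask_zero_mem_language_iff e htc.1 hx, h3, hL x hx]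
  · obtain ⟨f, hf, b, M', h1, h2, h3⟩ := mem_atime_succ_iff.1 hL'
    refine mem_atime_succ_iff.2 ⟨_, h.add g hg _ (h.comp f hf g hg), U.b + b + 7,
      ask M M' U e 0 (decide ([] ∈ L.2)), by simp [ask, prefixed], fun x => ?_, ?_⟩
    · by_cases hx : x = []
      · subst hx
        exact (ask_nil_bdd e).mono (by omega) (by omega)
      · refine (ask_bdd e htc.1 (.inl rfl) hx (A := 0) (.inl rfl) (hpos x hx)
          (fun y hy => hy ▸ h2 y)).mono (hbound b _ _) ?_
        rw [altCount_of_not]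
        · omega
        · simp [Alternates, h1, altLabel]
    · refine language_eq_of_nil (by simp) (ask_nil_mem e) fun x hx => ?_
      rw [ask_zero_mem_language_iff e htc.1 hx, h3, hL x hx]

theorem TransferPair.mem_space_of_padsTo (h : TransferPair D C) {L L' : Lang} {g : ℕ → ℕ}
    (hg : g ∈ C) (hL : PadsTo L g L') (hL' : L' ∈ SPACE D) : L ∈ SPACE C := by
  classical
  obtain ⟨M, e, hL⟩ := hL
  have htc := h.timeConstructible g hg
  obtain ⟨U⟩ := htc.unaryFrag
  obtain ⟨f, hf, b, M', h1, h2, h3, h4⟩ := hL'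
  set K := Nat.card (AskTape M M' U)
  refine ⟨_, h.add g hg _ (h.comp f hf g hg), K * (2 * U.b + 13) + b,
      ask M M' U e 0 (decide ([] ∈ L.2)), ask_deterministic e h1, ?_, fun x => ?_, ?_⟩
  · rw [halts_iff] at h2 ⊢
    intro x
    by_cases hx : x = []
    · subst hx
      exact ⟨_, _, ask_nil_bdd e⟩
    · -- the computations of `M'` on the finitely many words of length `g n` have a common bound
      have hfin : {y : List (Fin L'.1) | y.length = g x.length}.Finite :=
        List.finite_length_eq _ _
      choose t A hb using h2
      obtain ⟨B, hB⟩ := (hfin.image fun y => t y).bddAbove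
      exact ⟨_, _, ask_bdd e htc.1 (.inl rfl) hx (A := 0) (.inl rfl)
        ((List.length_pos_iff.2 hx).trans_le (htc.1 _))
        (fun y hy => ((hb y).mono (hB ⟨y, hy, rfl⟩) le_rfl).alt_le_time)⟩
  · rw [← visitsAtMost_init_iff]
    by_cases hx : x = []
    · subst hx
      refine (ask_visitsAtMost_nil e).mono ?_
      change K ≤ _ + (_ + _)
      nlinarith [Nat.zero_le (K * U.b)]
    · have h5 := h3 (trackWord e x [] (g x.length))
      rw [trackWord_length, ← visitsAtMost_init_iff] at h5
      refine (ask_visitsAtMost e htc.1 hx h5).mono ?_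
      change K * _ + (b * f (g x.length) + b) ≤ (K * (2 * U.b + 13) + b) *
        (g x.length + f (g x.length)) + (K * (2 * U.b + 13) + b)
      generalize g x.length = u
      generalize f u = v
      have h6 : K * ((2 * U.b + 6) * u + 2 * U.b + 13) ≤
          K * ((2 * U.b + 13) * (u + v) + (2 * U.b + 13)) := by
        refine Nat.mul_le_mul_left _ ?_
        nlinarith [Nat.zero_le (U.b * v)]
      nlinarith [Nat.zero_le (b * u)]
  · refine language_eq_of_nil (by simp) (ask_nil_mem e) fun x hx => ?_
    rw [ask_zero_mem_language_iff e htc.1 hx, h4, hL x hx]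

theorem TransferPair.atime_subset_atime (h : TransferPair D C) {j j' : ℕ}
    (hD : ATIME D j ⊆ ATIME D j') : ATIME C j ⊆ ATIME C j' := by
  intro L hL
  obtain ⟨g, hg, L', h1, h2⟩ := h.exists_padsTo_of_mem_atime hL
  exact h.mem_atime_of_padsTo hg h2 (hD h1)

theorem TransferPair.atime_subset_space (h : TransferPair D C) {j : ℕ}
    (hD : ATIME D j ⊆ SPACE D) : ATIME C j ⊆ SPACE C := by
  intro L hL
  obtain ⟨g, hg, L', h1, h2⟩ := h.exists_padsTo_of_mem_atime hL
  exact h.mem_space_of_padsTo hg h2 (hD h1)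

theorem TransferPair.space_subset_atime (h : TransferPair D C) {j : ℕ}
    (hD : SPACE D ⊆ ATIME D j) : SPACE C ⊆ ATIME C j := by
  intro L hL
  obtain ⟨g, hg, L', h1, h2⟩ := h.exists_padsTo_of_mem_space hL
  exact h.mem_atime_of_padsTo hg h2 (hD h1)

/-- If level `j` of the small hierarchy is closed under complement, then the levels `k + 1` and
`k ≥ j` of the large one coincide: the computation of the machine of level `k + 1` after its
first `k + 1 - j` alternations is a question that both a machine of level `j` and the dual of such
a machine can answer, and one of them begins in a state of the right kind. -/
theorem TransferPair.atime_succ_subset (h : TransferPair D C) {j k : ℕ} (hj : 1 ≤ j) (hk : j ≤ k)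
    (hD : ATIME D j = coATIME D j) : ATIME C (k + 1) ⊆ ATIME C k := by
  classical
  obtain ⟨j, rfl⟩ := Nat.exists_eq_add_of_le' hj
  obtain ⟨m, rfl⟩ := Nat.exists_eq_add_of_le hk
  intro L hL
  obtain ⟨f, hf, b, M, h1, h2, h3⟩ := mem_atime_succ_iff.1 hL
  obtain ⟨g, hg, hlt⟩ := h.exists_lt hf b
  have htc := h.timeConstructible g hg
  obtain ⟨U⟩ := htc.unaryFrag
  obtain ⟨n, ⟨e⟩⟩ := exists_letters M
  -- The question. Before its `(m + 1)`-st alternation, `M` is replayed in states of the kind of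
  -- those after it. So the replaying machine or its dual is of level `j + 1`, depending on the
  -- parity of `m`.
  set Q : Lang := ⟨n, (replay M e (m + 1) True (altLabel (m + 1))).language⟩ with hQ
  have hbdd : ∀ y, Bdd y (replay M e (m + 1) True (altLabel (m + 1))).init
      (6 * (1 * y.length) + 6) j := fun y =>
    (replay_bdd rfl h1 y (h2 _)).mono (by omega) (by omega)
  have hQ1 : Q ∈ ATIME D (j + 1) := by
    rcases altLabel_eq (m + 1) with hm | hm
    · exact mem_atime_succ_iff.2 ⟨_, h.linear 1 le_rfl, 6, _,
        by rw [replay_label_start, hm]; simp, hbdd, rfl⟩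
    · rw [hD]
      exact mem_coatime_succ_iff.2 ⟨_, h.linear 1 le_rfl, 6, _,
        by rw [replay_label_start, hm]; simp, hbdd, rfl⟩
  -- The machine that answers has to begin in the kind of states that precede the alternation.
  obtain ⟨f', hf', b', M', h4, h5, h6⟩ : ∃ f' ∈ D, ∃ (b' : ℕ) (M' : ATM (Fin n)),
      altCount (altLabel m) (M'.label M'.start) = 0 ∧
      (∀ y, Bdd y M'.init (b' * f' y.length + b') j) ∧ M'.language = Q.2 := by
    rcases altLabel_eq m with hm | hm
    · obtain ⟨f', hf', b', M', h4, h5, h6⟩ := mem_atime_succ_iff.1 hQ1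
      exact ⟨f', hf', b', M', altCount_of_not _ _ (by simp [Alternates, hm, h4]), h5, h6⟩
    · rw [hD] at hQ1
      obtain ⟨f', hf', b', M', h4, h5, h6⟩ := mem_coatime_succ_iff.1 hQ1
      exact ⟨f', hf', b', M', altCount_of_not _ _ (by simp [Alternates, hm, h4]), h5, h6⟩
  have hlen : ∀ {x : List (Fin L.1)}, x ≠ [] → 1 ≤ x.length := List.length_pos_iff.2
  rw [show j + 1 + m = m + j + 1 by omega]
  refine mem_atime_succ_iff.2 ⟨_, h.add g hg _ (h.comp f' hf' g hg), U.b + b' + 7,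
    ask M M' U e (m + 1) (decide ([] ∈ L.2)), by simp [ask, prefixed], fun x => ?_, ?_⟩
  · by_cases hx : x = []
    · subst hx
      exact (ask_nil_bdd e).mono (by omega) (by omega)
    · refine (ask_bdd e htc.1 (.inr h1) hx (.inr (h2 x)) (hlt _ (hlen hx))
        (fun y hy => hy ▸ h5 y)).mono ?_ ?_
      · simp only [Pi.add_apply, Function.comp]
        generalize g x.length = u
        generalize f' u = v
        nlinarith [Nat.zero_le (U.b * v), Nat.zero_le (b' * u)]
      · rw [Nat.add_sub_cancel, h4, add_zero]
  · refine language_eq_of_nil (by simp) (ask_nil_mem e) fun x hx => ?_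
    rw [← h3]
    refine ask_mem_language_iff e htc.1 hx (h2 x) (hlt _ (hlen hx)) fun π c hc => ?_
    rw [h6]
    exact replay_mem_language_iff (altLabel_eq _) (htc.1 _) (hlt _ (hlen hx)) (h2 x) hc

theorem TransferPair.collapse_of_closed (h : TransferPair D C) {j k : ℕ} (hj : 1 ≤ j) (hk : j ≤ k)
    (hD : ATIME D j = coATIME D j) :
    ATIME C k = coATIME C k ∧ coATIME C k = ATIME C j := by
  have h1 : ∀ k, j ≤ k → ATIME C (k + 1) = ATIME C k := fun k hk =>
    (h.atime_succ_subset hj hk hD).antisymm (atime_mono (hj.trans hk) (Nat.le_succ k))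
  have h2 : ATIME C k = coATIME C k := atime_eq_coatime_of_subset
    ((coatime_subset_atime_succ k (hj.trans hk)).trans (h1 k hk).le)
  refine ⟨h2, h2.symm.trans ?_⟩
  induction k, hk using Nat.le_induction with
  | base => rfl
  | succ k hk ih =>
    rw [h1 k hk]
    exact ih (atime_eq_coatime_of_subset
      ((coatime_subset_atime_succ k (hj.trans hk)).trans (h1 k hk).le))

/-- If level `0`, which is closed under complement, equals level `1`, then level `1` is closed under
complement. If level `j ≥ 1` equals level `j + 1`, then it contains the complements of its members,
which belong to level `j + 1`. -/
theorem TransferPair.collapse (h : TransferPair D C) {j k : ℕ} (hk : j ≤ k)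
    (hD : ATIME D j = ATIME D (j + 1) ∨ (1 ≤ j ∧ ATIME D j = coATIME D j)) :
    ATIME C k = coATIME C k ∧ coATIME C k = ATIME C j := by
  rcases hD with hD | ⟨hj, hD⟩
  · rcases Nat.eq_zero_or_pos j with rfl | hj
    · rcases Nat.eq_zero_or_pos k with rfl | hk
      · exact ⟨atime_zero_eq_coatime, atime_zero_eq_coatime.symm⟩
      · have h1 : ATIME D 1 = coATIME D 1 := by
          refine atime_eq_coatime fun L hL => ?_
          rw [zero_add] at hD
          rw [← hD] at hL ⊢
          exact compl_mem_atime_zero hL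
        obtain ⟨h2, h3⟩ := h.collapse_of_closed le_rfl hk h1
        exact ⟨h2, h3.trans ((h.atime_subset_atime hD.ge).antisymm (h.atime_subset_atime hD.le))⟩
    · refine h.collapse_of_closed hj hk (atime_eq_coatime_of_subset ?_)
      rw [hD]
      exact coatime_subset_atime_succ j hj
  · exact h.collapse_of_closed hj hk hD

end transfer

end AltTM

namespace AltTM

/-! ### Polynomial and iterated exponential bounds -/

section bounds

/-- Every bound in `F` is at most a bound in `F'`, up to a constant. -/
def Dominated (F F' : Set (ℕ → ℕ)) : Prop :=
  ∀ f ∈ F, ∃ f' ∈ F', ∃ b : ℕ, ∀ n, f n ≤ b * f' n + b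

theorem Dominated.exists_le {F F' : Set (ℕ → ℕ)} (h : Dominated F F') {f : ℕ → ℕ} (hf : f ∈ F)
    (b : ℕ) : ∃ f' ∈ F', ∃ b' : ℕ, ∀ n, b * f n + b ≤ b' * f' n + b' := by
  obtain ⟨f', hf', b', hb⟩ := h f hf
  refine ⟨f', hf', b * b' + b, fun n => ?_⟩
  have h1 := Nat.mul_le_mul_left b (hb n)
  nlinarith [Nat.zero_le (b * f' n)]

theorem Dominated.atime_subset {F F' : Set (ℕ → ℕ)} (h : Dominated F F') (j : ℕ) :
    ATIME F j ⊆ ATIME F' j := by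
  rintro L ⟨f, hf, b, M, h1, h2, h3⟩
  obtain ⟨f', hf', b', hb⟩ := h.exists_le hf b
  exact ⟨f', hf', b', M, h1, fun x t a c hr => (h2 x t a c hr).trans (hb _), h3⟩

theorem Dominated.space_subset {F F' : Set (ℕ → ℕ)} (h : Dominated F F') :
    SPACE F ⊆ SPACE F' := by
  rintro L ⟨f, hf, b, M, h1, h2, h3, h4⟩
  obtain ⟨f', hf', b', hb⟩ := h.exists_le hf b
  exact ⟨f', hf', b', M, h1, h2, fun x => (h3 x).trans (by exact_mod_cast hb _), h4⟩

/-- The linear bounds with a positive coefficient. -/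
def posLinearBounds : Set (ℕ → ℕ) := {f | ∃ a : ℕ, 1 ≤ a ∧ f = fun n => a * n}

/-- The functions `a * n ^ c` with positive `a` and `c`. -/
def monomialBounds : Set (ℕ → ℕ) :=
  {f | ∃ a c : ℕ, 1 ≤ a ∧ 1 ≤ c ∧ f = fun n => a * n ^ c}

/-- The `r` times iterated exponential function. -/
def iterExp (r m : ℕ) : ℕ := (fun m => 2 ^ m)^[r] m

/-- The time-constructible functions with a bound in `expBounds r`, except at `0` and `1`. From `2`
on, constant factors and terms are absorbed by the exponent; the values at `0` and `1` only
contribute to constants in `O`. -/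
def constructibleBounds (r : ℕ) : Set (ℕ → ℕ) :=
  {f | TimeConstructible f ∧ ∃ c, ∀ n, 2 ≤ n → f n ≤ iterExp r (n ^ c)}

theorem iterExp_succ (r m : ℕ) : iterExp (r + 1) m = 2 ^ iterExp r m :=
  Function.iterate_succ_apply' _ _ _

theorem iterExp_mono (r : ℕ) : Monotone (iterExp r) := by
  induction r with
  | zero => exact monotone_id
  | succ r ih =>
    intro m m' h
    rw [iterExp_succ, iterExp_succ]
    exact Nat.pow_le_pow_right (by omega) (ih h)

theorem le_iterExp (r m : ℕ) : m ≤ iterExp r m := by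
  induction r with
  | zero => exact le_rfl
  | succ r ih =>
    rw [iterExp_succ]
    exact ih.trans Nat.lt_two_pow_self.le

theorem add_le_mul_of_two_le {m n : ℕ} (hm : 2 ≤ m) (hn : 2 ≤ n) : m + n ≤ m * n := by
  nlinarith

theorem iterExp_mul_le (r : ℕ) {m n : ℕ} (hm : 2 ≤ m) (hn : 2 ≤ n) :
    iterExp r m * iterExp r n ≤ iterExp r (m * n) := by
  induction r with
  | zero => exact le_rfl
  | succ r ih =>
    rw [iterExp_succ, iterExp_succ, iterExp_succ, ← pow_add]
    exact Nat.pow_le_pow_right (by omega) ((add_le_mul_of_two_le (hm.trans (le_iterExp r m))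
      (hn.trans (le_iterExp r n))).trans ih)

theorem constructibleBounds_mul {r : ℕ} {f g : ℕ → ℕ} (hf : f ∈ constructibleBounds r)
    (hg : g ∈ constructibleBounds r) : f * g ∈ constructibleBounds r := by
  obtain ⟨hf, c, hc⟩ := hf
  obtain ⟨hg, d, hd⟩ := hg
  have hpow : ∀ n k : ℕ, 2 ≤ n → n ^ k ≤ n ^ (k + 1) ∧ 2 ≤ n ^ (k + 1) := fun n k hn =>
    ⟨Nat.pow_le_pow_right (by omega) (by omega), hn.trans (Nat.le_self_pow (by omega) n)⟩
  refine ⟨hf.mul hg, (c + 1) + (d + 1), fun n hn => ?_⟩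
  obtain ⟨h1, h2⟩ := hpow n c hn
  obtain ⟨h3, h4⟩ := hpow n d hn
  rw [pow_add]
  exact (Nat.mul_le_mul ((hc n hn).trans (iterExp_mono r h1))
    ((hd n hn).trans (iterExp_mono r h3))).trans (iterExp_mul_le r h2 h4)

theorem constructibleBounds_add {r : ℕ} {f g : ℕ → ℕ} (hf : f ∈ constructibleBounds r)
    (hg : g ∈ constructibleBounds r) : f + g ∈ constructibleBounds r := by
  obtain ⟨-, c, hc⟩ := constructibleBounds_mul hf hg
  refine ⟨hf.1.add hg.1, c, fun n hn => le_trans ?_ (hc n hn)⟩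
  exact add_le_mul_of_two_le (hn.trans (hf.1.1 n)) (hn.trans (hg.1.1 n))

/-- A set of functions that is closed under addition and multiplication is closed under
composition with monomials. -/
theorem monomial_comp_mem {C : Set (ℕ → ℕ)} (hadd : ∀ f ∈ C, ∀ g ∈ C, f + g ∈ C)
    (hmul : ∀ f ∈ C, ∀ g ∈ C, f * g ∈ C) {f g : ℕ → ℕ} (hg : g ∈ monomialBounds) (hf : f ∈ C) :
    g ∘ f ∈ C := by
  obtain ⟨a, c, ha, hc, rfl⟩ := hg
  have hpow : f ^ c ∈ C := by
    induction c, hc using Nat.le_induction with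
    | base => rwa [pow_one]
    | succ c _ ih => rw [pow_succ]; exact hmul _ ih _ hf
  have h : a • f ^ c ∈ C := by
    induction a, ha using Nat.le_induction with
    | base => rwa [one_nsmul]
    | succ a _ ih => rw [succ_nsmul]; exact hadd _ ih _ hpow
  exact h

theorem posLinearBounds_subset : posLinearBounds ⊆ monomialBounds := by
  rintro _ ⟨a, ha, rfl⟩
  exact ⟨a, 1, ha, le_rfl, by simp⟩

theorem transferPair_constructibleBounds (r : ℕ) {D : Set (ℕ → ℕ)}
    (h1 : posLinearBounds ⊆ D) (h2 : D ⊆ monomialBounds) :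
    TransferPair D (constructibleBounds r) where
  linear a ha := h1 ⟨a, ha, rfl⟩
  timeConstructible _ hf := hf.1
  add _ hf _ hg := constructibleBounds_add hf hg
  comp _ hg _ hf := monomial_comp_mem (fun _ h _ h' => constructibleBounds_add h h')
    (fun _ h _ h' => constructibleBounds_mul h h') (h2 hg) hf

theorem TimeConstructible.iterExp {f : ℕ → ℕ} (hf : TimeConstructible f) (r : ℕ) :
    TimeConstructible fun n => iterExp r (f n) := by
  induction r with
  | zero => exact hf
  | succ r ih => simpa only [iterExp_succ] using ih.two_pow

theorem iterExp_pow_mem (r : ℕ) {c : ℕ} (hc : 1 ≤ c) :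
    (fun n => iterExp r (n ^ c)) ∈ constructibleBounds r := by
  have h : TimeConstructible ((fun n => 1 * n ^ c) ∘ fun n => n) :=
    monomial_comp_mem (C := {f | TimeConstructible f}) (fun _ h _ h' => h.add h')
      (fun _ h _ h' => h.mul h') ⟨1, c, le_rfl, hc, rfl⟩ TimeConstructible.id
  simp only [Function.comp_def, one_mul] at h
  exact ⟨h.iterExp r, c, fun _ _ => le_rfl⟩

theorem dominated_constructibleBounds (r : ℕ) :
    Dominated (constructibleBounds r) (expBounds r) := by
  rintro f ⟨-, c, hc⟩
  refine ⟨_, ⟨c, rfl⟩, f 0 + f 1 + 1, fun n => ?_⟩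
  change f n ≤ _ * iterExp r (n ^ c) + _
  rcases n with _ | _ | n
  · omega
  · rw [zero_add]; omega
  · have := hc (n + 2) (by omega)
    nlinarith [Nat.zero_le ((f 0 + f 1) * iterExp r ((n + 2) ^ c))]

/-- The exponent `0` gives a constant bound, which is not time-constructible. -/
theorem dominated_expBounds (r : ℕ) : Dominated (expBounds r) (constructibleBounds r) := by
  rintro _ ⟨c, rfl⟩
  rcases Nat.eq_zero_or_pos c with rfl | hc
  · refine ⟨_, iterExp_pow_mem r le_rfl, iterExp r 1, fun n => ?_⟩
    change iterExp r (n ^ 0) ≤ _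
    rw [pow_zero]
    exact Nat.le_add_left _ _
  · refine ⟨_, iterExp_pow_mem r hc, 1, fun n => ?_⟩
    change iterExp r (n ^ c) ≤ _
    omega

theorem dominated_monomialBounds : Dominated monomialBounds (expBounds 0) := by
  rintro _ ⟨a, c, -, -, rfl⟩
  exact ⟨_, ⟨c, rfl⟩, a, fun n => Nat.le_add_right _ _⟩

theorem dominated_polynomial : Dominated (expBounds 0) monomialBounds := by
  rintro _ ⟨c, rfl⟩
  rcases Nat.eq_zero_or_pos c with rfl | hc
  · exact ⟨_, ⟨1, 1, le_rfl, le_rfl, rfl⟩, 1, fun n => by simp⟩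
  · exact ⟨_, ⟨1, c, le_rfl, hc, rfl⟩, 1, fun n => by simp⟩

theorem dominated_posLinearBounds : Dominated posLinearBounds linearBounds := by
  rintro _ ⟨a, -, rfl⟩
  exact ⟨_, ⟨a, rfl⟩, 1, fun n => by simp⟩

theorem dominated_linearBounds : Dominated linearBounds posLinearBounds := by
  rintro _ ⟨a, rfl⟩
  exact ⟨_, ⟨1, le_rfl, rfl⟩, a, fun n => by simp⟩

theorem Dominated.atime_eq {F F' : Set (ℕ → ℕ)} (h : Dominated F F') (h' : Dominated F' F)
    (j : ℕ) : ATIME F j = ATIME F' j := (h.atime_subset j).antisymm (h'.atime_subset j)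

/-- A collapse below the exponential hierarchies entails a collapse of them. -/
theorem collapsesTo_expBounds {F D : Set (ℕ → ℕ)} (h1 : posLinearBounds ⊆ D)
    (h2 : D ⊆ monomialBounds) (h3 : Dominated D F) (h4 : Dominated F D) {j : ℕ}
    (h : CollapsesTo F j) (r : ℕ) : CollapsesTo (expBounds r) j := by
  intro k hk
  have h5 : ATIME D j = ATIME D (j + 1) := by
    rw [h3.atime_eq h4, h3.atime_eq h4]
    exact h _ (Nat.le_succ j)
  obtain ⟨h6, h7⟩ := (transferPair_constructibleBounds r h1 h2).collapse hk (.inl h5)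
  have h8 := fun k => (dominated_expBounds r).atime_eq (dominated_constructibleBounds r) k
  rw [h8, h8]
  exact (h6.trans h7).symm

end bounds

end AltTM

theorem mainTheorem9 :
    (∀ (C D : Set (ℕ → ℕ)),
      (∀ a : ℕ, 1 ≤ a → (fun n => a * n) ∈ D) →
      (∀ f ∈ C, TimeConstructible f) →
      (∀ f ∈ C, ∀ g ∈ C, f + g ∈ C) →
      (∀ g ∈ D, ∀ f ∈ C, g ∘ f ∈ C) →
      ∀ j : ℕ,
        ((ATIME D j = ATIME D (j + 1) ∨ (1 ≤ j ∧ ATIME D j = coATIME D j)) →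
          ∀ k, j ≤ k → ATIME C k = coATIME C k ∧ coATIME C k = ATIME C j) ∧
        (ATIME D j = SPACE D → ATIME C j = SPACE C)) ∧
    (∀ j r : ℕ,
      (CollapsesTo (expBounds 0) j → CollapsesTo (expBounds r) j) ∧
      (CollapsesTo linearBounds j → CollapsesTo (expBounds r) j) ∧
      (SPACE (expBounds 0) ⊆ ATIME (expBounds 0) j →
        SPACE (expBounds r) ⊆ ATIME (expBounds r) j)) := by
  refine ⟨fun C D hlin htc hadd hcomp j => ?_, fun j r => ⟨fun h => ?_, fun h => ?_, fun h => ?_⟩⟩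
  · have hCD : TransferPair D C := ⟨hlin, htc, hadd, hcomp⟩
    exact ⟨fun h k hk => hCD.collapse hk h, fun h =>
      (hCD.atime_subset_space h.le).antisymm (hCD.space_subset_atime h.ge)⟩
  · exact collapsesTo_expBounds posLinearBounds_subset subset_rfl dominated_monomialBounds
      dominated_polynomial h r
  · exact collapsesTo_expBounds subset_rfl posLinearBounds_subset dominated_posLinearBounds
      dominated_linearBounds h r
  · have hCD := transferPair_constructibleBounds r posLinearBounds_subset subset_rfl
    have h1 : SPACE monomialBounds ⊆ ATIME monomialBounds j :=
      dominated_monomialBounds.space_subset.trans (h.trans (dominated_polynomial.atime_subset j))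
    exact (dominated_expBounds r).space_subset.trans ((hCD.space_subset_atime h1).trans
      ((dominated_constructibleBounds r).atime_subset j))
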